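/- Let $\boldsymbol{k}$ be a field of characteristic $0$. All vector spaces are $\mathbb{Z}$-graded over $\boldsymbol{k}$, and $|x|'=|x|-1$ is the shifted degree; for a word $\vec a=(a_1,\dots,a_p)$ of homogeneous elements put $|\vec a|'=\sum_i|a_i|'$. An $A_\infty$-algebra $A$ has operations $m_n:A[1]^{\otimes n}\to A[1]$, $n\ge 1$, of degree $1$ with $\sum_{\vec x=(\vec a,\vec b,\vec c)}(-1)^{|\vec a|'}m(\vec a,m(\vec b),\vec c)=0$ for all words $\vec x$. An $A_\infty$-homomorphism $f:A\to B$ has components $f_n:A[1]^{\otimes n}\to B[1]$, $n\ge1$, of degree $0$ with $\sum_{\vec x=(\vec a,\vec b,\vec c)}(-1)^{|\vec a|'}f(\vec a,m^A(\vec b),\vec c)=m^B(\widehat f(\vec x))$, where $\widehat f(\vec x)=\sum f(\vec x_1)\otimes\cdots\otimes f(\vec x_r)$ over all decompositions of $\vec x$ into non-empty consecutive blocks. It is a quasi-isomorphism if $f_1$ induces an isomorphism $H^\bullet(A)\to H^\bullet(B)$ of $m_1$-cohomologies. An $A_\infty$-bimodule map $\phi:A\to A^*$ of degree $d\in\mathbb{Z}$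 is a family of multilinear maps $\phi_{p,q}:A^{\otimes p}\otimes A\otimes A^{\otimes q}\to A^*$, $p,q\ge0$, with $\phi(\vec a,v,\vec b)(w)=0$ unless $|\vec a|'+|v|'+|\vec b|'+|w|'=d$, and such that for all homogeneous $\vec a,v,\vec b,w$ $$\sum(-1)^{|\vec a_1|'}\phi(\vec a_1,m(\vec a_2),\vec a_3,v,\vec b)(w)+\sum(-1)^{|\vec a_1|'}\phi(\vec a_1,m(\vec a_2,v,\vec b_1),\vec b_2)(w)+\sum(-1)^{|\vec a|'+|v|'+|\vec b_1|'}\phi(\vec a,v,\vec b_1,m(\vec b_2),\vec b_3)(w)$$ $$=-\sum(-1)^{e+|\vec a_1|'(e+|\vec b_2|'+|w|')}\phi(\vec a_2,v,\vec b_1)\bigl(m(\vec b_2,w,\vec a_1)\bigr),\qquad e=|\vec a_2|'+|v|'+|\vec b_1|',$$ where the sums run over all decompositions of $\vec a$ and $\vec b$ into consecutive, possibly empty, pieces (with $m$ of the empty word $=0$). It is a strong homotopy inner product if moreover 1. (skew symmetry) $\phi(\vec a,v,\vec b)(w)=-(-1)^{(|\vec a|'+|v|')(|\vec b|'+|w|')}\phi(\vec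 b,w,\vec a)(v)$; 2. (closedness) for every family $(a_1,\dots,a_{l+1})$ of homogeneous elements and all $1\le i<j<k\le l+1$, $$(-1)^{K_j}\phi(\dots,\underline{a_i},\dots)(a_j)+(-1)^{K_k}\phi(\dots,\underline{a_j},\dots)(a_k)+(-1)^{K_i}\phi(\dots,\underline{a_k},\dots)(a_i)=0,$$ where the underlined element is the bimodule argument, the arguments of each term followed by its last entry list the family in its cyclic order, and $K_t=(|a_1|'+\cdots+|a_t|')(|a_{t+1}|'+\cdots+|a_{l+1}|')$; 3. (homological non-degeneracy) for every $[a]\neq0$ in $H^\bullet(A)$ there is $[b]\in H^\bullet(A)$ with $\phi_{0,0}(a)(b)\ne0$. For an $A_\infty$-homomorphism $f:A\to B$ and an $A_\infty$-bimodule map $\phi:B\to B^*$, the pullback $f^*\phi=\widetilde f^*\circ\widehat\phi\circ\widehat{\widetilde f}$ (with $\widetilde f_{p,q}=f_{p+1+q}$) is $$(f^*\phi)(\vec a,v,\vec b)(w)=\sum(-1)^{|\vec a_1|'(|\vec a_2|'+|\vec a_3|'+|v|'+|\vec b|'+|w|')}\,\phi\bigl(\widehat f(\vec a_2),f(\vec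 a_3,v,\vec b_1),\widehat f(\vec b_2)\bigr)\bigl(f(\vec b_3,w,\vec a_1)\bigr),$$ summed over $\vec a=(\vec a_1,\vec a_2,\vec a_3)$, $\vec b=(\vec b_1,\vec b_2,\vec b_3)$. A cyclic inner product of degree $d$ on an $A_\infty$-algebra $C$ is a non-degenerate bilinear form with $\langle x,y\rangle=0$ unless $|x|'+|y|'=d$, $\langle x,y\rangle=-(-1)^{|x|'|y|'}\langle y,x\rangle$ and $\langle m_n(x_1,\dots,x_n),x_{n+1}\rangle=(-1)^{|x_1|'(|x_2|'+\cdots+|x_{n+1}|')}\langle m_n(x_2,\dots,x_{n+1}),x_1\rangle$ for $n\ge1$; it is regarded as a family $\psi:C\to C^*$ with $\psi_{0,0}=\langle\,,\rangle$ and $\psi_{p,q}=0$ otherwise. Strong homotopy inner products $\phi$ on $A$ and $\phi'$ on $B$ of degree $d$ are equivalent if there are an $A_\infty$-algebra $C$ with a cyclic inner product $\psi$ of degree $d$ and $A_\infty$-quasi-isomorphisms $g:C\to A$, $h:C\to B$ with $g^*\phi=\psi=h^*\phi'$. **Proposition.** Let $A,B$ be $A_\infty$-algebras with $H^\bullet(B)$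 finite dimensional, let $\phi:B\to B^*$ be a strong homotopy inner product of degree $d$, and let $f:A\to B$ be an $A_\infty$-quasi-isomorphism. Then $f^*\phi$ is a strong homotopy inner product of degree $d$ on $A$, and it is equivalent to $\phi$. -/

import Mathlib

universe u v

namespace AInf

section Words

variable {k : Type u} [Field k] {V : Type v} [AddCommGroup V] [Module k V]

/-- A homogeneous element of a graded vector space `V = ⨁ n, gr n`, together with its degree. -/
abbrev Homog (gr : ℤ → Submodule k V) : Type v := Σ n : ℤ, gr n

/-- The underlying vector of a homogeneous element. -/
def Homog.val {gr : ℤ → Submodule k V} (x : Homog gr) : V := (x.2 : V)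

/-- A word `x₁ ⊗ ⋯ ⊗ xₙ` of homogeneous elements. -/
abbrev Word (gr : ℤ → Submodule k V) : Type v := List (Homog gr)

/-- The total degree `|x₁|' + ⋯ + |xₙ|'` of a word. -/
def Word.deg {gr : ℤ → Submodule k V} (w : Word gr) : ℤ := (w.map Sigma.fst).sum

/-- The list of the underlying vectors of a word. -/
def Word.vals {gr : ℤ → Submodule k V} (w : Word gr) : List V := w.map Homog.val

/-- Evaluation of a sequence of multilinear maps `F n : V^{⊗ n} → W` on a list of vectors. -/
def evalList {W : Type v} [AddCommGroup W] [Module k W]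
    (F : ∀ n : ℕ, MultilinearMap k (fun _ : Fin n => V) W) (l : List V) : W :=
  F l.length l.get

end Words

/-- The sum of `F a b` over all ways to write `w = a ++ b`. -/
def sum₂ {α : Type*} {M : Type*} [AddCommMonoid M] (w : List α) (F : List α → List α → M) : M :=
  ∑ i ∈ Finset.range (w.length + 1), F (w.take i) (w.drop i)

/-- The sum of `F a b c` over all ways to write `w = a ++ b ++ c`. -/
def sum₃ {α : Type*} {M : Type*} [AddCommMonoid M] (w : List α)
    (F : List α → List α → List α → M) : M :=
  sum₂ w fun a r => sum₂ r fun b c => F a b c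

/-- An (unfiltered, uncurved) `A_∞`-algebra on the `k`-vector space `V`. The grading is recorded
through the shifted degree `|x|' = |x| - 1`: `gr n` is `V[1]ⁿ`, the part of unshifted degree
`n + 1`. The operations `m_n`, `n ≥ 1`, have degree `1` for the shifted degree (so `2 - n` for the
unshifted one) and satisfy the `A_∞`-equations with Koszul signs. -/
structure Algebra (k : Type u) [Field k] (V : Type v) [AddCommGroup V] [Module k V] where
  gr : ℤ → Submodule k V
  internal : DirectSum.IsInternal gr
  m : ∀ n : ℕ, MultilinearMap k (fun _ : Fin n => V) V
  m_zero : m 0 = 0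
  m_deg : ∀ w : Word gr, evalList m w.vals ∈ gr (w.deg + 1)
  m_rel : ∀ w : Word gr,
    sum₃ w (fun a b c =>
      (Word.deg a).negOnePow •
        evalList m (Word.vals a ++ evalList m (Word.vals b) :: Word.vals c)) = 0

section Basic

variable {k : Type u} [Field k]
variable {V : Type v} [AddCommGroup V] [Module k V]
variable {W : Type v} [AddCommGroup W] [Module k W]

/-- `m(x₁, …, xₙ)` as a homogeneous element, of degree `|x₁|' + ⋯ + |xₙ|' + 1`. -/
def Algebra.op (A : Algebra k V) (w : Word A.gr) : Homog A.gr :=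
  ⟨w.deg + 1, ⟨evalList A.m w.vals, A.m_deg w⟩⟩

/-- The first operation `m₁` as a linear map. -/
def Algebra.d (A : Algebra k V) : V →ₗ[k] V :=
  (A.m 1).toLinearMap (fun _ => 0) 0

/-- The cohomology `H^•(A) = ker m₁ / im m₁`. -/
abbrev Algebra.Cohomology (A : Algebra k V) : Type v :=
  (LinearMap.ker A.d) ⧸ (LinearMap.range A.d).submoduleOf (LinearMap.ker A.d)

/-- An `A_∞`-homomorphism `f : A → B`: maps `f_n : A[1]^{⊗ n} → B[1]`, `n ≥ 1`, of degree `0` with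
`f ∘ m̂^A = m^B ∘ f̂`. -/
structure Hom (A : Algebra k V) (B : Algebra k W) where
  f : ∀ n : ℕ, MultilinearMap k (fun _ : Fin n => V) W
  f_zero : f 0 = 0
  f_deg : ∀ w : Word A.gr, evalList f w.vals ∈ B.gr w.deg
  f_rel : ∀ w : Word A.gr,
    sum₃ w (fun a b c =>
      (Word.deg a).negOnePow •
        evalList f (Word.vals a ++ evalList A.m (Word.vals b) :: Word.vals c)) =
    ∑ c : Composition w.length,
      evalList B.m ((w.splitWrtComposition c).map fun u => evalList f (Word.vals u))

variable {A : Algebra k V} {B : Algebra k W}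

/-- `f(x₁, …, xₙ)` as a homogeneous element, of degree `|x₁|' + ⋯ + |xₙ|'`. -/
def Hom.op (F : Hom A B) (w : Word A.gr) : Homog B.gr :=
  ⟨w.deg, ⟨evalList F.f w.vals, F.f_deg w⟩⟩

/-- The linear part `f₁` of an `A_∞`-homomorphism. -/
def Hom.linear (F : Hom A B) : V →ₗ[k] W :=
  (F.f 1).toLinearMap (fun _ => 0) 0

theorem Algebra.evalList_m_nil (A : Algebra k V) : evalList A.m [] = 0 := by
  change A.m 0 _ = 0
  rw [A.m_zero]; rfl

theorem Algebra.evalList_m_singleton (A : Algebra k V) (x : V) : evalList A.m [x] = A.d x := by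
  change A.m 1 _ = A.m 1 _
  congr 1
  ext i
  fin_cases i
  simp

theorem Hom.evalList_f_singleton (F : Hom A B) (x : V) : evalList F.f [x] = F.linear x := by
  change F.f 1 _ = F.f 1 _
  congr 1
  ext i
  fin_cases i
  simp

theorem evalList_pair_zero (F : ∀ n : ℕ, MultilinearMap k (fun _ : Fin n => V) W) (x : V) :
    evalList F [0, x] = 0 ∧ evalList F [x, 0] = 0 :=
  ⟨(F 2).map_coord_zero (0 : Fin 2) rfl, (F 2).map_coord_zero (1 : Fin 2) rfl⟩

/-- `f₁` is a chain map. -/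
theorem Hom.linear_comm (F : Hom A B) (x : V) : F.linear (A.d x) = B.d (F.linear x) := by
  have key : ∀ (n : ℤ) (y : A.gr n), F.linear (A.d y) = B.d (F.linear y) := by
    intro n y
    have h := F.f_rel [⟨n, y⟩]
    have hc : ∀ c : Composition 1, c = Composition.ones 1 := fun c =>
      Fintype.card_le_one_iff.1 (by rw [composition_card]; simp) c _
    have hs : ∀ c : Composition [(⟨n, y⟩ : Homog A.gr)].length,
        [(⟨n, y⟩ : Homog A.gr)].splitWrtComposition c = [[⟨n, y⟩]] := by
      intro c
      rw [show c = Composition.ones 1 from hc c]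
      rfl
    simp only [hs, Finset.sum_const] at h
    simpa [sum₃, sum₂, Finset.sum_range_succ, Word.vals, Homog.val, Word.deg,
      A.evalList_m_nil, (evalList_pair_zero F.f _).1, (evalList_pair_zero F.f _).2,
      A.evalList_m_singleton, B.evalList_m_singleton, F.evalList_f_singleton,
      composition_card] using h
  have hx : x ∈ ⨆ n, A.gr n := by
    rw [A.internal.submodule_iSup_eq_top]; trivial
  induction hx using Submodule.iSup_induction' with
  | mem n y hy => exact key n ⟨y, hy⟩
  | zero => simp
  | add y z _ _ hy hz => simp only [map_add, hy, hz]

/-- The map `H^•(A) → H^•(B)` induced by `f₁`. -/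
def Hom.cohomologyMap (F : Hom A B) : A.Cohomology →ₗ[k] B.Cohomology :=
  Submodule.mapQ _ _
    (F.linear.restrict (p := LinearMap.ker A.d) (q := LinearMap.ker B.d) (fun x hx => by
      rw [LinearMap.mem_ker] at hx ⊢
      rw [← F.linear_comm, hx, map_zero]))
    (by
      rintro ⟨x, hx⟩ ⟨y, hy⟩
      exact ⟨F.linear y, by rw [← F.linear_comm, hy]; rfl⟩)

/-- `f` is an `A_∞`-quasi-isomorphism: `f₁` induces an isomorphism on cohomology. -/
def Hom.IsQuasiIso (F : Hom A B) : Prop := Function.Bijective F.cohomologyMap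

end Basic

section Bimodules

variable {k : Type u} [Field k]
variable {V : Type v} [AddCommGroup V] [Module k V]
variable {W : Type v} [AddCommGroup W] [Module k W]

/-- The data of a family `φ_{p,q} : A^{⊗ p} ⊗ M ⊗ A^{⊗ q} → N^*`, given by its values
`φ_{p,q}(a₁, …, a_p, v, b₁, …, b_q)(w)` on homogeneous arguments. Here `grA`, `grM`, `grN` are the
gradings of `A`, `M`, `N`. Multilinearity is imposed separately (`IsMultilinear`). -/
abbrev PreMap {VA VM VN : Type v} [AddCommGroup VA] [Module k VA] [AddCommGroup VM] [Module k VM]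
    [AddCommGroup VN] [Module k VN]
    (grA : ℤ → Submodule k VA) (grM : ℤ → Submodule k VM) (grN : ℤ → Submodule k VN) : Type _ :=
  Word grA → Homog grM → Word grA → Homog grN → k

/-- A family `φ_{p,q} : A^{⊗ p} ⊗ A ⊗ A^{⊗ q} → A^*`. -/
abbrev DualMap (A : Algebra k V) : Type _ := PreMap A.gr A.gr A.gr

/-- `φ_{p,q}(a, v, b)(w)` is linear in each of its `p + q + 2` arguments. -/
structure IsMultilinear {A : Algebra k V} (φ : DualMap A) : Prop where
  left : ∀ (a₁ a₂ : Word A.gr) (n : ℤ) (c : k) (x y : A.gr n) (v : Homog A.gr) (b : Word A.gr)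
    (w : Homog A.gr),
    φ (a₁ ++ ⟨n, c • x + y⟩ :: a₂) v b w =
      c * φ (a₁ ++ ⟨n, x⟩ :: a₂) v b w + φ (a₁ ++ ⟨n, y⟩ :: a₂) v b w
  mid : ∀ (a : Word A.gr) (n : ℤ) (c : k) (x y : A.gr n) (b : Word A.gr) (w : Homog A.gr),
    φ a ⟨n, c • x + y⟩ b w = c * φ a ⟨n, x⟩ b w + φ a ⟨n, y⟩ b w
  right : ∀ (a : Word A.gr) (v : Homog A.gr) (b₁ b₂ : Word A.gr) (n : ℤ) (c : k) (x y : A.gr n)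
    (w : Homog A.gr),
    φ a v (b₁ ++ ⟨n, c • x + y⟩ :: b₂) w =
      c * φ a v (b₁ ++ ⟨n, x⟩ :: b₂) w + φ a v (b₁ ++ ⟨n, y⟩ :: b₂) w
  last : ∀ (a : Word A.gr) (v : Homog A.gr) (b : Word A.gr) (n : ℤ) (c : k) (x y : A.gr n),
    φ a v b ⟨n, c • x + y⟩ = c * φ a v b ⟨n, x⟩ + φ a v b ⟨n, y⟩

/-- The dual `A_∞`-bimodule structure of `A` on `A^*`, applied to a functional `ξ` of degree `e`:
`m^*(a, ξ, b)(w) = -(-1)^{e + |a|'(e + |b|' + |w|')} ξ(m(b, w, a))`. -/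
def Algebra.dualOp (A : Algebra k V) (a : Word A.gr) (e : ℤ) (ξ : Homog A.gr → k) (b : Word A.gr)
    (w : Homog A.gr) : k :=
  -((e + a.deg * (e + b.deg + w.1)).negOnePow • ξ (A.op (b ++ w :: a)))

/-- `(φ ∘ m̂)(a, v, b)(w)`, where `A` is regarded as an `A_∞`-bimodule over itself by
`m_{p,q} = m_{p+1+q}`. -/
def DualMap.compOp {A : Algebra k V} (φ : DualMap A) : DualMap A := fun a v b w =>
  sum₃ a (fun a₁ a₂ a₃ => (Word.deg a₁).negOnePow • φ (a₁ ++ A.op a₂ :: a₃) v b w) +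
  sum₂ a (fun a₁ a₂ => sum₂ b (fun b₁ b₂ =>
    (Word.deg a₁).negOnePow • φ a₁ (A.op (a₂ ++ v :: b₁)) b₂ w)) +
  sum₃ b (fun b₁ b₂ b₃ =>
    (Word.deg a + v.1 + Word.deg b₁).negOnePow • φ a v (b₁ ++ A.op b₂ :: b₃) w)

/-- `(m^* ∘ φ̂)(a, v, b)(w)`. -/
def DualMap.dualOpComp {A : Algebra k V} (φ : DualMap A) : DualMap A := fun a v b w =>
  sum₂ a (fun a₁ a₂ => sum₂ b (fun b₁ b₂ =>
    A.dualOp a₁ (Word.deg a₂ + v.1 + Word.deg b₁) (φ a₂ v b₁) b₂ w))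

/-- `φ : A → A^*` is an `A_∞`-bimodule map of degree `d`, meaning that `φ(a, v, b)(w)` vanishes
unless `|a|' + |v|' + |b|' + |w|' = d`. (For odd `d` the additional Koszul signs coming from the
degree of `φ` cancel each other, so that the equation has the same form for all `d`.) -/
structure IsBimoduleMap {A : Algebra k V} (d : ℤ) (φ : DualMap A) : Prop where
  multilinear : IsMultilinear φ
  degree : ∀ (a : Word A.gr) (v : Homog A.gr) (b : Word A.gr) (w : Homog A.gr),
    a.deg + v.1 + b.deg + w.1 ≠ d → φ a v b w = 0
  equation : φ.compOp = φ.dualOpComp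

/-- Skew symmetry. -/
def IsSkew {A : Algebra k V} (φ : DualMap A) : Prop :=
  ∀ (a : Word A.gr) (v : Homog A.gr) (b : Word A.gr) (w : Homog A.gr),
    φ a v b w = -(((a.deg + v.1) * (b.deg + w.1)).negOnePow • φ b w a v)

/-- Closedness. The family `(a₁, …, a_{l+1})` is `(p, x, q, y, r, z, s)` with `x = a_i`, `y = a_j`,
`z = a_k`, `i < j < k`. Each of the three terms lists the family in its cyclic order, and carries
the Koszul sign of the rotation that leads to it. -/
def IsClosed {A : Algebra k V} (φ : DualMap A) : Prop :=
  ∀ (p q r s : Word A.gr) (x y z : Homog A.gr),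
    ((p.deg + x.1 + q.deg + y.1) * (r.deg + z.1 + s.deg)).negOnePow •
        φ (r ++ z :: (s ++ p)) x q y +
    ((p.deg + x.1 + q.deg + y.1 + r.deg + z.1) * s.deg).negOnePow •
        φ (s ++ p ++ x :: q) y r z +
    ((p.deg + x.1) * (q.deg + y.1 + r.deg + z.1 + s.deg)).negOnePow •
        φ (q ++ y :: r) z (s ++ p) x = 0

/-- Homological non-degeneracy: every non-zero class `[a]` of `H^•(A)` pairs non-trivially under
`φ_{0,0}` with some class `[b]`. -/
def IsHomNondegenerate {A : Algebra k V} (φ : DualMap A) : Prop :=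
  ∀ a : Homog A.gr, A.d a.val = 0 → a.val ∉ LinearMap.range A.d →
    ∃ b : Homog A.gr, A.d b.val = 0 ∧ φ [] a [] b ≠ 0

/-- A strong homotopy inner product (of degree `d`) on `A`. -/
structure IsStrongHomotopyInnerProduct {A : Algebra k V} (d : ℤ) (φ : DualMap A) : Prop where
  bimoduleMap : IsBimoduleMap d φ
  skew : IsSkew φ
  closed : IsClosed φ
  nondegenerate : IsHomNondegenerate φ

variable {A : Algebra k V} {B : Algebra k W}

/-- `φ : B → B^*` regarded as a map of bimodules over `A` along `f`:
`(a, v, b) ↦ φ(f̂(a), v, f̂(b))`, where `f̂(x₁, …, xₙ)` is the sum of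
`f(x₁, …) ⊗ ⋯ ⊗ f(…, xₙ)` over all decompositions of the word into non-empty blocks. -/
def Hom.restrict (F : Hom A B) (φ : DualMap B) : PreMap A.gr B.gr B.gr := fun a v b w =>
  ∑ c : Composition a.length, ∑ c' : Composition b.length,
    φ ((a.splitWrtComposition c).map F.op) v ((b.splitWrtComposition c').map F.op) w

/-- The bimodule map `f̃ : A → B` over `A` induced by `f`, `f̃_{p,q} = f_{p+1+q}`. -/
def Hom.tilde (F : Hom A B) (a : Word A.gr) (v : Homog A.gr) (b : Word A.gr) : Homog B.gr :=
  F.op (a ++ v :: b)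

/-- The dual bimodule map `f̃^* : B^* → A^*`, applied to a functional `ξ` of degree `e`:
`f̃^*(a, ξ, b)(w) = (-1)^{|a|'(e + |b|' + |w|')} ξ(f̃(b, w, a))`. -/
def Hom.tildeDual (F : Hom A B) (a : Word A.gr) (e : ℤ) (ξ : Homog B.gr → k) (b : Word A.gr)
    (w : Homog A.gr) : k :=
  (a.deg * (e + b.deg + w.1)).negOnePow • ξ (F.tilde b w a)

/-- The composition `χ ∘ f̃` (that is `χ ∘ f̃^` on the bar complexes), for `χ : B → B^*`. -/
def Hom.compTilde (F : Hom A B) (χ : PreMap A.gr B.gr B.gr) : PreMap A.gr A.gr B.gr :=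
  fun a v b w =>
    sum₂ a (fun a₁ a₂ => sum₂ b (fun b₁ b₂ => χ a₁ (F.tilde a₂ v b₁) b₂ w))

/-- The composition `f̃^* ∘ χ̂`, for `χ : A → B^*`. -/
def Hom.tildeDualComp (F : Hom A B) (χ : PreMap A.gr A.gr B.gr) : DualMap A := fun a v b w =>
  sum₂ a (fun a₁ a₂ => sum₂ b (fun b₁ b₂ =>
    F.tildeDual a₁ (Word.deg a₂ + v.1 + Word.deg b₁) (χ a₂ v b₁) b₂ w))

/-- The pullback `f^*φ = f̃^* ∘ φ̂ ∘ f̃`. -/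
def Hom.pullback (F : Hom A B) (φ : DualMap B) : DualMap A :=
  F.tildeDualComp (F.compTilde (F.restrict φ))

/-- A cyclic inner product (of degree `d`) on `A`. -/
structure IsCyclicInnerProduct (A : Algebra k V) (d : ℤ) (β : V →ₗ[k] V →ₗ[k] k) : Prop where
  degree : ∀ x y : Homog A.gr, x.1 + y.1 ≠ d → β x.val y.val = 0
  skew : ∀ x y : Homog A.gr, β x.val y.val = -((x.1 * y.1).negOnePow • β y.val x.val)
  nondegenerate : ∀ x : V, (∀ y : V, β x y = 0) → x = 0
  cyclic : ∀ (x : Homog A.gr) (u : Word A.gr) (y : Homog A.gr),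
    β (A.op (x :: u)).val y.val =
      (x.1 * (u.deg + y.1)).negOnePow • β (A.op (u ++ [y])).val x.val

/-- The bimodule map `A → A^*` given by an inner product: only its `(0,0)`-component is
non-zero. -/
def ofInnerProduct (A : Algebra k V) (β : V →ₗ[k] V →ₗ[k] k) : DualMap A
  | [], v, [], w => β v.val w.val
  | _, _, _, _ => 0

/-- Equivalence of strong homotopy inner products `φ` on `A` and `ψ` on `B` (of degree `d`): there
are a cyclic `A_∞`-algebra `C` and `A_∞`-quasi-isomorphisms `g : C → A`, `h : C → B` that pull both
`φ` and `ψ` back to the cyclic inner product of `C`. -/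
def Equivalent (d : ℤ) (φ : DualMap A) (ψ : DualMap B) : Prop :=
  ∃ (U : Type v) (_ : AddCommGroup U) (_ : Module k U) (C : Algebra k U)
    (β : U →ₗ[k] U →ₗ[k] k) (G : Hom C A) (H : Hom C B),
    IsCyclicInnerProduct C d β ∧ G.IsQuasiIso ∧ H.IsQuasiIso ∧
      G.pullback φ = ofInnerProduct C β ∧ H.pullback ψ = ofInnerProduct C β

end Bimodules

end AInf

set_option linter.unusedSectionVars false

/-! Read the operations `m` as an odd vector field on a formal noncommutative space and `φ` as a
two-form on it: a function of a cyclic word with two marked letters. Skew symmetry and closedness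
say that `φ` is a closed two-form; the bimodule equation says that its Lie derivative along `m` is
zero. In characteristic 0 a closed form has a primitive, `φ = dα` (`dForm_primitive`), where `α` is
a function of a cyclic word with one marked letter. This replaces the pullback of two-forms, with
its many signs, by that of one-forms.

Pullback commutes with `d` (`pull₂_dForm`), with Lie derivatives along intertwined vector fields
(`pull₁_lie`) and with composition (`pull₁_pull₁`), and on exact forms the bimodule defect is `d` of
the Lie derivative of `α` (`lie_dForm`). Hence `f^*φ = d(f^*α)` is skew and closed because it is
exact, and it satisfies the bimodule equation because the defect of `φ` pulls back to its own
defect. Non-degeneracy involves only `φ_{0,0}` and the isomorphism induced by `f₁` on cohomology.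

For the equivalence, a cyclic minimal model `G : C → A` of `f^*φ` suffices: the pair `G`, `f ∘ G`
then pulls both forms back to the same cyclic inner product. The model lives on the cohomology of
`A` and is built by induction on word length `n`. Homotopy transfer chooses `m_n` and `g_n` so that
the homomorphism equation holds in length `n`. A Darboux correction then adds to `g_n` a term with
values in chosen cycles, which does not affect that equation, and which kills the components of
`g^*φ` with `n + 1` arguments. The correction is the vector dual to `-g^*α` under the non-degenerate
form on the finite dimensional cohomology. In the limit `g^*φ` is constant, and its bimodule
equation is precisely cyclicity of `C`. -/

namespace AInf

/-! ### Sums over deconcatenations of words -/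

section Splittings

variable {α β γ : Type*} {M N : Type*} [AddCommMonoid M] [AddCommMonoid N]

@[simp]
theorem sum₂_nil (F : List α → List α → M) : sum₂ [] F = F [] [] := by
  simp [sum₂]

theorem sum₂_cons (x : α) (w : List α) (F : List α → List α → M) :
    sum₂ (x :: w) F = F [] (x :: w) + sum₂ w fun a b => F (x :: a) b := by
  simp only [sum₂, List.length_cons]
  rw [Finset.sum_range_succ', add_comm]
  simp

theorem sum₂_congr {w : List α} {F G : List α → List α → M}
    (h : ∀ a b, a ++ b = w → F a b = G a b) : sum₂ w F = sum₂ w G :=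
  Finset.sum_congr rfl fun i _ => h _ _ (List.take_append_drop i w)

theorem sum₂_add (w : List α) (F G : List α → List α → M) :
    sum₂ w (fun a b => F a b + G a b) = sum₂ w F + sum₂ w G :=
  Finset.sum_add_distrib

@[simp]
theorem sum₂_zero (w : List α) : sum₂ w (fun _ _ => (0 : M)) = 0 :=
  Finset.sum_const_zero

theorem map_sum₂ {E : Type*} [FunLike E M N] [AddMonoidHomClass E M N] (e : E)
    (w : List α) (F : List α → List α → M) :
    e (sum₂ w F) = sum₂ w fun a b => e (F a b) :=
  map_sum e _ _

theorem smul_sum₂ {R : Type*} [DistribSMul R M] (r : R) (w : List α)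
    (F : List α → List α → M) : r • sum₂ w F = sum₂ w fun a b => r • F a b :=
  Finset.smul_sum

theorem sum₂_comm (w : List α) (w' : List β) (F : List α → List α → List β → List β → M) :
    sum₂ w (fun a b => sum₂ w' fun c d => F a b c d) =
      sum₂ w' fun c d => sum₂ w fun a b => F a b c d :=
  Finset.sum_comm

theorem sum₂_append_cons (p q : List α) (x : α) (F : List α → List α → M) :
    sum₂ (p ++ x :: q) F =
      sum₂ p (fun a b => F a (b ++ x :: q)) + sum₂ q fun a b => F (p ++ x :: a) b := by
  induction p generalizing F with
  | nil => simp [sum₂_cons]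
  | cons y p ih => simp [sum₂_cons, ih, add_assoc]

/-- Both sides sum over all ways to cut a word into three pieces. -/
theorem sum₂_assoc (w : List α) (F : List α → List α → List α → M) :
    sum₂ w (fun l c => sum₂ l fun a b => F a b c) = sum₂ w fun a r => sum₂ r fun b c => F a b c := by
  induction w generalizing F with
  | nil => simp
  | cons x w ih =>
    simp only [sum₂_cons, sum₂_nil, sum₂_add, ih]
    rw [← add_assoc]

theorem sum₂_eq_left {w : List α} {F : List α → List α → M}
    (h : ∀ a b, a ++ b = w → a ≠ [] → F a b = 0) : sum₂ w F = F [] w := by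
  cases w with
  | nil => simp
  | cons x w =>
    rw [sum₂_cons, sum₂_congr (G := fun _ _ => 0), sum₂_zero, add_zero]
    intro a b hab
    exact h _ _ (by simp [hab]) (by simp)

theorem sum₂_eq_right {w : List α} {F : List α → List α → M}
    (h : ∀ a b, a ++ b = w → b ≠ [] → F a b = 0) : sum₂ w F = F w [] := by
  induction w generalizing F with
  | nil => simp
  | cons x w ih =>
    rw [sum₂_cons, h [] (x :: w) rfl (by simp), zero_add]
    exact ih fun a b hab hb => h _ _ (by simp [hab]) hb

theorem sum₃_cons (x : α) (w : List α) (F : List α → List α → List α → M) :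
    sum₃ (x :: w) F = F [] [] (x :: w) + sum₂ w (fun b c => F [] (x :: b) c) +
      sum₃ w fun a b c => F (x :: a) b c := by
  simp only [sum₃, sum₂_cons]

theorem sum₃_congr {w : List α} {F G : List α → List α → List α → M}
    (h : ∀ a b c, a ++ (b ++ c) = w → F a b c = G a b c) : sum₃ w F = sum₃ w G :=
  sum₂_congr fun a r har => sum₂_congr fun b c hbc => h a b c (by rw [hbc, har])

theorem sum₃_add (w : List α) (F G : List α → List α → List α → M) :
    sum₃ w (fun a b c => F a b c + G a b c) = sum₃ w F + sum₃ w G := by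
  simp only [sum₃, sum₂_add]

@[simp]
theorem sum₃_zero (w : List α) : sum₃ w (fun _ _ _ => (0 : M)) = 0 := by
  simp only [sum₃, sum₂_zero]

theorem map_sum₃ {E : Type*} [FunLike E M N] [AddMonoidHomClass E M N] (e : E)
    (w : List α) (F : List α → List α → List α → M) :
    e (sum₃ w F) = sum₃ w fun a b c => e (F a b c) := by
  simp only [sum₃, map_sum₂]

theorem smul_sum₃ {R : Type*} [DistribSMul R M] (r : R) (w : List α)
    (F : List α → List α → List α → M) : r • sum₃ w F = sum₃ w fun a b c => r • F a b c := by
  simp only [sum₃, smul_sum₂]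

theorem sum₃_eq_mid {w : List α} {F : List α → List α → List α → M}
    (h : ∀ a b c, a ++ (b ++ c) = w → b ≠ w → F a b c = 0) : sum₃ w F = F [] w [] := by
  rw [sum₃, sum₂_eq_left, sum₂_eq_right]
  · intro b c hbc hc
    exact h _ _ _ hbc (by rintro rfl; simp_all)
  · intro a r har ha
    rw [← sum₂_zero r]
    refine sum₂_congr fun b c hbc => h _ _ _ (by rw [hbc, har]) ?_
    rintro rfl
    subst hbc
    have := congrArg List.length har
    simp only [List.length_append] at this
    exact ha (List.length_eq_zero_iff.1 (by omega))

end Splittings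

/-! ### The coalgebra map induced by a family of operations -/

section Hat

variable {α β γ : Type*} {M N : Type*} [AddCommMonoid M] [AddCommMonoid N]

/-- The value of a function `G` of words on `f̂(w)`: the sum of `G(f(u₁), …, f(u_r))` over all
decompositions of `w` into non-empty blocks. -/
def hat (op : List α → β) (G : List β → M) (w : List α) : M :=
  ∑ c : Composition w.length, G ((w.splitWrtComposition c).map op)

@[simp]
theorem hat_nil (op : List α → β) (G : List β → M) : hat op G [] = G [] := by
  have : ∀ c : Composition 0, c = Composition.ones 0 := fun c =>
    Fintype.card_le_one_iff.1 (by rw [composition_card]; simp) c _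
  change ∑ c : Composition 0, _ = _
  rw [Fintype.sum_eq_single (Composition.ones 0) fun c hc => (hc (this c)).elim]
  rfl

/-- Splits off the first block, of size `i + 1`; the remaining blocks form a composition of `n - i`.
-/
theorem sum_composition_succ (n : ℕ) (H : List ℕ → M) :
    ∑ c : Composition (n + 1), H c.blocks =
      ∑ i ∈ Finset.range (n + 1), ∑ c : Composition (n - i), H ((i + 1) :: c.blocks) := by
  rw [Finset.sum_range fun i => ∑ c : Composition (n - i), H ((i + 1) :: c.blocks),
    ← Fintype.sum_sigma']
  symm
  refine Fintype.sum_bijective (fun x : Σ i : Fin (n + 1), Composition (n - i) =>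
    (⟨(x.1 + 1) :: x.2.blocks, ?_, ?_⟩ : Composition (n + 1))) ⟨?_, ?_⟩ _ _ fun x => rfl
  · intro i hi
    rcases List.mem_cons.1 hi with rfl | hi
    · omega
    · exact x.2.blocks_pos hi
  · rw [List.sum_cons, x.2.blocks_sum]
    omega
  · rintro ⟨⟨i, hi⟩, c⟩ ⟨⟨j, hj⟩, c'⟩ h
    simp only [Composition.mk.injEq, List.cons.injEq, add_left_inj] at h
    obtain ⟨rfl, h⟩ := h
    rw [Composition.ext h]
  · rintro ⟨_ | ⟨k, ks⟩, hpos, hsum⟩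
    · simp at hsum
    · have hk : 0 < k := hpos (by simp)
      simp only [List.sum_cons] at hsum
      refine ⟨⟨⟨k - 1, by omega⟩, ⟨ks, fun h => hpos (by simp [h]), by simp only; omega⟩⟩, ?_⟩
      exact Composition.ext (congrArg (· :: ks) (by simp only; omega))

/-- This recursion on the first block replaces compositions in most of what follows: facts about
`hat` are proved from it by induction on length. -/
theorem hat_cons (op : List α → β) (G : List β → M) (x : α) (w : List α) :
    hat op G (x :: w) = sum₂ w fun u v => hat op (fun L => G (op (x :: u) :: L)) v := by
  have key : ∀ (n : ℕ) (l : List α) (G : List β → M), l.length = n →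
      hat op G l = ∑ c : Composition n, G ((l.splitWrtCompositionAux c.blocks).map op) := by
    rintro n l G rfl
    rfl
  rw [key (w.length + 1) (x :: w) G rfl,
    sum_composition_succ w.length fun ks => G (((x :: w).splitWrtCompositionAux ks).map op), sum₂]
  refine Finset.sum_congr rfl fun i _ => ?_
  rw [key (w.length - i) _ _ (by simp)]
  refine Finset.sum_congr rfl fun c _ => ?_
  rw [List.splitWrtCompositionAux_cons]
  simp

theorem hat_congr_fun (op : List α → β) {G G' : List β → M} (w : List α)
    (h : ∀ L, G L = G' L) : hat op G w = hat op G' w := by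
  rw [funext h]

@[simp]
theorem hat_zero (op : List α → β) (w : List α) : hat op (fun _ => (0 : M)) w = 0 :=
  Finset.sum_const_zero

theorem hat_add (op : List α → β) (G G' : List β → M) (w : List α) :
    hat op (fun L => G L + G' L) w = hat op G w + hat op G' w :=
  Finset.sum_add_distrib

theorem map_hat {E : Type*} [FunLike E M N] [AddMonoidHomClass E M N] (e : E)
    (op : List α → β) (G : List β → M) (w : List α) :
    e (hat op G w) = hat op (fun L => e (G L)) w :=
  map_sum e _ _

theorem smul_hat {R : Type*} [DistribSMul R M] (r : R) (op : List α → β) (G : List β → M)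
    (w : List α) : r • hat op G w = hat op (fun L => r • G L) w :=
  Finset.smul_sum

theorem hat_sum₂ (op : List α → β) (w : List α) (w' : List γ)
    (F : List γ → List γ → List β → M) :
    hat op (fun L => sum₂ w' fun a b => F a b L) w = sum₂ w' fun a b => hat op (F a b) w :=
  Finset.sum_comm

theorem hat_comm {α' β' : Type*} (op : List α → β) (op' : List α' → β') (F : List β → List β' → M)
    (w : List α) (w' : List α') :
    hat op (fun L => hat op' (F L) w') w = hat op' (fun L' => hat op (fun L => F L L') w) w' :=
  Finset.sum_comm

/-- `f̂` is compatible with deconcatenation. -/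
theorem hat_split (op : List α → β) (Ψ : List β → List β → M) (w : List α) :
    hat op (fun L => sum₂ L Ψ) w =
      sum₂ w fun u v => hat op (fun L₁ => hat op (Ψ L₁) v) u := by
  induction h : w.length using Nat.strong_induction_on generalizing w Ψ with
  | _ n ih =>
    cases w with
    | nil => simp
    | cons x w =>
      subst h
      have e1 : hat op (fun L => sum₂ L Ψ) (x :: w) = sum₂ w (fun u v =>
          hat op (fun L => Ψ [] (op (x :: u) :: L)) v) + sum₂ w (fun u v => sum₂ v fun a b =>
            hat op (fun L₁ => hat op (Ψ (op (x :: u) :: L₁)) b) a) := by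
        rw [hat_cons, ← sum₂_add]
        refine sum₂_congr fun u v huv => ?_
        simp only [sum₂_cons, hat_add]
        rw [ih v.length (by subst huv; simp) (fun a b => Ψ (op (x :: u) :: a) b) v rfl]
      rw [e1, sum₂_cons, ← sum₂_assoc, ← hat_cons, hat_nil]
      congr 1
      refine sum₂_congr fun u v huv => ?_
      rw [hat_cons]

/-- `f̂` of a word with a marked letter, expanded according to the block of that letter. -/
theorem hat_append_cons (op : List α → β) (G : List β → M) (p q : List α) (x : α) :
    hat op G (p ++ x :: q) = sum₂ p fun p₁ p₂ => sum₂ q fun q₁ q₂ =>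
      hat op (fun L₁ => hat op (fun L₂ => G (L₁ ++ op (p₂ ++ x :: q₁) :: L₂)) q₂) p₁ := by
  induction h : p.length using Nat.strong_induction_on generalizing p G with
  | _ n ih =>
    cases p with
    | nil => simp [hat_cons]
    | cons y p =>
      subst h
      rw [List.cons_append, hat_cons, sum₂_append_cons, sum₂_cons, add_comm]
      congr 1
      · simp
      · simp only [hat_cons]
        refine Eq.trans ?_ ((sum₂_assoc p fun a b c => sum₂ q fun q₁ q₂ =>
          hat op (fun L₁ => hat op (fun L₂ => G (op (y :: a) :: L₁ ++ op (c ++ x :: q₁) :: L₂)) q₂)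
            b).symm.trans (sum₂_congr fun a b _ => sum₂_comm a q _))
        refine sum₂_congr fun a b hab => ?_
        rw [ih b.length (by subst hab; simp) _ b rfl]
        rfl

/-- No block is longer than the word, so `hat` sees only components up to that length. The inductive
construction of operations rests on this. -/
theorem hat_congr_op {op op' : List α → β} (G : List β → M) (w : List α)
    (h : ∀ u, u.length ≤ w.length → op u = op' u) : hat op G w = hat op' G w := by
  induction hn : w.length using Nat.strong_induction_on generalizing w G with
  | _ n ih =>
    cases w with
    | nil => simp
    | cons x w =>
      subst hn
      rw [hat_cons, hat_cons]
      refine sum₂_congr fun u v huv => ?_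
      subst huv
      rw [h (x :: u) (by simp), ih v.length (by simp) _ v _ rfl]
      exact fun l hl => h l (by simp; omega)

end Hat

/-! ### Signs and multilinearity on homogeneous words -/

section Multilinear

variable {k : Type u} [Field k]
variable {V : Type v} [AddCommGroup V] [Module k V] {gr : ℤ → Submodule k V}
variable {V' : Type v} [AddCommGroup V'] [Module k V'] {gr' : ℤ → Submodule k V'}
variable {M N : Type*} [AddCommGroup M] [Module k M] [AddCommGroup N] [Module k N]

theorem Homog.ext {x y : Homog gr} (h : x.1 = y.1) (h' : x.val = y.val) : x = y := by
  obtain ⟨n, x⟩ := x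
  obtain ⟨m, y⟩ := y
  obtain rfl : n = m := h
  exact congrArg _ (Subtype.ext h')

theorem Homog.val_mem (x : Homog gr) : x.val ∈ gr x.1 := x.2.2

@[simp]
theorem Word.deg_nil : Word.deg ([] : Word gr) = 0 := rfl

@[simp]
theorem Word.deg_cons (x : Homog gr) (w : Word gr) : Word.deg (x :: w) = x.1 + w.deg := by
  simp [Word.deg]

@[simp]
theorem Word.deg_append (u w : Word gr) : Word.deg (u ++ w) = u.deg + Word.deg w := by
  simp [Word.deg]

theorem map_negOnePow_smul (ℓ : M →ₗ[k] N) (n : ℤ) (x : M) :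
    ℓ (n.negOnePow • x) = n.negOnePow • ℓ x := by
  simp only [Units.smul_def, map_zsmul]

/-- Koszul signs are compared by polynomial identities of their exponents in `ZMod 2`. -/
theorem negOnePow_congr {a b : ℤ} (h : (a : ZMod 2) = b) : a.negOnePow = b.negOnePow := by
  rw [Int.negOnePow_eq_iff, ← ZMod.intCast_eq_zero_iff_even, Int.cast_sub, h, sub_self]

theorem negOnePow_smul_smul (a b : ℤ) (x : M) :
    a.negOnePow • b.negOnePow • x = (a + b).negOnePow • x := by
  rw [smul_smul, Int.negOnePow_add]

theorem negOnePow_smul_self (a : ℤ) (x : M) : a.negOnePow • a.negOnePow • x = x := by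
  rw [negOnePow_smul_smul, Int.negOnePow_even _ ⟨a, rfl⟩, one_smul]

theorem neg_negOnePow_smul (a : ℤ) (x : M) : -(a.negOnePow • x) = (a + 1).negOnePow • x := by
  rw [Int.negOnePow_succ]
  simp [Units.smul_def]

/-- `f` is linear on the homogeneous elements of degree `n`. -/
def LinearOn (n : ℤ) (f : Homog gr → M) : Prop :=
  ∃ ℓ : V →ₗ[k] M, ∀ x : Homog gr, x.1 = n → f x = ℓ x.val

/-- `G` is linear in each letter of a word. -/
def ML (G : Word gr → M) : Prop :=
  ∀ (p q : Word gr) (n : ℤ), LinearOn n fun x => G (p ++ x :: q)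

namespace LinearOn

variable {n : ℤ} {f g : Homog gr → M}

theorem zero : LinearOn n fun _ : Homog gr => (0 : M) := ⟨0, fun _ _ => rfl⟩

theorem add (hf : LinearOn n f) (hg : LinearOn n g) : LinearOn n fun x => f x + g x := by
  obtain ⟨ℓ, hℓ⟩ := hf
  obtain ⟨ℓ', hℓ'⟩ := hg
  exact ⟨ℓ + ℓ', fun x hx => by simp [hℓ x hx, hℓ' x hx]⟩

theorem map (hf : LinearOn n f) (e : M →ₗ[k] N) : LinearOn n fun x => e (f x) := by
  obtain ⟨ℓ, hℓ⟩ := hf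
  exact ⟨e ∘ₗ ℓ, fun x hx => by simp [hℓ x hx]⟩

theorem sgn (hf : LinearOn n f) (m : ℤ) : LinearOn n fun x => m.negOnePow • f x := by
  obtain ⟨ℓ, hℓ⟩ := hf
  exact ⟨((m.negOnePow : ℤ) : k) • ℓ, fun x hx => by
    simp only [hℓ x hx, Units.smul_def, LinearMap.smul_apply, Int.cast_smul_eq_zsmul]⟩

theorem neg (hf : LinearOn n f) : LinearOn n fun x => -f x := by
  obtain ⟨ℓ, hℓ⟩ := hf
  exact ⟨-ℓ, fun x hx => by simp [hℓ x hx]⟩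

theorem congr (hf : LinearOn n f) (h : ∀ x, x.1 = n → g x = f x) : LinearOn n g := by
  obtain ⟨ℓ, hℓ⟩ := hf
  exact ⟨ℓ, fun x hx => by rw [h x hx, hℓ x hx]⟩

theorem sum {ι : Type*} (s : Finset ι) {F : ι → Homog gr → M} (h : ∀ i, LinearOn n (F i)) :
    LinearOn n fun x => ∑ i ∈ s, F i x := by
  choose ℓ hℓ using h
  refine ⟨∑ i ∈ s, ℓ i, fun x hx => ?_⟩
  rw [LinearMap.sum_apply]
  exact Finset.sum_congr rfl fun i _ => hℓ i x hx

theorem sum₂ {α : Type*} (w : List α) {F : List α → List α → Homog gr → M}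
    (h : ∀ a b, LinearOn n (F a b)) : LinearOn n fun x => sum₂ w fun a b => F a b x :=
  sum _ fun _ => h _ _

theorem hat {α β : Type*} (op : List α → β) (w : List α) {F : List β → Homog gr → M}
    (h : ∀ L, LinearOn n (F L)) : LinearOn n fun x => hat op (fun L => F L x) w :=
  sum _ fun _ => h _

theorem apply_zero (hf : LinearOn n f) {x : Homog gr} (hx : x.1 = n) (h0 : x.val = 0) :
    f x = 0 := by
  obtain ⟨ℓ, hℓ⟩ := hf
  rw [hℓ x hx, h0, map_zero]

end LinearOn

/-- `op` is a family of multilinear operations of degree `r`, without constant term. -/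
structure IsOp (r : ℤ) (op : Word gr → Homog gr') : Prop where
  deg : ∀ w, (op w).1 = w.deg + r
  ml : ML fun w => (op w).val
  nil : (op []).val = 0

theorem IsOp.linearOn {r : ℤ} {op : Word gr → Homog gr'} (h : IsOp r op) (p q : Word gr) (n : ℤ)
    {f : Homog gr' → M} (hf : LinearOn (p.deg + (n + q.deg) + r) f) :
    LinearOn n fun x => f (op (p ++ x :: q)) := by
  obtain ⟨ℓ, hℓ⟩ := hf
  obtain ⟨ℓ', hℓ'⟩ := h.ml p q n
  refine ⟨ℓ ∘ₗ ℓ', fun x hx => ?_⟩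
  exact (hℓ _ (by simp [h.deg, hx])).trans (congrArg ℓ (hℓ' x hx))

namespace ML

variable {G H : Word gr → M}

theorem apply_zero (hG : ML G) (p q : Word gr) {x : Homog gr} (h0 : x.val = 0) :
    G (p ++ x :: q) = 0 :=
  (hG p q x.1).apply_zero rfl h0

theorem linearOn_cons (hG : ML G) (q : Word gr) (n : ℤ) : LinearOn n fun x => G (x :: q) :=
  hG [] q n

theorem zero : ML fun _ : Word gr => (0 : M) := fun _ _ _ => .zero

theorem add (hG : ML G) (hH : ML H) : ML fun w => G w + H w := fun p q n =>
  (hG p q n).add (hH p q n)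

theorem map (hG : ML G) (e : M →ₗ[k] N) : ML fun w => e (G w) := fun p q n => (hG p q n).map e

theorem neg (hG : ML G) : ML fun w => -G w := fun p q n => (hG p q n).neg

theorem append_left (hG : ML G) (p : Word gr) : ML fun w => G (p ++ w) := fun p' q n => by
  simpa using hG (p ++ p') q n

theorem append_right (hG : ML G) (q : Word gr) : ML fun w => G (w ++ q) := fun p q' n => by
  simpa using hG p (q' ++ q) n

theorem cons (hG : ML G) (x : Homog gr) : ML fun w => G (x :: w) := hG.append_left [x]

/-- Multilinearity is not affected by a dependence on the degree of the word. -/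
theorem of_deg {F : ℤ → Word gr → M} (h : ∀ e, ML (F e)) : ML fun w => F w.deg w :=
  fun p q n => (h (p.deg + (n + q.deg)) p q n).congr fun x hx => by simp [hx]

theorem sgn (hG : ML G) (e : ℤ → ℤ) : ML fun w => (e w.deg).negOnePow • G w :=
  of_deg (F := fun d w => (e d).negOnePow • G w) fun _ p q n => (hG p q n).sgn _

theorem sum₂ {Ψ : Word gr → Word gr → M} (h₁ : ∀ b, ML fun a => Ψ a b) (h₂ : ∀ a, ML (Ψ a)) :
    ML fun w => sum₂ w Ψ := fun p q n => by
  simp only [sum₂_append_cons]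
  refine .add (.sum₂ _ fun a b => ?_) (.sum₂ _ fun a b => ?_)
  · exact h₂ a b q n
  · exact h₁ b p a n

theorem hat {G : Word gr' → M} (hG : ML G) {op : Word gr → Homog gr'} (hop : IsOp 0 op) :
    ML (hat op G) := fun p q n => by
  simp only [hat_append_cons]
  exact .sum₂ _ fun a b => .sum₂ _ fun c d => .hat _ _ fun L => .hat _ _ fun L' =>
    hop.linearOn _ _ _ (hG _ _ _)

theorem comp_op {r : ℤ} {op : Word gr → Homog gr'} (hop : IsOp r op) {f : Homog gr' → M}
    (hf : ∀ n, LinearOn n f) : ML fun w => f (op w) := fun p q n =>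
  hop.linearOn p q n (hf _)

end ML

end Multilinear

/-! ### Coderivations and their compatibility with coalgebra maps -/

section Derivations

variable {k : Type u} [Field k]
variable {V : Type v} [AddCommGroup V] [Module k V] {gr : ℤ → Submodule k V}
variable {V' : Type v} [AddCommGroup V'] [Module k V'] {gr' : ℤ → Submodule k V'}
variable {M N : Type*} [AddCommGroup M] [Module k M] [AddCommGroup N] [Module k N]

/-- A function of words may be changed on words of the wrong degree. -/
theorem hat_deg_congr {f : Word gr → Homog gr'} (hf : IsOp 0 f) {G G' : Word gr' → M} (w : Word gr)
    (h : ∀ L : Word gr', L.deg = w.deg → G L = G' L) : hat f G w = hat f G' w := by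
  refine Finset.sum_congr rfl fun c _ => h _ ?_
  conv_rhs => rw [← w.flatten_splitWrtComposition c]
  induction w.splitWrtComposition c with
  | nil => rfl
  | cons u L ih => simp [hf.deg, ih]

/-- The value of `G` on `m̂(w)`, where `m̂` is the coderivation with components `m`. -/
def der (m : Word gr → Homog gr) (G : Word gr → M) (w : Word gr) : M :=
  sum₃ w fun a b c => (Word.deg a).negOnePow • G (a ++ m b :: c)

theorem LinearOn.der {gr' : ℤ → Submodule k V'} {n : ℤ} (m : Word gr → Homog gr)
    {F : Word gr → Homog gr' → M} (w : Word gr) (h : ∀ l, LinearOn n (F l)) :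
    LinearOn n fun x => AInf.der m (fun l => F l x) w := by
  unfold AInf.der sum₃
  exact .sum₂ _ fun a b => .sum₂ _ fun c d => (h (a ++ m c :: d)).sgn _

theorem der_add (m : Word gr → Homog gr) (G G' : Word gr → M) (w : Word gr) :
    der m (fun l => G l + G' l) w = der m G w + der m G' w := by
  simp only [der, smul_add, sum₃_add]

theorem der_sgn (m : Word gr → Homog gr) (n : ℤ) (G : Word gr → M) (w : Word gr) :
    der m (fun l => n.negOnePow • G l) w = n.negOnePow • der m G w := by
  simp only [der, smul_sum₃]
  exact sum₃_congr fun a b c _ => smul_comm _ _ _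

theorem map_der (e : M →ₗ[k] N) (m : Word gr → Homog gr) (G : Word gr → M) (w : Word gr) :
    e (der m G w) = der m (fun l => e (G l)) w := by
  simp only [der, map_sum₃, map_negOnePow_smul]

theorem der_hat_comm {α β : Type*} (m : Word gr → Homog gr) (op : List α → β)
    (G : List β → Word gr → M) (w : Word gr) (u : List α) :
    der m (fun l => hat op (fun L => G L l) u) w = hat op (fun L => der m (G L) w) u := by
  simp only [der, sum₃, sum₂, hat, Finset.smul_sum]
  rw [Finset.sum_comm]
  refine Finset.sum_congr rfl fun c _ => ?_
  rw [Finset.sum_comm]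

/-- The Leibniz rule. -/
theorem der_sum₂ (m : Word gr → Homog gr) (Ψ : Word gr → Word gr → M) (w : Word gr) :
    der m (fun l => sum₂ l Ψ) w = sum₂ w fun u v =>
      der m (fun l => Ψ l v) u + (Word.deg u).negOnePow • der m (Ψ u) v := by
  -- A cut of `a ++ m b :: c` lies either before or after the new letter; the two cases give the two
  -- Leibniz terms, in the opposite order.
  simp only [der, sum₃, sum₂_append_cons, smul_add, sum₂_add, smul_sum₂, negOnePow_smul_smul]
  rw [add_comm]
  congr 1
  · rw [sum₂_assoc w fun a l v => sum₂ l fun b c => (Word.deg a).negOnePow • Ψ (a ++ m b :: c) v]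
    refine sum₂_congr fun a r _ => ?_
    rw [sum₂_assoc r fun b c v => (Word.deg a).negOnePow • Ψ (a ++ m b :: c) v]
  · rw [← sum₂_assoc w fun u a r => sum₂ r fun b c =>
      (Word.deg u + Word.deg a).negOnePow • Ψ u (a ++ m b :: c)]
    refine sum₂_congr fun a r _ => ?_
    rw [sum₂_comm r a]
    refine sum₂_congr fun a₁ a₂ ha => ?_
    subst ha
    simp

section

variable {m : Word gr → Homog gr}

theorem der_cons (hm : IsOp 1 m) {G : Word gr → M} (hG : ML G) (x : Homog gr) (w : Word gr) :
    der m G (x :: w) = sum₂ w (fun u v => G (m (x :: u) :: v)) +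
      x.1.negOnePow • der m (fun l => G (x :: l)) w := by
  rw [der, sum₃_cons, der, smul_sum₃]
  simp only [List.nil_append, Word.deg_nil, Int.negOnePow_zero, one_smul, Word.deg_cons,
    negOnePow_smul_smul, List.cons_append]
  rw [hG.linearOn_cons (x :: w) _ |>.apply_zero rfl hm.nil, zero_add]

theorem der_nil (hm : IsOp 1 m) {G : Word gr → M} (hG : ML G) : der m G [] = 0 := by
  simpa [der, sum₃] using hG.apply_zero [] [] hm.nil

/-- Derivation of a function of a word with a marked letter. -/
theorem der_append_cons (hm : IsOp 1 m) {G : Word gr → M} (hG : ML G) (p q : Word gr) (x : Homog gr) :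
    der m G (p ++ x :: q) = der m (fun l => G (l ++ x :: q)) p +
      sum₂ p (fun p₁ p₂ => sum₂ q fun q₁ q₂ =>
        (Word.deg p₁).negOnePow • G (p₁ ++ m (p₂ ++ x :: q₁) :: q₂)) +
      (p.deg + x.1).negOnePow • der m (fun l => G (p ++ x :: l)) q := by
  induction p generalizing G with
  | nil =>
    rw [List.nil_append, der_cons hm hG, der_nil hm (hG.append_right (x :: q))]
    simp
  | cons y p ih =>
    rw [List.cons_append, der_cons hm hG, der_cons hm (hG.append_right (x :: q)),
      sum₂_append_cons, ih (hG.cons y)]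
    simp only [sum₂_cons, smul_add, smul_sum₂, negOnePow_smul_smul, Word.deg_cons,
      List.cons_append, List.nil_append, Word.deg_nil, Int.negOnePow_zero, one_smul, add_assoc]
    abel

theorem ML.der {G : Word gr → M} (hG : ML G) (hm : IsOp 1 m) : ML (der m G) := fun p q n => by
  refine LinearOn.congr (.add (.add ?_ ?_) ?_) fun x _ => der_append_cons hm hG p q x
  · exact .der _ _ fun l => hG l q n
  · exact .sum₂ _ fun a b => .sum₂ _ fun c d => .sgn (hm.linearOn _ _ _ (hG _ _ _)) _
  · refine LinearOn.congr (f := fun x => (p.deg + n).negOnePow •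
      AInf.der m (fun l => G (p ++ x :: l)) q) ?_ fun x hx => by rw [hx]
    exact .sgn (.der _ _ fun l => hG p l n) _

/-- The square of an odd coderivation is the coderivation with components `m ∘ m̂`. -/
theorem der_der (hm : IsOp 1 m) {G : Word gr → M} (hG : ML G) (w : Word gr)
    (h : ∀ u : Word gr, u.length < w.length → der m (fun l => (m l).val) u = 0)
    (e : Homog gr) (he : e.1 = w.deg + 2) (he' : e.val = der m (fun l => (m l).val) w) :
    der m (der m G) w = G [e] := by
  induction hn : w.length using Nat.strong_induction_on generalizing w G e with
  | _ n ih =>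
    subst hn
    cases w with
    | nil =>
      rw [der_nil hm (hG.der hm)]
      rw [der_nil hm hm.ml] at he'
      exact (hG.apply_zero [] [] he').symm
    | cons x w =>
      -- Since `m` is odd, passing the letter `m (x :: u)` gives the sign opposite to that of
      -- passing `x :: u`. The terms with two disjoint insertions therefore cancel (`e7`).
      have e1 : ∀ u v, der m G (m (x :: u) :: v) =
          sum₂ v (fun a b => G (m (m (x :: u) :: a) :: b)) +
            -((x.1 + Word.deg u).negOnePow • der m (fun l => G (m (x :: u) :: l)) v) := by
        intro u v
        rw [der_cons hm hG, neg_negOnePow_smul, hm.deg, Word.deg_cons]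
      have e2 : ∀ l, der m G (x :: l) = sum₂ l (fun a b => G (m (x :: a) :: b)) +
          x.1.negOnePow • der m (fun l => G (x :: l)) l := fun l => der_cons hm hG x l
      -- The induction hypothesis applies with the zero vector as value of `m ∘ m̂` on `w`, because
      -- `w` is shorter than `x :: w`.
      have e3 : der m (der m fun l => G (x :: l)) w = 0 := by
        have := ih w.length (by simp) (hG.cons x) w
          (fun u hu => h u (by rw [List.length_cons]; omega)) ⟨Word.deg w + 2, 0⟩ rfl
          (h w (by simp)).symm rfl
        rw [this]
        exact hG.apply_zero [x] [] rfl
      rw [der_cons hm (hG.der hm)]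
      simp only [e1, e2, der_add, der_sgn, e3, smul_zero, add_zero, der_sum₂, smul_sum₂, smul_add,
        negOnePow_smul_smul, sum₂_add]
      rw [← sum₂_assoc w fun u a b => G (m (m (x :: u) :: a) :: b)]
      have e4 : ∀ l v, sum₂ l (fun u a => G (m (m (x :: u) :: a) :: v)) +
          x.1.negOnePow • der m (fun l => G (m (x :: l) :: v)) l =
            der m (fun l => G (m l :: v)) (x :: l) := by
        intro l v
        rw [der_cons hm]
        exact ML.comp_op hm fun n => hG.linearOn_cons v n
      -- The nested insertions remain. They are linear in `m ∘ m̂` of the prefix `x :: l`, which is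
      -- zero unless the prefix is the whole word.
      have e5 : sum₂ w (fun l v => der m (fun l => G (m l :: v)) (x :: l)) = G [e] := by
        have e6 : ∀ l v, l ++ v = w → ∃ ℓ : V →ₗ[k] M,
            (∀ y : Homog gr, y.1 = Word.deg (x :: l) + 2 → G (y :: v) = ℓ y.val) ∧
            der m (fun l => G (m l :: v)) (x :: l) =
              ℓ (der m (fun l => (m l).val) (x :: l)) := by
          intro l v _
          obtain ⟨ℓ, hℓ⟩ := hG.linearOn_cons v (Word.deg (x :: l) + 2)
          refine ⟨ℓ, hℓ, ?_⟩
          rw [map_der]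
          refine sum₃_congr fun a b c habc => ?_
          rw [hℓ]
          rw [hm.deg, Word.deg_append, Word.deg_cons, hm.deg, ← habc, Word.deg_append,
            Word.deg_append]
          ring
        rw [sum₂_eq_right]
        · obtain ⟨ℓ, hℓ, h'⟩ := e6 w [] (by simp)
          rw [h', ← he', hℓ e he]
        · intro l v hlv hv
          obtain ⟨ℓ, hℓ, h'⟩ := e6 l v hlv
          rw [h', h, map_zero]
          subst hlv
          have := List.length_pos_iff.2 hv
          simp
          omega
      rw [← e5]
      simp only [← e4, sum₂_add]
      have e7 : sum₂ w (fun u v => -((x.1 + Word.deg u).negOnePow •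
            der m (fun l => G (m (x :: u) :: l)) v)) +
          sum₂ w (fun u v => (x.1 + Word.deg u).negOnePow •
            der m (fun l => G (m (x :: u) :: l)) v) = 0 := by
        rw [← sum₂_add]
        simp
      rw [← sub_eq_zero, ← e7]
      abel

end

/-- The coderivations `m`, `m'` and the coalgebra map `f̂` commute up to the defect of the
`A_∞`-homomorphism equation. -/
theorem der_hat {m : Word gr → Homog gr} (hm : IsOp 1 m) {m' : Word gr' → Homog gr'}
    (hm' : IsOp 1 m') {f : Word gr → Homog gr'} (hf : IsOp 0 f) {G : Word gr' → M} (hG : ML G)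
    (w : Word gr)
    (h : ∀ u : Word gr, u.length < w.length →
      der m (fun l => (f l).val) u = hat f (fun L => (m' L).val) u)
    (e : Homog gr') (he : e.1 = w.deg + 1)
    (he' : der m (fun l => (f l).val) w = hat f (fun L => (m' L).val) w + e.val) :
    der m (hat f G) w = hat f (der m' G) w + G [e] := by
  induction hn : w.length using Nat.strong_induction_on generalizing w G e with
  | _ n ih =>
    subst hn
    cases w with
    | nil =>
      rw [der_nil hm (hG.hat hf), hat_nil, der_nil hm' hG, zero_add]
      rw [der_nil hm hf.ml, hat_nil, hm'.nil, zero_add] at he'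
      exact (hG.apply_zero [] [] he'.symm).symm
    | cons x w =>
      have e1 : ∀ u v, u ++ v = w → der m (hat f fun L => G (f (x :: u) :: L)) v =
          hat f (der m' fun L => G (f (x :: u) :: L)) v := by
        intro u v huv
        subst huv
        rw [ih v.length (by simp) (hG.cons _) v (fun l hl => h l (by simp; omega))
          ⟨Word.deg v + 1, 0⟩ rfl (by rw [h v (by simp)]; exact (add_zero _).symm) rfl,
          ((hG.cons (f (x :: u))).linearOn_cons [] _).apply_zero rfl rfl, add_zero]
      have hH : ∀ v n, LinearOn n fun y => hat f (fun L => G (y :: L)) v := fun v n =>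
        .hat _ _ fun L => hG.linearOn_cons L n
      have e2 : der m (hat f G) (x :: w) =
          sum₂ w (fun l v => der m (fun l => hat f (fun L => G (f l :: L)) v) (x :: l)) +
          sum₂ w (fun u v => (x.1 + Word.deg u).negOnePow •
            hat f (der m' fun L => G (f (x :: u) :: L)) v) := by
        rw [der_cons hm (hG.hat hf)]
        simp only [hat_cons, der_sum₂, smul_sum₂, smul_add, sum₂_add, negOnePow_smul_smul]
        rw [← add_assoc, ← sum₂_assoc w fun u a b => hat f (fun L => G (f (m (x :: u) :: a) :: L)) b,
          ← sum₂_add]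
        congr 1
        · refine sum₂_congr fun l v _ => ?_
          rw [der_cons hm]
          exact ML.comp_op hf (hH v)
        · exact sum₂_congr fun u v huv => by rw [e1 u v huv]
      have e3 : hat f (der m' G) (x :: w) =
          sum₂ w (fun l v => hat f (fun L' => hat f (fun L => G (m' L' :: L)) v) (x :: l)) +
          sum₂ w (fun u v => (x.1 + Word.deg u).negOnePow •
            hat f (der m' fun L => G (f (x :: u) :: L)) v) := by
        simp only [hat_cons]
        rw [sum₂_assoc w fun u a v => hat f (fun L' => hat f (fun L => G (m' (f (x :: u) :: L') :: L))
          v) a, ← sum₂_add]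
        refine sum₂_congr fun u v _ => ?_
        rw [smul_hat, ← hat_split f fun L' L => G (m' (f (x :: u) :: L') :: L), ← hat_add]
        refine hat_congr_fun _ _ fun L => ?_
        rw [der_cons hm' hG, hf.deg, add_zero, Word.deg_cons]
      rw [e2, e3, add_right_comm]
      congr 1
      -- The terms acting behind the first block agree on both sides. The others are linear in the
      -- two sides of the homomorphism equation on the prefix `x :: l`, so they differ only for the
      -- whole word.
      have e4 : ∀ l v, l ++ v = w → ∃ ℓ : V' →ₗ[k] M,
          (∀ y : Homog gr', y.1 = Word.deg (x :: l) + 1 →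
            hat f (fun L => G (y :: L)) v = ℓ y.val) ∧
          der m (fun l => hat f (fun L => G (f l :: L)) v) (x :: l) =
            ℓ (der m (fun l => (f l).val) (x :: l)) ∧
          hat f (fun L' => hat f (fun L => G (m' L' :: L)) v) (x :: l) =
            ℓ (hat f (fun L => (m' L).val) (x :: l)) := by
        intro l v _
        obtain ⟨ℓ, hℓ⟩ := hH v (Word.deg (x :: l) + 1)
        refine ⟨ℓ, hℓ, ?_, ?_⟩
        · rw [map_der]
          refine sum₃_congr fun a b c habc => ?_
          rw [hℓ]
          rw [hf.deg, Word.deg_append, Word.deg_cons, hm.deg, ← habc, Word.deg_append,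
            Word.deg_append]
          ring
        · rw [map_hat]
          refine hat_deg_congr hf (x :: l) fun L hL => ?_
          exact hℓ (m' L) (by rw [hm'.deg, hL])
      have e5 : sum₂ w (fun l v => der m (fun l => hat f (fun L => G (f l :: L)) v) (x :: l) -
          hat f (fun L' => hat f (fun L => G (m' L' :: L)) v) (x :: l)) = G [e] := by
        rw [sum₂_eq_right]
        · obtain ⟨ℓ, hℓ, h1, h2⟩ := e4 w [] (by simp)
          rw [h1, h2, he', ← map_sub, add_sub_cancel_left, ← hℓ e he, hat_nil]
        · intro l v hlv hv
          obtain ⟨ℓ, hℓ, h1, h2⟩ := e4 l v hlv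
          rw [h1, h2, h, sub_self]
          subst hlv
          have := List.length_pos_iff.2 hv
          simp
          omega
      rw [← e5, ← sum₂_add]
      exact sum₂_congr fun l v _ => by abel

end Derivations

/-! ### Cyclic one-forms: pullback and Lie derivative -/

section OneForms

variable {k : Type u} [Field k]
variable {V : Type v} [AddCommGroup V] [Module k V] {gr : ℤ → Submodule k V}
variable {V' : Type v} [AddCommGroup V'] [Module k V'] {gr' : ℤ → Submodule k V'}
variable {V'' : Type v} [AddCommGroup V''] [Module k V''] {gr'' : ℤ → Submodule k V''}

/-- A cyclic one-form: a function of a word together with a marked last letter, which is linear in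
each argument. -/
structure IsOneForm (α : Word gr → Homog gr → k) : Prop where
  ml : ∀ w, ML fun u => α u w
  last : ∀ u n, LinearOn n (α u)

/-- The differential of a cyclic one-form. -/
def dForm (α : Word gr → Homog gr → k) : PreMap gr gr gr := fun a v b w =>
  α (a ++ v :: b) w - ((Word.deg a + v.1) * (Word.deg b + w.1)).negOnePow • α (b ++ w :: a) v

/-- The sum of `Ψ r B` over all ways to cut the cyclic word `u w` into a block `B` that contains the
marked letter `w` and the remaining word `r`. -/
def cyc (Ψ : Word gr → Word gr → k) (u : Word gr) (w : Homog gr) : k :=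
  sum₂ u fun u₁ u' => (Word.deg u₁ * (Word.deg u' + w.1)).negOnePow •
    sum₂ u' fun r u₃ => Ψ r (u₃ ++ w :: u₁)

/-- The pullback of a cyclic one-form along the coalgebra map with components `f`. -/
def pull₁ (f : Word gr → Homog gr') (α : Word gr' → Homog gr' → k) : Word gr → Homog gr → k :=
  cyc fun r B => hat f (fun L => α L (f B)) r

/-- The Lie derivative of a cyclic one-form along the coderivation with components `m`. -/
def lie (m : Word gr → Homog gr) (α : Word gr → Homog gr → k) : Word gr → Homog gr → k :=
  fun u w => der m (fun l => α l w) u + cyc (fun r B => (Word.deg r).negOnePow • α r (m B)) u w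

theorem cyc_congr {Ψ Ψ' : Word gr → Word gr → k} (h : ∀ r B, Ψ r B = Ψ' r B) (u : Word gr)
    (w : Homog gr) : cyc Ψ u w = cyc Ψ' u w := by
  rw [funext fun r => funext (h r)]

theorem cyc_add (Ψ Ψ' : Word gr → Word gr → k) (u : Word gr) (w : Homog gr) :
    cyc (fun r B => Ψ r B + Ψ' r B) u w = cyc Ψ u w + cyc Ψ' u w := by
  simp only [cyc, sum₂_add, smul_add]

theorem IsOneForm.cyc {Ψ : Word gr → Word gr → k} (h₁ : ∀ B, ML fun r => Ψ r B)
    (h₂ : ∀ r, ML (Ψ r)) : IsOneForm (cyc Ψ) where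
  ml w := by
    -- The sign involves the degrees of both pieces. Once the total degree `e` is fixed it depends
    -- on `u₁` alone, and each piece can be treated separately.
    have key := ML.of_deg (M := k) (F := fun e u => sum₂ u fun u₁ u' =>
      (Word.deg u₁ * (e - Word.deg u₁ + w.1)).negOnePow • sum₂ u' fun r u₃ => Ψ r (u₃ ++ w :: u₁))
    refine fun p q n => LinearOn.congr (key (fun e => ?_) p q n) fun x _ => ?_
    · refine ML.sum₂ (fun u' => ?_) fun u₁ => ?_
      · refine ML.sgn (G := fun u₁ => sum₂ u' fun r u₃ => Ψ r (u₃ ++ w :: u₁)) ?_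
          fun d => d * (e - d + w.1)
        exact fun p q n => .sum₂ _ fun r u₃ => by simpa using h₂ r (u₃ ++ w :: p) q n
      · refine fun p q n => LinearOn.sgn ?_ _
        refine ML.sum₂ (fun u₃ => h₁ (u₃ ++ w :: u₁)) (fun r => ?_) p q n
        exact (h₂ r).append_right (w :: u₁)
    · refine sum₂_congr fun a b hab => ?_
      rw [← hab, Word.deg_append, add_sub_cancel_left]
  last u n := by
    refine LinearOn.sum₂ _ fun u₁ u' => LinearOn.congr (f := fun w =>
      (Word.deg u₁ * (Word.deg u' + n)).negOnePow • sum₂ u' fun r u₃ => Ψ r (u₃ ++ w :: u₁)) ?_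
      fun x hx => by rw [hx]
    exact .sgn (.sum₂ _ fun r u₃ => h₂ r u₃ u₁ n) _

theorem IsOneForm.pull₁ {α : Word gr' → Homog gr' → k} (hα : IsOneForm α)
    {f : Word gr → Homog gr'} (hf : IsOp 0 f) : IsOneForm (pull₁ f α) :=
  .cyc (fun B => (hα.ml (f B)).hat hf) fun _ _ _ _ => .hat _ _ fun L =>
    hf.linearOn _ _ _ (hα.last L _)

/-- Both sides cut `u` into `t₁ x₁ r x₃ t₃`. In the cyclic word, the left side chooses first the
inner block `t₃ w t₁` and then the larger block `x₃ t₃ w t₁ x₁`; the right side chooses the larger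
block first. -/
theorem sum₂_five {α M : Type*} [AddCommMonoid M] (u : List α)
    (F : List α → List α → List α → List α → List α → M) :
    sum₂ u (fun t₁ t' => sum₂ t' fun R t₃ => sum₂ R fun x₁ x' => sum₂ x' fun r x₃ =>
      F t₁ x₁ r x₃ t₃) =
    sum₂ u fun s s' => sum₂ s' fun r y => sum₂ s fun t₁ x₁ => sum₂ y fun x₃ t₃ =>
      F t₁ x₁ r x₃ t₃ := by
  have h1 : ∀ t₁ t', sum₂ t' (fun R t₃ => sum₂ R fun x₁ x' => sum₂ x' fun r x₃ =>
      F t₁ x₁ r x₃ t₃) = sum₂ t' fun x₁ s' => sum₂ s' fun r y => sum₂ y fun x₃ t₃ =>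
        F t₁ x₁ r x₃ t₃ := by
    intro t₁ t'
    rw [sum₂_assoc t' fun x₁ x' t₃ => sum₂ x' fun r x₃ => F t₁ x₁ r x₃ t₃]
    exact sum₂_congr fun x₁ s' _ => sum₂_assoc s' fun r x₃ t₃ => F t₁ x₁ r x₃ t₃
  simp only [h1]
  rw [← sum₂_assoc u fun t₁ x₁ s' => sum₂ s' fun r y => sum₂ y fun x₃ t₃ => F t₁ x₁ r x₃ t₃]
  refine sum₂_congr fun s s' _ => ?_
  rw [sum₂_comm s s']

/-- Expansion of a sum over pairs of disjoint cyclic blocks. -/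
theorem cyc_cyc_aux (u : Word gr) (w : Homog gr) (e : ℤ)
    (F : Word gr → Word gr → Word gr → Word gr → Word gr → k) :
    sum₂ u (fun t₁ t' => (Word.deg t₁ * (Word.deg t' + w.1)).negOnePow • sum₂ t' fun R t₃ =>
      sum₂ R fun x₁ x' => (Word.deg x₁ * (Word.deg x' + (Word.deg t₃ + (w.1 + Word.deg t₁) + e))
        ).negOnePow • sum₂ x' fun r x₃ => F t₁ x₁ r x₃ t₃) =
    sum₂ u fun s s' => (Word.deg s * (Word.deg s' + w.1)).negOnePow • sum₂ s' fun r y =>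
      sum₂ s fun t₁ x₁ => sum₂ y fun x₃ t₃ =>
        (Word.deg x₁ * e).negOnePow • F t₁ x₁ r x₃ t₃ := by
  -- Here `e` is the degree of the operation applied to the inner block: `0` for a homomorphism, `1`
  -- for `m`. Rotating `x₁` past that operation leaves the sign `(-1)^{|x₁|' e}`.
  simp only [smul_sum₂, negOnePow_smul_smul]
  have h1 : sum₂ u (fun t₁ t' => sum₂ t' fun R t₃ => sum₂ R fun x₁ x' => sum₂ x' fun r x₃ =>
      (Word.deg t₁ * (Word.deg t' + w.1) + Word.deg x₁ * (Word.deg x' +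
        (Word.deg t₃ + (w.1 + Word.deg t₁) + e))).negOnePow • F t₁ x₁ r x₃ t₃) =
      sum₂ u (fun t₁ t' => sum₂ t' fun R t₃ => sum₂ R fun x₁ x' => sum₂ x' fun r x₃ =>
      ((Word.deg t₁ + Word.deg x₁) * (Word.deg r + Word.deg x₃ + Word.deg t₃ + w.1) +
        Word.deg x₁ * e).negOnePow • F t₁ x₁ r x₃ t₃) := by
    refine sum₂_congr fun t₁ t' _ => sum₂_congr fun R t₃ h => sum₂_congr fun x₁ x' h' =>
      sum₂_congr fun r x₃ h'' => ?_
    subst h h' h''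
    congr 1
    refine negOnePow_congr ?_
    simp only [Word.deg_append]
    push_cast
    grind
  rw [h1, sum₂_five u fun t₁ x₁ r x₃ t₃ => ((Word.deg t₁ + Word.deg x₁) *
    (Word.deg r + Word.deg x₃ + Word.deg t₃ + w.1) + Word.deg x₁ * e).negOnePow • F t₁ x₁ r x₃ t₃]
  refine sum₂_congr fun s s' _ => sum₂_congr fun r y h' => sum₂_congr fun t₁ x₁ h =>
    sum₂_congr fun x₃ t₃ h'' => ?_
  subst h h' h''
  simp only [Word.deg_append, add_assoc]

/-- Cutting a cyclic word commutes with applying `f̂`, as `f` has degree `0`: a block of letters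
`f(…)` around `f(B)` is the image of a larger block of the original word, in which `hat_append_cons`
recovers the block `B` of the marked letter. -/
theorem hat_cyc {f : Word gr → Homog gr'} (hf : IsOp 0 f) (Ψ : Word gr' → Word gr' → k)
    (u : Word gr) (w : Homog gr) :
    cyc (fun r B => hat f (fun L => cyc Ψ L (f B)) r) u w =
      cyc (fun r B => hat f (fun L₁ => hat f (Ψ L₁) B) r) u w := by
  have h1 : ∀ r B, hat f (fun L => cyc Ψ L (f B)) r = sum₂ r fun r₁ r' =>
      (Word.deg r₁ * (Word.deg r' + (Word.deg B + 0))).negOnePow •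
        sum₂ r' fun r₂ r₃ => hat f (fun L₁ => hat f (fun L₂ => hat f (fun L₃ =>
          Ψ L₂ (L₃ ++ f B :: L₁)) r₃) r₂) r₁ := by
    intro r B
    simp only [cyc]
    rw [hat_split f]
    refine sum₂_congr fun r₁ r' _ => ?_
    have h2 : ∀ L₁ : Word gr', hat f (fun L' => sum₂ L' fun L₂ L₃ => Ψ L₂ (L₃ ++ f B :: L₁)) r' =
        sum₂ r' fun r₂ r₃ => hat f (fun L₂ => hat f (fun L₃ => Ψ L₂ (L₃ ++ f B :: L₁)) r₃) r₂ :=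
      fun L₁ => hat_split f _ r'
    rw [← hat_sum₂, smul_hat]
    simp only [← h2]
    refine hat_deg_congr hf r₁ fun L₁ hL₁ => ?_
    rw [smul_hat]
    refine hat_deg_congr hf r' fun L' hL' => ?_
    rw [hL₁, hL', hf.deg]
  simp only [h1]
  simp only [cyc, Word.deg_append, Word.deg_cons]
  rw [cyc_cyc_aux u w 0 fun t₁ x₁ r x₃ t₃ => hat f (fun L₁ => hat f (fun L₂ => hat f (fun L₃ =>
    Ψ L₂ (L₃ ++ f (t₃ ++ w :: t₁) :: L₁)) x₃) r) x₁]
  refine sum₂_congr fun s s' _ => ?_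
  congr 1
  refine sum₂_congr fun r y _ => ?_
  have h3 : ∀ L₂, hat f (Ψ L₂) (y ++ w :: s) = _ := fun L₂ => hat_append_cons f (Ψ L₂) y s w
  simp only [h3]
  rw [hat_sum₂, sum₂_comm s y]
  refine sum₂_congr fun x₃ t₃ _ => ?_
  rw [hat_sum₂]
  refine sum₂_congr fun t₁ x₁ _ => ?_
  rw [mul_zero, Int.negOnePow_zero, one_smul, hat_comm]
  refine hat_congr_fun _ _ fun L₂ => ?_
  rw [hat_comm]

/-- A Leibniz rule for the cyclic cut. Insertions of `m` away from the marked letter come from the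
`der` part of `lie`; those that swallow the marked letter come from its `cyc` part, and together
with the insertions in `u₃` and `u₁` they make up `der` on the block. -/
theorem lie_cyc {m : Word gr → Homog gr} (hm : IsOp 1 m) {Φ : Word gr → Word gr → k}
    (h₂ : ∀ r, ML (Φ r)) (u : Word gr) (w : Homog gr) :
    lie m (cyc Φ) u w =
      cyc (fun r B => der m (fun l => Φ l B) r + (Word.deg r).negOnePow • der m (Φ r) B) u w := by
  have hdeg : ∀ (c : ℤ) (G : Word gr → k) (l : Word gr),
      der m (fun l => (Word.deg l * c).negOnePow • G l) l =
        ((Word.deg l + 1) * c).negOnePow • der m G l := by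
    intro c G l
    rw [← der_sgn]
    refine sum₃_congr fun a b d h => ?_
    subst h
    simp only [Word.deg_append, Word.deg_cons, hm.deg]
    congr 4
    ring
  have hdeg' : ∀ (c e : ℤ) (G : Word gr → k) (l : Word gr),
      der m (fun l => (c * (Word.deg l + e)).negOnePow • G l) l =
        (c * (Word.deg l + 1 + e)).negOnePow • der m G l := by
    intro c e G l
    rw [← der_sgn]
    refine sum₃_congr fun a b d h => ?_
    subst h
    simp only [Word.deg_append, Word.deg_cons, hm.deg]
    congr 5
    ring
  have e1 : der m (fun l => cyc Φ l w) u = sum₂ u fun u₁ u' => sum₂ u' fun r u₃ =>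
      ((Word.deg u₁ + 1) * (Word.deg u' + w.1)).negOnePow •
        der m (fun l => Φ r (u₃ ++ w :: l)) u₁ +
      (Word.deg u₁ + Word.deg u₁ * (Word.deg u' + 1 + w.1)).negOnePow •
        (der m (fun l => Φ l (u₃ ++ w :: u₁)) r +
          (Word.deg r).negOnePow • der m (fun l => Φ r (l ++ w :: u₁)) u₃) := by
    simp only [cyc]
    rw [der_sum₂]
    refine sum₂_congr fun u₁ u' _ => ?_
    rw [sum₂_add, ← smul_sum₂, ← smul_sum₂, hdeg, hdeg', negOnePow_smul_smul, der_sum₂]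
    congr 2
    simp only [der, sum₃, smul_sum₂]
    rw [sum₂_comm u' u₁]
    refine sum₂_congr fun a l _ => ?_
    rw [sum₂_comm u' l]
  have e2 : cyc (fun r B => (Word.deg r).negOnePow • cyc Φ r (m B)) u w =
      sum₂ u fun s s' => (Word.deg s * (Word.deg s' + w.1)).negOnePow • sum₂ s' fun r y =>
        (Word.deg r).negOnePow • sum₂ y fun x₃ t₃ => sum₂ s fun t₁ x₁ =>
          (Word.deg x₃).negOnePow • Φ r (x₃ ++ m (t₃ ++ w :: t₁) :: x₁) := by
    have := cyc_cyc_aux u w 1 fun t₁ x₁ r x₃ t₃ =>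
      (Word.deg x₁ + Word.deg r + Word.deg x₃).negOnePow • Φ r (x₃ ++ m (t₃ ++ w :: t₁) :: x₁)
    refine Eq.trans ?_ (this.trans ?_)
    · simp only [cyc]
      refine sum₂_congr fun t₁ t' _ => ?_
      congr 1
      refine sum₂_congr fun R t₃ _ => ?_
      rw [smul_sum₂]
      refine sum₂_congr fun x₁ x' h => ?_
      rw [smul_comm, smul_sum₂, hm.deg, Word.deg_append, Word.deg_cons]
      congr 1
      refine sum₂_congr fun r x₃ h' => ?_
      subst h h'
      rw [Word.deg_append, Word.deg_append, add_assoc]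
    · refine sum₂_congr fun s s' _ => ?_
      congr 1
      refine sum₂_congr fun r y _ => ?_
      rw [sum₂_comm s y, smul_sum₂]
      refine sum₂_congr fun x₃ t₃ _ => ?_
      rw [smul_sum₂]
      refine sum₂_congr fun t₁ x₁ _ => ?_
      rw [negOnePow_smul_smul, negOnePow_smul_smul]
      congr 1
      refine negOnePow_congr ?_
      push_cast
      grind
  rw [lie, e1, e2, ← sum₂_add, cyc]
  refine sum₂_congr fun s s' _ => ?_
  rw [smul_sum₂, smul_sum₂, ← sum₂_add]
  refine sum₂_congr fun r y h => ?_
  subst h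
  rw [der_append_cons hm (h₂ r)]
  simp only [smul_add, negOnePow_smul_smul]
  have s1 : (Word.deg s + Word.deg s * (Word.deg (r ++ y) + 1 + w.1)).negOnePow =
      (Word.deg s * (Word.deg (r ++ y) + w.1)).negOnePow :=
    negOnePow_congr (by push_cast; grind)
  have s2 : ((Word.deg s + 1) * (Word.deg (r ++ y) + w.1)).negOnePow =
      (Word.deg s * (Word.deg (r ++ y) + w.1) + (Word.deg r + (Word.deg y + w.1))).negOnePow :=
    negOnePow_congr (by rw [Word.deg_append]; push_cast; grind)
  have s3 : (Word.deg s + Word.deg s * (Word.deg (r ++ y) + 1 + w.1) + Word.deg r).negOnePow =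
      (Word.deg s * (Word.deg (r ++ y) + w.1) + Word.deg r).negOnePow :=
    negOnePow_congr (by push_cast; grind)
  rw [s1, s2, s3]
  abel

/-- Pullback commutes with Lie derivatives, if `f` intertwines the coderivations. -/
theorem pull₁_lie {m : Word gr → Homog gr} (hm : IsOp 1 m) {m' : Word gr' → Homog gr'}
    (hm' : IsOp 1 m') {f : Word gr → Homog gr'} (hf : IsOp 0 f)
    (h : ∀ u, der m (fun l => (f l).val) u = hat f (fun L => (m' L).val) u)
    {α : Word gr' → Homog gr' → k} (hα : IsOneForm α) :
    pull₁ f (lie m' α) = lie m (pull₁ f α) := by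
  funext u w
  have h₂ : ∀ r, ML fun B => hat f (fun L => α L (f B)) r := fun r p q n => .hat _ _ fun L =>
    hf.linearOn _ _ _ (hα.last L _)
  have e := lie_cyc hm h₂ u w
  rw [cyc_add] at e
  refine Eq.trans ?_ e.symm
  rw [pull₁]
  simp only [lie, hat_add]
  rw [cyc_add, hat_cyc hf]
  congr 1
  · refine cyc_congr (fun r B => ?_) u w
    have := der_hat hm hm' hf (hα.ml (f B)) r (fun u _ => h u) ⟨Word.deg r + 1, 0⟩ rfl
      (by rw [h]; exact (add_zero _).symm)
    rw [this, (hα.ml (f B)).linearOn_cons [] _ |>.apply_zero rfl rfl, add_zero]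
  · refine cyc_congr (fun r B => ?_) u w
    rw [der_hat_comm, smul_hat]
    refine hat_deg_congr hf r fun L hL => ?_
    rw [← smul_hat, hL]
    congr 1
    -- Linearity of `α` in its last argument reduces the claim to the homomorphism equation on the
    -- block `B`.
    obtain ⟨ℓ, hℓ⟩ := hα.last L (Word.deg B + 1)
    have e1 : hat f (fun L₂ => α L (m' L₂)) B = ℓ (hat f (fun L => (m' L).val) B) := by
      rw [map_hat]
      exact hat_deg_congr hf B fun L₂ hL₂ => hℓ _ (by rw [hm'.deg, hL₂])
    rw [e1, ← h, map_der]
    refine sum₃_congr fun a b c habc => ?_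
    dsimp only
    rw [hℓ]
    rw [hf.deg, Word.deg_append, Word.deg_cons, hm.deg, ← habc, Word.deg_append, Word.deg_append]
    ring

/-- The composition of two families of operations. -/
theorem hat_hat {f : Word gr' → Homog gr''} (hf : IsOp 0 f) {g : Word gr → Homog gr'}
    (hg : IsOp 0 g) {fg : Word gr → Homog gr''} (hfg : IsOp 0 fg)
    (h : ∀ u, u ≠ [] → (fg u).val = hat g (fun L => (f L).val) u) {M : Type*} [AddCommGroup M]
    [Module k M] {G : Word gr'' → M} (hG : ML G) (w : Word gr) :
    hat g (hat f G) w = hat fg G w := by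
  induction hn : w.length using Nat.strong_induction_on generalizing w G with
  | _ n ih =>
    cases w with
    | nil => simp
    | cons x w =>
      subst hn
      rw [hat_cons fg, hat_cons g]
      simp only [hat_cons f]
      have h1 : ∀ u v, hat g (fun L => sum₂ L fun L₁ L₂ => hat f (fun P =>
          G (f (g (x :: u) :: L₁) :: P)) L₂) v = sum₂ v fun v₁ v₂ => hat g (fun L₁ =>
            hat g (hat f fun P => G (f (g (x :: u) :: L₁) :: P)) v₂) v₁ := fun u v =>
        hat_split g _ v
      simp only [h1]
      rw [← sum₂_assoc w fun u v₁ v₂ => hat g (fun L₁ =>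
            hat g (hat f fun P => G (f (g (x :: u) :: L₁) :: P)) v₂) v₁]
      refine sum₂_congr fun u v huv => ?_
      rw [← hat_cons g fun L₁ => hat g (hat f fun P => G (f L₁ :: P)) v]
      subst huv
      have h2 : ∀ y, hat g (hat f fun P => G (y :: P)) v = hat fg (fun P => G (y :: P)) v :=
        fun y => ih v.length (by simp) (hG.cons y) v rfl
      simp only [h2]
      -- All first letters that occur have the degree of `x :: u`, so one linear map evaluates them
      -- and the formula for `fg` can be inserted.
      obtain ⟨ℓ, hℓ⟩ : LinearOn (Word.deg (x :: u)) fun y => hat fg (fun P => G (y :: P)) v :=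
        .hat _ _ fun P => hG.linearOn_cons P _
      have h3 := hℓ (fg (x :: u)) (by rw [hfg.deg, add_zero])
      simp only at h3
      rw [h3, h _ (by simp), map_hat]
      exact hat_deg_congr hg _ fun L hL => hℓ _ (by rw [hf.deg, hL, add_zero])

theorem pull₁_pull₁ {f : Word gr' → Homog gr''} (hf : IsOp 0 f) {g : Word gr → Homog gr'}
    (hg : IsOp 0 g) {fg : Word gr → Homog gr''} (hfg : IsOp 0 fg)
    (h : ∀ u, u ≠ [] → (fg u).val = hat g (fun L => (f L).val) u)
    {α : Word gr'' → Homog gr'' → k} (hα : IsOneForm α) :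
    pull₁ g (pull₁ f α) = pull₁ fg α := by
  funext u w
  simp only [pull₁]
  rw [hat_cyc hg]
  refine sum₂_congr fun u₁ u' _ => ?_
  congr 1
  refine sum₂_congr fun r u₃ _ => ?_
  dsimp only
  rw [← hat_hat hf hg hfg h (hα.ml _)]
  refine hat_congr_fun _ _ fun L₁ => ?_
  rw [hat_comm]
  refine hat_congr_fun _ _ fun P => ?_
  obtain ⟨ℓ, hℓ⟩ := hα.last P (Word.deg (u₃ ++ w :: u₁))
  rw [hℓ (fg (u₃ ++ w :: u₁)) (by rw [hfg.deg, add_zero]), h _ (by simp), map_hat]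
  exact hat_deg_congr hg _ fun L hL => hℓ _ (by rw [hf.deg, hL, add_zero])

end OneForms

/-! ### Two-forms and the exterior differential -/

section TwoForms

variable {k : Type u} [Field k]
variable {V : Type v} [AddCommGroup V] [Module k V] {gr : ℤ → Submodule k V}
variable {V' : Type v} [AddCommGroup V'] [Module k V'] {gr' : ℤ → Submodule k V'}

/-- The pullback of a family `φ : B → B^*` along the coalgebra map with components `f`. -/
def pull₂ (f : Word gr → Homog gr') (φ : PreMap gr' gr' gr') : PreMap gr gr gr := fun a v b w =>
  sum₂ a fun a₁ a' => sum₂ b fun b' b₃ =>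
    (Word.deg a₁ * (Word.deg a' + v.1 + Word.deg b' + Word.deg b₃ + w.1)).negOnePow •
      sum₂ a' fun a₂ a₃ => sum₂ b' fun b₁ b₂ =>
        hat f (fun L₁ => hat f (fun L₂ =>
          φ L₁ (f (a₃ ++ v :: b₁)) L₂ (f (b₃ ++ w :: a₁))) b₂) a₂

/-- The terms of `cyc Ψ` on the cyclic word `a v b w` where the block of `w` does not contain `v`. -/
def cyc₂ (Ψ : Word gr → Word gr → k) : PreMap gr gr gr := fun a v b w =>
  sum₂ a fun a₁ a' => sum₂ b fun b' b₃ =>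
    (Word.deg a₁ * (Word.deg a' + v.1 + Word.deg b' + Word.deg b₃ + w.1)).negOnePow •
      Ψ (a' ++ v :: b') (b₃ ++ w :: a₁)

/-- The block around `w` avoids `v`, or joins `v` through `b`, leaving a subword of `a`, or joins
`v` through `a`, leaving a subword of `b`. -/
theorem cyc_append_cons (Ψ : Word gr → Word gr → k) (a b : Word gr) (v w : Homog gr) :
    cyc Ψ (a ++ v :: b) w = cyc₂ Ψ a v b w +
      sum₂ a (fun a₁ a' => (Word.deg a₁ * (Word.deg a' + v.1 + Word.deg b + w.1)).negOnePow •
        sum₂ a' fun r a₃ => Ψ r (a₃ ++ v :: (b ++ w :: a₁))) +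
      sum₂ b (fun b₁ b' =>
        ((Word.deg a + v.1 + Word.deg b₁) * (Word.deg b' + w.1)).negOnePow •
        sum₂ b' fun r b₃ => Ψ r (b₃ ++ w :: (a ++ v :: b₁))) := by
  rw [cyc, sum₂_append_cons]
  simp only [sum₂_append_cons, smul_add, sum₂_add, Word.deg_append, Word.deg_cons,
    List.append_assoc, List.cons_append]
  congr 1
  · rw [add_comm]
    congr 1
    · refine sum₂_congr fun a₁ a' _ => ?_
      rw [smul_sum₂]
      refine sum₂_congr fun b' b₃ h => ?_
      subst h
      rw [Word.deg_append]
      congr 2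
      ring
    · refine sum₂_congr fun a₁ a' _ => ?_
      congr 2
      ring
  · refine sum₂_congr fun b₁ b' _ => ?_
    congr 2
    ring

/-- In the antisymmetrization of `cyc Ψ`, blocks containing both marked letters cancel. -/
theorem dForm_cyc (Ψ : Word gr → Word gr → k) (a b : Word gr) (v w : Homog gr) :
    dForm (cyc Ψ) a v b w = cyc₂ Ψ a v b w -
      ((Word.deg a + v.1) * (Word.deg b + w.1)).negOnePow • cyc₂ Ψ b w a v := by
  rw [dForm, cyc_append_cons, cyc_append_cons, smul_add, smul_add]
  have e1 : ((Word.deg a + v.1) * (Word.deg b + w.1)).negOnePow •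
      sum₂ b (fun b₁ b' => (Word.deg b₁ * (Word.deg b' + w.1 + Word.deg a + v.1)).negOnePow •
        sum₂ b' fun r b₃ => Ψ r (b₃ ++ w :: (a ++ v :: b₁))) =
      sum₂ b (fun b₁ b' =>
        ((Word.deg a + v.1 + Word.deg b₁) * (Word.deg b' + w.1)).negOnePow •
        sum₂ b' fun r b₃ => Ψ r (b₃ ++ w :: (a ++ v :: b₁))) := by
    rw [smul_sum₂]
    refine sum₂_congr fun b₁ b' h => ?_
    rw [negOnePow_smul_smul]
    congr 1
    subst h
    exact negOnePow_congr (by rw [Word.deg_append]; push_cast; grind)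
  have e2 : ((Word.deg a + v.1) * (Word.deg b + w.1)).negOnePow •
      sum₂ a (fun b₁ b' =>
        ((Word.deg b + w.1 + Word.deg b₁) * (Word.deg b' + v.1)).negOnePow •
        sum₂ b' fun r b₃ => Ψ r (b₃ ++ v :: (b ++ w :: b₁))) =
      sum₂ a (fun a₁ a' => (Word.deg a₁ * (Word.deg a' + v.1 + Word.deg b + w.1)).negOnePow •
        sum₂ a' fun r a₃ => Ψ r (a₃ ++ v :: (b ++ w :: a₁))) := by
    rw [smul_sum₂]
    refine sum₂_congr fun b₁ b' h => ?_
    rw [negOnePow_smul_smul]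
    congr 1
    subst h
    exact negOnePow_congr (by rw [Word.deg_append]; push_cast; grind)
  rw [e1, e2]
  abel

/-- Pullback commutes with the differential. -/
theorem pull₂_dForm {f : Word gr → Homog gr'} (hf : IsOp 0 f) (α : Word gr' → Homog gr' → k) :
    pull₂ f (dForm α) = dForm (pull₁ f α) := by
  funext a v b w
  rw [pull₁, dForm_cyc]
  -- By `dForm_cyc` only disjoint blocks of `v` and `w` remain. `e1` and `e2` write the two halves
  -- over the same six-piece decomposition, so that they combine into `dForm α` term by term.
  have e1 : ∀ (a b : Word gr) (v w : Homog gr),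
      cyc₂ (fun r B => hat f (fun L => α L (f B)) r) a v b w =
      sum₂ a fun a₁ a' => sum₂ b fun b' b₃ =>
        (Word.deg a₁ * (Word.deg a' + v.1 + Word.deg b' + Word.deg b₃ + w.1)).negOnePow •
          sum₂ a' fun a₂ a₃ => sum₂ b' fun b₁ b₂ =>
            hat f (fun L₁ => hat f (fun L₂ =>
              α (L₁ ++ f (a₃ ++ v :: b₁) :: L₂) (f (b₃ ++ w :: a₁))) b₂) a₂ := by
    intro a b v w
    refine sum₂_congr fun a₁ a' _ => sum₂_congr fun b' b₃ _ => ?_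
    congr 1
    exact hat_append_cons f _ _ _ _
  have e2 : ((Word.deg a + v.1) * (Word.deg b + w.1)).negOnePow •
      cyc₂ (fun r B => hat f (fun L => α L (f B)) r) b w a v =
      sum₂ a fun a₁ a' => sum₂ b fun b' b₃ =>
        (Word.deg a₁ * (Word.deg a' + v.1 + Word.deg b' + Word.deg b₃ + w.1)).negOnePow •
          sum₂ a' fun a₂ a₃ => sum₂ b' fun b₁ b₂ =>
            ((Word.deg a₂ + (Word.deg a₃ + v.1 + Word.deg b₁)) *
              (Word.deg b₂ + (Word.deg b₃ + w.1 + Word.deg a₁))).negOnePow •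
            hat f (fun L₁ => hat f (fun L₂ =>
              α (L₂ ++ f (b₃ ++ w :: a₁) :: L₁) (f (a₃ ++ v :: b₁))) b₂) a₂ := by
    rw [e1]
    simp only [smul_sum₂, negOnePow_smul_smul]
    rw [sum₂_comm b a]
    let F : List (Homog gr) → List (Homog gr) → List (Homog gr) → List (Homog gr) →
        List (Homog gr) → List (Homog gr) → k := fun a₁ a₂ a₃ b₁ b₂ b₃ =>
      ((Word.deg a + v.1) * (Word.deg b + w.1) + Word.deg b₁ * (Word.deg b₂ + Word.deg b₃ + w.1 +
        Word.deg a + v.1)).negOnePow • hat f (fun L₁ => hat f (fun L₂ =>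
              α (L₂ ++ f (b₃ ++ w :: a₁) :: L₁) (f (a₃ ++ v :: b₁))) b₂) a₂
    have e3 : sum₂ a (fun a' a₃ => sum₂ b fun b₁ b' => sum₂ b' fun b₂ b₃ => sum₂ a' fun a₁ a₂ =>
        F a₁ a₂ a₃ b₁ b₂ b₃) = sum₂ a fun a₁ a' => sum₂ b fun b' b₃ => sum₂ a' fun a₂ a₃ =>
        sum₂ b' fun b₁ b₂ => F a₁ a₂ a₃ b₁ b₂ b₃ := by
      have h1 : ∀ a' a₃, sum₂ b (fun b₁ b' => sum₂ b' fun b₂ b₃ => sum₂ a' fun a₁ a₂ =>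
          F a₁ a₂ a₃ b₁ b₂ b₃) = sum₂ a' fun a₁ a₂ => sum₂ b fun b' b₃ => sum₂ b' fun b₁ b₂ =>
            F a₁ a₂ a₃ b₁ b₂ b₃ := by
        intro a' a₃
        rw [← sum₂_assoc b fun b₁ b₂ b₃ => sum₂ a' fun a₁ a₂ => F a₁ a₂ a₃ b₁ b₂ b₃]
        rw [sum₂_comm a' b]
        exact sum₂_congr fun b' b₃ _ => sum₂_comm b' a' _
      simp only [h1]
      rw [sum₂_assoc a fun a₁ a₂ a₃ => sum₂ b fun b' b₃ => sum₂ b' fun b₁ b₂ =>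
            F a₁ a₂ a₃ b₁ b₂ b₃]
      exact sum₂_congr fun a₁ a' _ => sum₂_comm a' b _
    refine Eq.trans ?_ (e3.trans ?_)
    · refine sum₂_congr fun a' a₃ ha => sum₂_congr fun b₁ b' _ => sum₂_congr fun b₂ b₃ hb =>
        sum₂_congr fun a₁ a₂ ha' => ?_
      rw [hat_comm]
      dsimp only [F]
      congr 1
      subst ha ha' hb
      congr 1
      simp only [Word.deg_append]
      ring
    · refine sum₂_congr fun a₁ a' ha => sum₂_congr fun b' b₃ hb => sum₂_congr fun a₂ a₃ ha' =>
        sum₂_congr fun b₁ b₂ hb' => ?_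
      dsimp only [F]
      congr 1
      subst ha ha' hb hb'
      refine negOnePow_congr ?_
      simp only [Word.deg_append]
      push_cast
      grind
  rw [e1, e2, sub_eq_add_neg, pull₂]
  simp only [smul_sum₂, negOnePow_smul_smul]
  have hneg : ∀ (w : List (Homog gr)) (F : List (Homog gr) → List (Homog gr) → k),
      -sum₂ w F = sum₂ w fun a b => -F a b := fun w F => (Finset.sum_neg_distrib _).symm
  simp only [hneg, ← sum₂_add]
  refine sum₂_congr fun a₁ a' ha => sum₂_congr fun b' b₃ hb => sum₂_congr fun a₂ a₃ ha' =>
        sum₂_congr fun b₁ b₂ hb' => ?_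
  rw [← negOnePow_smul_smul, ← smul_neg, ← smul_add]
  congr 1
  rw [← neg_one_smul k (Int.negOnePow _ • _ : k), smul_hat, smul_hat, ← hat_add]
  refine hat_deg_congr hf a₂ fun L₁ hL₁ => ?_
  rw [smul_hat, smul_hat, ← hat_add]
  refine hat_deg_congr hf b₂ fun L₂ hL₂ => ?_
  rw [dForm, hL₁, hL₂, hf.deg, hf.deg, neg_one_smul, sub_eq_add_neg]
  simp only [Word.deg_append, Word.deg_cons]
  congr 4
  ring

theorem dForm_skew (α : Word gr → Homog gr → k) (a : Word gr) (v : Homog gr) (b : Word gr)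
    (w : Homog gr) : dForm α a v b w =
      -(((a.deg + v.1) * (b.deg + w.1)).negOnePow • dForm α b w a v) := by
  rw [dForm, dForm, smul_sub, mul_comm (b.deg + w.1), negOnePow_smul_self]
  abel

/-- This is `d² = 0`: of the six terms, the two with the same last letter cancel. -/
theorem dForm_closed (α : Word gr → Homog gr → k) (p q r s : Word gr) (x y z : Homog gr) :
    ((p.deg + x.1 + q.deg + y.1) * (r.deg + z.1 + s.deg)).negOnePow •
        dForm α (r ++ z :: (s ++ p)) x q y +
    ((p.deg + x.1 + q.deg + y.1 + r.deg + z.1) * s.deg).negOnePow •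
        dForm α (s ++ p ++ x :: q) y r z +
    ((p.deg + x.1) * (q.deg + y.1 + r.deg + z.1 + s.deg)).negOnePow •
        dForm α (q ++ y :: r) z (s ++ p) x = 0 := by
  simp only [dForm, smul_sub, negOnePow_smul_smul, Word.deg_append, Word.deg_cons,
    List.append_assoc, List.cons_append]
  have h1 : ((p.deg + x.1 + q.deg + y.1) * (r.deg + z.1 + s.deg) +
      (r.deg + (z.1 + (s.deg + p.deg)) + x.1) * (q.deg + y.1)).negOnePow =
      ((p.deg + x.1) * (q.deg + y.1 + r.deg + z.1 + s.deg)).negOnePow :=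
    negOnePow_congr (by push_cast; grind)
  have h2 : ((p.deg + x.1 + q.deg + y.1 + r.deg + z.1) * s.deg +
      (s.deg + (p.deg + (x.1 + q.deg)) + y.1) * (r.deg + z.1)).negOnePow =
      ((p.deg + x.1 + q.deg + y.1) * (r.deg + z.1 + s.deg)).negOnePow :=
    negOnePow_congr (by push_cast; grind)
  have h3 : ((p.deg + x.1) * (q.deg + y.1 + r.deg + z.1 + s.deg) +
      (q.deg + (y.1 + r.deg) + z.1) * (s.deg + p.deg + x.1)).negOnePow =
      ((p.deg + x.1 + q.deg + y.1 + r.deg + z.1) * s.deg).negOnePow :=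
    negOnePow_congr (by push_cast; grind)
  rw [h1, h2, h3]
  abel

end TwoForms

/-! ### The bimodule equation as a Lie derivative -/

section Potential

variable {k : Type u} [Field k]
variable {V : Type v} [AddCommGroup V] [Module k V] {A : Algebra k V}

/-- The Lie derivative of a two-form along the differential of `A`. -/
theorem lie_dForm {α : Word A.gr → Homog A.gr → k} (hα : IsOneForm α) (hm : IsOp 1 A.op)
    (a : Word A.gr) (v : Homog A.gr) (b : Word A.gr) (w : Homog A.gr) :
    DualMap.compOp (dForm α) a v b w - DualMap.dualOpComp (dForm α) a v b w =
      dForm (lie A.op α) a v b w := by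
  have e0 : dForm (lie A.op α) a v b w =
      dForm (fun u w => der A.op (fun l => α l w) u) a v b w +
      dForm (cyc fun r B => (Word.deg r).negOnePow • α r (A.op B)) a v b w := by
    simp only [dForm, lie, smul_add]
    abel
  have hneg : ∀ (w : List (Homog A.gr)) (F : List (Homog A.gr) → List (Homog A.gr) → k),
      -sum₂ w F = sum₂ w fun a b => -F a b := fun w F => (Finset.sum_neg_distrib _).symm
  have hneg₃ : ∀ (w : List (Homog A.gr)) (F : List (Homog A.gr) → List (Homog A.gr) →
      List (Homog A.gr) → k), -sum₃ w F = sum₃ w fun a b c => -F a b c := fun w F => by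
    simp only [sum₃, hneg]
  -- The insertions of `m` are sorted by position: inside `a` (`e1`), inside `b` (`e3`), around `v`
  -- (`e2`), and around `w`, which is the dual side (`e4`).
  have e1 : sum₃ a (fun a₁ a₂ a₃ =>
      (Word.deg a₁).negOnePow • dForm α (a₁ ++ A.op a₂ :: a₃) v b w) =
      der A.op (fun l => α (l ++ v :: b) w) a - ((Word.deg a + v.1) * (Word.deg b + w.1)).negOnePow •
        ((Word.deg b + w.1).negOnePow • der A.op (fun l => α (b ++ w :: l) v) a) := by
    rw [sub_eq_add_neg, der, der, negOnePow_smul_smul, smul_sum₃, hneg₃, ← sum₃_add]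
    refine sum₃_congr fun a₁ a₂ a₃ h => ?_
    subst h
    rw [dForm, smul_sub, sub_eq_add_neg, negOnePow_smul_smul, negOnePow_smul_smul]
    congr 3
    refine negOnePow_congr ?_
    simp only [Word.deg_append, Word.deg_cons, hm.deg]
    push_cast
    grind
  have e3 : sum₃ b (fun b₁ b₂ b₃ =>
      (Word.deg a + v.1 + Word.deg b₁).negOnePow • dForm α a v (b₁ ++ A.op b₂ :: b₃) w) =
      (Word.deg a + v.1).negOnePow • der A.op (fun l => α (a ++ v :: l) w) b -
        ((Word.deg a + v.1) * (Word.deg b + w.1)).negOnePow •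
          der A.op (fun l => α (l ++ w :: a) v) b := by
    rw [sub_eq_add_neg, der, der, smul_sum₃, smul_sum₃, hneg₃, ← sum₃_add]
    refine sum₃_congr fun a₁ a₂ a₃ h => ?_
    subst h
    rw [dForm, smul_sub, sub_eq_add_neg, negOnePow_smul_smul, negOnePow_smul_smul,
      negOnePow_smul_smul]
    congr 3
    refine negOnePow_congr ?_
    simp only [Word.deg_append, Word.deg_cons, hm.deg]
    push_cast
    grind
  have e2 : sum₂ a (fun a₁ a₂ => sum₂ b (fun b₁ b₂ =>
      (Word.deg a₁).negOnePow • dForm α a₁ (A.op (a₂ ++ v :: b₁)) b₂ w)) =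
      sum₂ a (fun a₁ a₂ => sum₂ b fun b₁ b₂ =>
        (Word.deg a₁).negOnePow • α (a₁ ++ A.op (a₂ ++ v :: b₁) :: b₂) w) -
      ((Word.deg a + v.1) * (Word.deg b + w.1)).negOnePow •
        cyc₂ (fun r B => (Word.deg r).negOnePow • α r (A.op B)) b w a v := by
    rw [cyc₂, sum₂_comm b a, sub_eq_add_neg, smul_sum₂, hneg, ← sum₂_add]
    refine sum₂_congr fun a₁ a₂ ha => ?_
    rw [smul_sum₂, hneg, ← sum₂_add]
    refine sum₂_congr fun b₁ b₂ hb => ?_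
    subst ha hb
    rw [dForm, smul_sub, sub_eq_add_neg, negOnePow_smul_smul, negOnePow_smul_smul,
      negOnePow_smul_smul]
    congr 3
    refine negOnePow_congr ?_
    simp only [Word.deg_append, Word.deg_cons, hm.deg]
    push_cast
    grind
  have e4 : DualMap.dualOpComp (dForm α) a v b w =
      -cyc₂ (fun r B => (Word.deg r).negOnePow • α r (A.op B)) a v b w +
      ((Word.deg a + v.1) * (Word.deg b + w.1)).negOnePow •
        sum₂ b (fun b₁ b₂ => sum₂ a fun a₁ a₂ =>
          (Word.deg b₁).negOnePow • α (b₁ ++ A.op (b₂ ++ w :: a₁) :: a₂) v) := by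
    rw [DualMap.dualOpComp, cyc₂, sum₂_comm b a, smul_sum₂, hneg, ← sum₂_add]
    refine sum₂_congr fun a₁ a₂ ha => ?_
    rw [smul_sum₂, hneg, ← sum₂_add]
    refine sum₂_congr fun b₁ b₂ hb => ?_
    subst ha hb
    rw [Algebra.dualOp, dForm, smul_sub, neg_sub, sub_eq_neg_add, negOnePow_smul_smul,
      negOnePow_smul_smul, negOnePow_smul_smul]
    have hs : ∀ {i j : ℤ} (x : k), i.negOnePow = j.negOnePow →
        i.negOnePow • x = j.negOnePow • x := fun x h => by rw [h]
    refine congrArg₂ _ (congrArg _ (hs _ ?_)) (hs _ ?_)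
    all_goals
      refine negOnePow_congr ?_
      simp only [Word.deg_append, Word.deg_cons, hm.deg]
      push_cast
      -- The sign of the dual structure depends on products in which a degree meets itself.
      have h : ∀ x : ZMod 2, x * x = x := by decide
      grind
  -- Insertions containing both `v` and `w` do not occur in a bimodule equation; on the right they
  -- cancel by `dForm_cyc`.
  rw [e0, dForm_cyc, DualMap.compOp, e1, e2, e3, e4]
  simp only [dForm]
  rw [der_append_cons hm (hα.ml w), der_append_cons hm (hα.ml v)]
  simp only [smul_add]
  abel

end Potential

/-! ### The Poincaré lemma for closed cyclic two-forms -/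

section Poincare

variable {α M : Type*} [AddCommMonoid M]

/-- The sum of `F a x b` over all ways to write `w = a ++ x :: b`. -/
def sumLetter : List α → (List α → α → List α → M) → M
  | [], _ => 0
  | x :: w, F => F [] x w + sumLetter w fun a v b => F (x :: a) v b

theorem sumLetter_append (p q : List α) (F : List α → α → List α → M) :
    sumLetter (p ++ q) F = sumLetter p (fun a v b => F a v (b ++ q)) +
      sumLetter q fun a v b => F (p ++ a) v b := by
  induction p generalizing F with
  | nil => simp [sumLetter]
  | cons x p ih => simp [sumLetter, ih, add_assoc]

theorem sumLetter_eq_nsmul (c : M) (w : List α) (F : List α → α → List α → M)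
    (h : ∀ a v b, a ++ v :: b = w → F a v b = c) : sumLetter w F = w.length • c := by
  induction w generalizing F with
  | nil => simp [sumLetter]
  | cons x w ih =>
    rw [sumLetter, h _ _ _ rfl, ih _ fun a v b hab => h (x :: a) v b (by simp [hab]),
      List.length_cons, succ_nsmul']

theorem sumLetter_add (w : List α) (F G : List α → α → List α → M) :
    sumLetter w (fun a v b => F a v b + G a v b) = sumLetter w F + sumLetter w G := by
  induction w generalizing F G with
  | nil => simp [sumLetter]
  | cons x w ih => simp only [sumLetter, ih]; exact add_add_add_comm _ _ _ _

theorem map_sumLetter {N E : Type*} [AddCommMonoid N] [FunLike E M N] [AddMonoidHomClass E M N]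
    (e : E) (w : List α) (F : List α → α → List α → M) :
    e (sumLetter w F) = sumLetter w fun a v b => e (F a v b) := by
  induction w generalizing F with
  | nil => simp [sumLetter]
  | cons x w ih => simp [sumLetter, ih]

variable {k : Type u} [Field k]
variable {V : Type v} [AddCommGroup V] [Module k V] {gr : ℤ → Submodule k V}
variable {N : Type*} [AddCommGroup N] [Module k N]

theorem LinearOn.sumLetter {n : ℤ} (w : List α) {F : List α → α → List α → Homog gr → N}
    (h : ∀ a v b, LinearOn n (F a v b)) :
    LinearOn n fun x => sumLetter w fun a v b => F a v b x := by
  induction w generalizing F with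
  | nil => exact .zero
  | cons y w ih => exact .add (h _ _ _) (ih fun a v b => h _ _ _)

/-- Over a field a linear map on `gr n` extends to the whole space, as `LinearOn` requires. -/
theorem LinearOn.of_forall {n : ℤ} {f : Homog gr → N}
    (h : ∀ (c : k) (x y : gr n), f ⟨n, c • x + y⟩ = c • f ⟨n, x⟩ + f ⟨n, y⟩) : LinearOn n f := by
  have h0 : f ⟨n, 0⟩ = 0 := by simpa using h 1 0 0
  obtain ⟨ℓ, hℓ⟩ := LinearMap.exists_extend
    ({ toFun := fun x => f ⟨n, x⟩
       map_add' := fun x y => by simpa using h 1 x y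
       map_smul' := fun c x => by simpa [h0] using h c x 0 } : gr n →ₗ[k] N)
  refine ⟨ℓ, ?_⟩
  rintro ⟨m, x⟩ rfl
  exact (LinearMap.congr_fun hℓ x).symm

theorem LinearOn.forall {n : ℤ} {f : Homog gr → k} (h : LinearOn n f) (c : k) (x y : gr n) :
    f ⟨n, c • x + y⟩ = c * f ⟨n, x⟩ + f ⟨n, y⟩ := by
  obtain ⟨ℓ, hℓ⟩ := h
  rw [hℓ _ rfl, hℓ _ rfl, hℓ _ rfl]
  exact (map_add _ _ _).trans (congrArg (· + _) (map_smul ℓ c _))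

variable {A : Algebra k V}

/-- The primitive of a closed two-form. -/
def primitive (φ : DualMap A) : Word A.gr → Homog A.gr → k := fun u w =>
  -- Contraction with the Euler field: every letter of `u` is marked in turn, and the result is
  -- divided by the number of letters of the cyclic word `u w`.
  ((u.length : k) + 1)⁻¹ * sumLetter u fun a v b => φ a v b w

theorem IsOneForm.primitive {φ : DualMap A} (hφ : IsMultilinear φ) : IsOneForm (primitive φ) where
  ml w p q n := by
    refine LinearOn.congr (f := fun x => LinearMap.mulLeft k
      (((p.length + (q.length + 1) : ℕ) : k) + 1)⁻¹
      (AInf.sumLetter p (fun a v b => φ a v (b ++ x :: q) w) + (φ p x q w +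
        AInf.sumLetter q fun a v b => φ (p ++ x :: a) v b w))) ?_ fun x _ => ?_
    · refine LinearOn.map (.add (.sumLetter _ fun a v b => ?_) (.add ?_
        (.sumLetter _ fun a v b => ?_))) _
      · exact .of_forall fun c x y => hφ.right a v b q n c x y w
      · exact .of_forall fun c x y => hφ.mid p n c x y q w
      · exact .of_forall fun c x y => hφ.left p a n c x y v b w
    · dsimp only
      rw [AInf.primitive, sumLetter_append, AInf.sumLetter]
      simp
  last u n := by
    refine LinearOn.map (M := k) (f := fun x => AInf.sumLetter u fun a v b => φ a v b x)
      (.sumLetter _ fun a v b => ?_) (LinearMap.mulLeft k _)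
    exact .of_forall fun c x y => hφ.last a v b n c x y

/-- The Poincaré lemma for closed two-forms. -/
theorem dForm_primitive [CharZero k] {φ : DualMap A} (hs : IsSkew φ) (hc : IsClosed φ) :
    dForm (primitive φ) = φ := by
  funext a v b w
  have hn : ((a.length + b.length + 1 : ℕ) : k) + 1 ≠ 0 := Nat.cast_add_one_ne_zero _
  have l1 : (a ++ v :: b).length = a.length + b.length + 1 := by simp; omega
  have l2 : (b ++ w :: a).length = a.length + b.length + 1 := by simp; omega
  set ε := ((a.deg + v.1) * (b.deg + w.1)).negOnePow with hε
  let e : k →+ k := AddMonoidHom.mk' (fun t => -(ε • t)) fun x y => by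
    rw [smul_add, neg_add]
  have he : ∀ t, e t = -(ε • t) := fun _ => rfl
  -- For a letter `i` of `a`, closedness for the triple `(i, v, w)` and skew symmetry show that its
  -- two contributions add up to `φ a v b w`.
  have ha : sumLetter a (fun p i q => φ p i (q ++ v :: b) w) +
      e (sumLetter a fun p i q => φ (b ++ w :: p) i q v) = a.length • φ a v b w := by
    rw [map_sumLetter, ← sumLetter_add]
    refine sumLetter_eq_nsmul _ _ _ fun (p : Word A.gr) i (q : Word A.gr) h => ?_
    have h1 := hc p q b [] i v w
    have h2 := hs p i (q ++ v :: b) w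
    subst h
    simp only [Word.deg_append, Word.deg_cons, Word.deg_nil, mul_zero, Int.negOnePow_zero, one_smul,
      List.nil_append, add_zero] at h1 h2 hε
    have s1 : ((p.deg + i.1 + q.deg + v.1) * (b.deg + w.1)).negOnePow = ε :=
      hε ▸ negOnePow_congr (by push_cast; grind)
    have s2 : ((p.deg + i.1) * (q.deg + v.1 + b.deg + w.1)).negOnePow =
        ((p.deg + i.1) * (q.deg + (v.1 + b.deg) + w.1)).negOnePow :=
      negOnePow_congr (by push_cast; grind)
    rw [s1, s2] at h1
    rw [he, h2]
    linear_combination -h1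
  -- The same for a letter `i` of `b`, with the triple `(v, i, w)`.
  have hb : sumLetter b (fun q i r => φ (a ++ v :: q) i r w) +
      e (sumLetter b fun q i r => φ q i (r ++ w :: a) v) = b.length • φ a v b w := by
    rw [map_sumLetter, ← sumLetter_add]
    refine sumLetter_eq_nsmul _ _ _ fun (q : Word A.gr) i (r : Word A.gr) h => ?_
    have h1 := hc a q r [] v i w
    have h2 := hs q i (r ++ w :: a) v
    have h3 := hs a v b w
    subst h
    simp only [Word.deg_append, Word.deg_cons, Word.deg_nil, mul_zero, Int.negOnePow_zero, one_smul,
      List.nil_append, add_zero] at h1 h2 h3 hε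
    have s1 : ((a.deg + v.1) * (q.deg + i.1 + r.deg + w.1)).negOnePow = ε :=
      hε ▸ negOnePow_congr (by push_cast; grind)
    have s2 : ε • ((q.deg + i.1) * (r.deg + (w.1 + a.deg) + v.1)).negOnePow •
        φ (r ++ w :: a) v q i = ((a.deg + v.1 + q.deg + i.1) * (r.deg + w.1)).negOnePow •
        φ (r ++ w :: a) v q i := by
      rw [hε, negOnePow_smul_smul]
      congr 1
      exact negOnePow_congr (by push_cast; grind)
    rw [s1] at h1
    rw [← hε] at h3
    rw [he, h2, smul_neg, s2, h3]
    linear_combination h1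
  -- The letters `v` and `w` contribute once each, so the total multiplicity is `|a| + |b| + 2`, the
  -- number of letters.
  have hvw : φ a v b w + e (φ b w a v) = 2 • φ a v b w := by
    rw [he, hε, ← hs a v b w, two_smul]
  have hS : sumLetter (a ++ v :: b) (fun p i q => φ p i q w) +
      e (sumLetter (b ++ w :: a) fun p i q => φ p i q v) =
      (((a.length + b.length + 1 : ℕ) : k) + 1) * φ a v b w := by
    rw [sumLetter_append, sumLetter_append, sumLetter, sumLetter, map_add, map_add]
    simp only [List.append_nil]
    have : (((a.length + b.length + 1 : ℕ) : k) + 1) * φ a v b w =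
      a.length • φ a v b w + b.length • φ a v b w + 2 • φ a v b w := by
      simp only [nsmul_eq_mul]
      push_cast
      ring
    rw [this, ← ha, ← hb, ← hvw]
    abel
  rw [dForm, primitive, primitive, l1, l2]
  have hm : ∀ c t : k, -(ε • (c * t)) = c * e t := fun c t => by
    rw [he, mul_neg, mul_smul_comm]
  rw [sub_eq_add_neg, hm, ← mul_add, hS, inv_mul_cancel_left₀ hn]

end Poincare

/-! ### Multilinearity of exact two-forms -/

section Multilinear

variable {k : Type u} [Field k]
variable {V : Type v} [AddCommGroup V] [Module k V] {A : Algebra k V}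

theorem IsOneForm.isMultilinear {α : Word A.gr → Homog A.gr → k} (hα : IsOneForm α) :
    IsMultilinear (A := A) (dForm α) := by
  have hsub : ∀ {n : ℤ} {f g : Homog A.gr → k}, LinearOn n f → LinearOn n g →
      LinearOn n fun x => f x - g x := fun hf hg =>
    (hf.add hg.neg).congr fun x _ => sub_eq_add_neg _ _
  refine ⟨fun a₁ a₂ n c x y v b w => ?_, fun a n c x y b w => ?_,
    fun a v b₁ b₂ n c x y w => ?_, fun a v b n c x y => ?_⟩
  · refine LinearOn.forall (f := fun x => dForm α (a₁ ++ x :: a₂) v b w) (hsub ?_ ?_) c x y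
    · exact (hα.ml w a₁ (a₂ ++ v :: b) n).congr fun x _ => by simp
    · exact ((hα.ml v (b ++ w :: a₁) a₂ n).sgn _).congr
        (g := fun x => ((Word.deg (a₁ ++ x :: a₂) + v.1) * (b.deg + w.1)).negOnePow •
          α (b ++ w :: (a₁ ++ x :: a₂)) v)
        fun x hx => by simp [hx]; rfl
  · refine LinearOn.forall (f := fun x => dForm α a x b w) (hsub (hα.ml w a b n) ?_) c x y
    exact ((hα.last (b ++ w :: a) n).sgn ((a.deg + n) * (b.deg + w.1))).congr fun x hx => by rw [hx]
  · refine LinearOn.forall (f := fun x => dForm α a v (b₁ ++ x :: b₂) w) (hsub ?_ ?_) c x y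
    · exact (hα.ml w (a ++ v :: b₁) b₂ n).congr fun x _ => by simp
    · exact ((hα.ml v b₁ (b₂ ++ w :: a) n).sgn _).congr
        (g := fun x => ((Word.deg a + v.1) * (Word.deg (b₁ ++ x :: b₂) + w.1)).negOnePow •
          α ((b₁ ++ x :: b₂) ++ w :: a) v)
        fun x hx => by simp [hx]; rfl
  · refine LinearOn.forall (f := fun x => dForm α a v b x) (hsub (hα.last _ n) ?_) c x y
    exact ((hα.ml v b a n).sgn ((a.deg + v.1) * (b.deg + n))).congr fun x hx => by rw [hx]

end Multilinear

/-! ### Homogeneous components -/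

section Graded

variable {k : Type u} [Field k]
variable {V : Type v} [AddCommGroup V] [Module k V] {gr : ℤ → Submodule k V}
variable {W : Type*} [AddCommGroup W] [Module k W] {gr' : ℤ → Submodule k W}

theorem exists_linear_of_homogeneous (hI : DirectSum.IsInternal gr) (ℓ : ∀ n, gr n →ₗ[k] W) :
    ∃ L : V →ₗ[k] W, ∀ (n : ℤ) (x : gr n), L x = ℓ n x := by
  let e := LinearEquiv.ofBijective (DirectSum.coeLinearMap gr) hI
  refine ⟨DirectSum.toModule k ℤ W ℓ ∘ₗ e.symm.toLinearMap, fun n x => ?_⟩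
  have : e.symm x = DirectSum.lof k ℤ (fun n => gr n) n x := by
    rw [LinearEquiv.symm_apply_eq]
    exact (DirectSum.coeLinearMap_lof gr n x).symm
  simp [this]

theorem homogeneous_induction (hI : DirectSum.IsInternal gr) {P : V → Prop}
    (hom : ∀ n, ∀ x ∈ gr n, P x) (add : ∀ x y, P x → P y → P (x + y)) (x : V) : P x := by
  have hx : x ∈ ⨆ n, gr n := by
    rw [hI.submodule_iSup_eq_top]; trivial
  induction hx using Submodule.iSup_induction' with
  | mem n y hy => exact hom n y hy
  | zero => exact hom 0 0 (zero_mem _)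
  | add y z _ _ hy hz => exact add y z hy hz

/-- The projection to the homogeneous component of degree `n`. -/
noncomputable def proj (hI : DirectSum.IsInternal gr) (n : ℤ) : V →ₗ[k] V :=
  (gr n).subtype ∘ₗ DirectSum.component k ℤ (fun n => gr n) n ∘ₗ
    (LinearEquiv.ofBijective (DirectSum.coeLinearMap gr) hI).symm.toLinearMap

theorem proj_mem (hI : DirectSum.IsInternal gr) (n : ℤ) (x : V) : proj hI n x ∈ gr n :=
  Subtype.property _

theorem proj_of_mem (hI : DirectSum.IsInternal gr) {n m : ℤ} {x : V} (hx : x ∈ gr m) :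
    proj hI n x = if m = n then x else 0 := by
  have : (LinearEquiv.ofBijective (DirectSum.coeLinearMap gr) hI).symm x =
      DirectSum.lof k ℤ (fun n => gr n) m ⟨x, hx⟩ := by
    rw [LinearEquiv.symm_apply_eq]
    exact (DirectSum.coeLinearMap_lof gr m ⟨x, hx⟩).symm
  simp only [proj, LinearMap.comp_apply, LinearEquiv.coe_coe, this]
  split_ifs with h
  · subst h
    rw [DirectSum.component.lof_self]
    rfl
  · rw [DirectSum.component.of, dif_neg h]
    rfl

theorem eq_zero_of_proj (hI : DirectSum.IsInternal gr) {x : V} (h : ∀ n, proj hI n x = 0) :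
    x = 0 := by
  have : (LinearEquiv.ofBijective (DirectSum.coeLinearMap gr) hI).symm x = 0 :=
    DFinsupp.ext fun n => Subtype.ext (h n)
  simpa using this

theorem map_proj (hI : DirectSum.IsInternal gr) (hI' : DirectSum.IsInternal gr') (r : ℤ)
    (T : V →ₗ[k] W) (hT : ∀ n, ∀ x ∈ gr n, T x ∈ gr' (n + r)) (n : ℤ) (x : V) :
    T (proj hI n x) = proj hI' (n + r) (T x) := by
  induction x using homogeneous_induction hI with
  | hom m x hx =>
    rw [proj_of_mem hI hx, proj_of_mem hI' (hT m x hx)]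
    simp only [add_left_inj]
    split_ifs <;> simp
  | add x y hx hy => simp only [map_add, hx, hy]

end Graded

/-! ### Algebras and homomorphisms in terms of operations on words -/

section Operations

variable {k : Type u} [Field k]
variable {V : Type v} [AddCommGroup V] [Module k V]
variable {W : Type v} [AddCommGroup W] [Module k W]

theorem evalList_eq (F : ∀ n : ℕ, MultilinearMap k (fun _ : Fin n => V) W) {n : ℕ} (l : List V)
    (h : l.length = n) : evalList F l = F n fun i => l.get (i.cast h.symm) := by
  subst h
  rfl

theorem evalList_append_cons (F : ∀ n : ℕ, MultilinearMap k (fun _ : Fin n => V) W)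
    (P Q : List V) : ∃ ℓ : V →ₗ[k] W, ∀ y, evalList F (P ++ y :: Q) = ℓ y := by
  have hl : ∀ y, (P ++ y :: Q).length = P.length + (Q.length + 1) := fun y => by simp
  refine ⟨(F (P.length + (Q.length + 1))).toLinearMap
    (fun i => (P ++ 0 :: Q).get (i.cast (hl 0).symm)) ⟨P.length, by omega⟩, fun y => ?_⟩
  rw [evalList_eq F _ (hl y), MultilinearMap.toLinearMap_apply]
  congr 1
  funext i
  rw [Function.update_apply]
  split_ifs with hi
  · subst hi
    simp
  · have : (i : ℕ) ≠ P.length := fun h => hi (Fin.ext h)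
    simp only [List.get_eq_getElem, Fin.val_cast, List.getElem_append]
    split_ifs with h
    · rfl
    · obtain ⟨j, hj⟩ : ∃ j, (i : ℕ) - P.length = j + 1 := ⟨i - P.length - 1, by omega⟩
      simp [hj]

theorem Word.vals_append {gr : ℤ → Submodule k V} (u w : Word gr) :
    Word.vals (u ++ w) = u.vals ++ w.vals :=
  List.map_append ..

theorem ml_evalList {gr : ℤ → Submodule k V}
    (F : ∀ n : ℕ, MultilinearMap k (fun _ : Fin n => V) W) :
    ML fun w : Word gr => evalList F w.vals := fun p q n => by
  obtain ⟨ℓ, hℓ⟩ := evalList_append_cons F p.vals q.vals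
  exact ⟨ℓ, fun x _ => by
    rw [← hℓ]
    exact congrArg (evalList F) (Word.vals_append p (x :: q))⟩

theorem Algebra.isOp (A : Algebra k V) : IsOp 1 A.op :=
  ⟨fun _ => rfl, ml_evalList A.m, A.evalList_m_nil⟩

theorem Algebra.der_op (A : Algebra k V) (w : Word A.gr) :
    der A.op (fun l => (A.op l).val) w = 0 := by
  rw [← A.m_rel w]
  refine sum₃_congr fun a b c _ => ?_
  congr 1
  exact congrArg (evalList A.m) (Word.vals_append a (A.op b :: c))

theorem Algebra.op_singleton (A : Algebra k V) (x : Homog A.gr) : (A.op [x]).val = A.d x.val :=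
  A.evalList_m_singleton x.val

theorem Algebra.d_mem (A : Algebra k V) (n : ℤ) (x : V) (hx : x ∈ A.gr n) : A.d x ∈ A.gr (n + 1) := by
  have := (A.op [⟨n, ⟨x, hx⟩⟩]).val_mem
  rw [A.op_singleton, A.isOp.deg, Word.deg_cons, Word.deg_nil, add_zero] at this
  exact this

theorem Algebra.d_d (A : Algebra k V) (x : V) : A.d (A.d x) = 0 := by
  induction x using homogeneous_induction A.internal with
  | hom n x hx =>
    have := A.der_op [⟨n, ⟨x, hx⟩⟩]
    rw [der_cons A.isOp A.isOp.ml, sum₂_nil, der_nil A.isOp (A.isOp.ml.cons _), smul_zero, add_zero,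
      A.op_singleton, A.op_singleton] at this
    exact this
  | add x y hx hy => simp only [map_add, hx, hy, add_zero]

variable {A : Algebra k V} {B : Algebra k W}

theorem Hom.isOp (F : Hom A B) : IsOp 0 F.op :=
  ⟨fun w => (add_zero w.deg).symm, ml_evalList F.f, by
    change F.f 0 _ = 0
    rw [F.f_zero]; rfl⟩

theorem Hom.der_op (F : Hom A B) (w : Word A.gr) :
    der A.op (fun l => (F.op l).val) w = hat F.op (fun L => (B.op L).val) w := by
  refine Eq.trans ?_ ((F.f_rel w).trans ?_)
  · refine sum₃_congr fun a b c _ => ?_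
    congr 1
    exact congrArg (evalList F.f) (Word.vals_append a (A.op b :: c))
  · refine Finset.sum_congr rfl fun c _ => ?_
    change _ = evalList B.m (Word.vals _)
    rw [Word.vals, List.map_map]
    rfl

theorem Hom.op_singleton (F : Hom A B) (x : Homog A.gr) : (F.op [x]).val = F.linear x.val :=
  F.evalList_f_singleton x.val

theorem Hom.linear_mem (F : Hom A B) (n : ℤ) (x : V) (hx : x ∈ A.gr n) :
    F.linear x ∈ B.gr (n + 0) := by
  have := (F.op [⟨n, ⟨x, hx⟩⟩]).val_mem
  rw [F.op_singleton, F.isOp.deg, Word.deg_cons, Word.deg_nil, add_zero] at this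
  exact this

theorem Hom.pullback_eq (F : Hom A B) (φ : DualMap B) : F.pullback φ = pull₂ F.op φ := rfl

theorem Hom.isQuasiIso_iff (F : Hom A B) : F.IsQuasiIso ↔
    (∀ x, A.d x = 0 → F.linear x ∈ LinearMap.range B.d → x ∈ LinearMap.range A.d) ∧
    ∀ y, B.d y = 0 → ∃ x, A.d x = 0 ∧ y - F.linear x ∈ LinearMap.range B.d := by
  have zA : ∀ {x : LinearMap.ker A.d}, (Submodule.Quotient.mk x : A.Cohomology) = 0 ↔
      x.1 ∈ LinearMap.range A.d := Submodule.Quotient.mk_eq_zero _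
  have zB : ∀ {x : LinearMap.ker B.d}, (Submodule.Quotient.mk x : B.Cohomology) = 0 ↔
      x.1 ∈ LinearMap.range B.d := Submodule.Quotient.mk_eq_zero _
  have eB : ∀ x y : LinearMap.ker B.d, (Submodule.Quotient.mk x : B.Cohomology) =
      Submodule.Quotient.mk y ↔ x.1 - y.1 ∈ LinearMap.range B.d := fun x y =>
    Submodule.Quotient.eq _
  refine and_congr ?_ ?_
  · rw [← LinearMap.ker_eq_bot, LinearMap.ker_eq_bot']
    constructor
    · intro h x hx hFx
      have := h (Submodule.Quotient.mk ⟨x, hx⟩) (zB.2 hFx)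
      exact zA.1 this
    · intro h q hq
      induction q using Submodule.Quotient.induction_on with
      | _ x => exact zA.2 (h x.1 x.2 (zB.1 hq))
  · constructor
    · intro h y hy
      obtain ⟨q, hq⟩ := h (Submodule.Quotient.mk ⟨y, hy⟩)
      induction q using Submodule.Quotient.induction_on with
      | _ x => exact ⟨x.1, x.2, (eB _ _).1 hq.symm⟩
    · intro h q
      induction q using Submodule.Quotient.induction_on with
      | _ y =>
        obtain ⟨x, hx, hxy⟩ := h y.1 y.2
        exact ⟨Submodule.Quotient.mk ⟨x, hx⟩, ((eB _ _).2 hxy).symm⟩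

end Operations

/-! ### Pullback of strong homotopy inner products -/

section Pullback

variable {k : Type u} [Field k]
variable {V : Type v} [AddCommGroup V] [Module k V]
variable {W : Type v} [AddCommGroup W] [Module k W]
variable {A : Algebra k V} {B : Algebra k W}

theorem IsMultilinear.linearOn_last {φ : DualMap A} (hφ : IsMultilinear φ) (a : Word A.gr)
    (v : Homog A.gr) (b : Word A.gr) (n : ℤ) : LinearOn n (φ a v b) :=
  .of_forall fun c x y => hφ.last a v b n c x y

theorem IsMultilinear.linearOn_mid {φ : DualMap A} (hφ : IsMultilinear φ) (a : Word A.gr)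
    (b : Word A.gr) (w : Homog A.gr) (n : ℤ) : LinearOn n fun v => φ a v b w :=
  .of_forall fun c x y => hφ.mid a n c x y b w

/-- The bimodule equation with `a` and `b` empty: `φ_{0,0}` is a chain map, hence descends to
cohomology. -/
theorem IsBimoduleMap.differential {d : ℤ} {φ : DualMap A} (hφ : IsBimoduleMap d φ)
    (v w : Homog A.gr) :
    φ [] (A.op [v]) [] w = -(v.1.negOnePow • φ [] v [] (A.op [w])) := by
  have h := congrFun (congrFun (congrFun (congrFun hφ.equation []) v) []) w
  have h1 : φ [A.op []] v [] w = 0 :=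
    (LinearOn.of_forall (n := (A.op []).1) (f := fun x => φ [x] v [] w) fun c x y =>
      hφ.multilinear.left [] [] _ c x y v [] w).apply_zero rfl A.isOp.nil
  have h2 : φ [] v [A.op []] w = 0 :=
    (LinearOn.of_forall (n := (A.op []).1) (f := fun x => φ [] v [x] w) fun c x y =>
      hφ.multilinear.right [] v [] [] _ c x y w).apply_zero rfl A.isOp.nil
  simpa [DualMap.compOp, DualMap.dualOpComp, sum₃, Algebra.dualOp, h1, h2] using h

theorem IsBimoduleMap.exact {d : ℤ} {φ : DualMap A} (hφ : IsBimoduleMap d φ)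
    {v w : Homog A.gr} (hv : A.d v.val = 0) (hw : w.val ∈ LinearMap.range A.d) :
    φ [] v [] w = 0 := by
  obtain ⟨z, hz⟩ := hw
  -- A preimage of `w` under the differential need not be homogeneous; its component of degree `|w|'
  -- - 1` is again a preimage.
  let z' : Homog A.gr := ⟨w.1 - 1, ⟨proj A.internal (w.1 - 1) z, proj_mem _ _ _⟩⟩
  have hz' : A.op [z'] = w := by
    refine Homog.ext (by simp [A.isOp.deg, z']) ?_
    rw [A.op_singleton]
    change A.d (proj A.internal (w.1 - 1) z) = _
    rw [map_proj A.internal A.internal 1 A.d A.d_mem, hz, sub_add_cancel,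
      proj_of_mem _ w.val_mem, if_pos rfl]
  have h := hφ.differential v z'
  rw [hz', (hφ.multilinear.linearOn_mid [] [] z' _).apply_zero rfl
    (by rw [A.op_singleton, hv]), eq_comm, neg_eq_zero] at h
  exact (smul_eq_zero_iff_eq _).1 h

theorem pull₂_nil {gr : ℤ → Submodule k V} {gr' : ℤ → Submodule k W} (f : Word gr → Homog gr')
    (φ : PreMap gr' gr' gr') (v w : Homog gr) :
    pull₂ f φ [] v [] w = φ [] (f [v]) [] (f [w]) := by
  simp [pull₂]

theorem pull₂_zero {gr : ℤ → Submodule k V} {gr' : ℤ → Submodule k W} (f : Word gr → Homog gr') :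
    pull₂ f (fun _ _ _ _ => (0 : k)) = fun _ _ _ _ => 0 := by
  funext a v b w
  simp [pull₂]

theorem pull₂_degree {gr : ℤ → Submodule k V} {gr' : ℤ → Submodule k W} {f : Word gr → Homog gr'}
    (hf : IsOp 0 f) {d : ℤ} {φ : PreMap gr' gr' gr'}
    (hφ : ∀ (a : Word gr') (v : Homog gr') (b : Word gr') (w : Homog gr'),
      a.deg + v.1 + b.deg + w.1 ≠ d → φ a v b w = 0)
    (a : Word gr) (v : Homog gr) (b : Word gr) (w : Homog gr)
    (h : a.deg + v.1 + b.deg + w.1 ≠ d) : pull₂ f φ a v b w = 0 := by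
  rw [pull₂, ← sum₂_zero a]
  refine sum₂_congr fun a₁ a' ha => ?_
  rw [← sum₂_zero b]
  refine sum₂_congr fun b' b₃ hb => ?_
  rw [← smul_zero (Int.negOnePow _)]
  congr 1
  rw [← sum₂_zero a']
  refine sum₂_congr fun a₂ a₃ ha' => ?_
  rw [← sum₂_zero b']
  refine sum₂_congr fun b₁ b₂ hb' => ?_
  rw [← hat_zero f a₂]
  refine hat_deg_congr hf _ fun L₁ h₁ => ?_
  rw [← hat_zero f b₂]
  refine hat_deg_congr hf _ fun L₂ h₂ => ?_
  refine hφ _ _ _ _ fun hd => h ?_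
  subst ha hb ha' hb'
  rw [← hd, h₁, h₂, hf.deg, hf.deg]
  simp only [Word.deg_append, Word.deg_cons]
  ring

variable [CharZero k]

/-- A closed two-form has a primitive. -/
theorem IsStrongHomotopyInnerProduct.exists_primitive {d : ℤ} {φ : DualMap A}
    (hφ : IsStrongHomotopyInnerProduct d φ) :
    ∃ α : Word A.gr → Homog A.gr → k, IsOneForm α ∧ dForm α = φ :=
  ⟨primitive φ, .primitive hφ.bimoduleMap.multilinear, dForm_primitive hφ.skew hφ.closed⟩

/-- With `φ = dα` one has `f^*φ = d(f^*α)`, and exactness yields multilinearity, skew symmetry and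
closedness. Only the bimodule equation uses the full homomorphism equation, and only non-degeneracy
uses that `f` is a quasi-isomorphism. -/
theorem IsStrongHomotopyInnerProduct.pullback {d : ℤ} {φ : DualMap B}
    (hφ : IsStrongHomotopyInnerProduct d φ) (F : Hom A B) (hF : F.IsQuasiIso) :
    IsStrongHomotopyInnerProduct d (F.pullback φ) := by
  obtain ⟨α, hα, rfl⟩ := hφ.exists_primitive
  have hp : F.pullback (dForm α) = dForm (pull₁ F.op α) := pull₂_dForm F.isOp α
  have hα' := hα.pull₁ F.isOp
  refine ⟨⟨?_, fun a v b w h => pull₂_degree F.isOp hφ.bimoduleMap.degree a v b w h, ?_⟩, ?_, ?_, ?_⟩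
  · rw [hp]
    exact hα'.isMultilinear
  -- The Lie derivative of `α` itself need not vanish, only its differential; this vanishing is what
  -- is pulled back.
  · have h0 : dForm (lie B.op α) = fun _ _ _ _ => 0 := by
      funext a v b w
      rw [← lie_dForm hα B.isOp, hφ.bimoduleMap.equation, sub_self]
    funext a v b w
    rw [← sub_eq_zero, hp, lie_dForm hα' A.isOp,
      ← pull₁_lie A.isOp B.isOp F.isOp F.der_op hα, ← pull₂_dForm F.isOp, h0, pull₂_zero]
  · rw [hp]
    exact dForm_skew _
  · rw [hp]
    exact dForm_closed _
  · intro a ha ha'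
    obtain ⟨hinj, hsurj⟩ := F.isQuasiIso_iff.1 hF
    have hFa : B.d (F.op [a]).val = 0 := by rw [F.op_singleton, ← F.linear_comm, ha, map_zero]
    obtain ⟨b, hb, hab⟩ := hφ.nondegenerate (F.op [a]) hFa fun h =>
      ha' (hinj _ ha (by rwa [F.op_singleton] at h))
    -- The class `b` pairing with `f₁ a` is cohomologous to some `f₁ y`. The component of `y` in the
    -- degree of `b` still works, and `φ_{0,0}` does not see the exact difference.
    obtain ⟨y, hy, z, hz⟩ := hsurj b.val hb
    let y' : Homog A.gr := ⟨b.1, ⟨proj A.internal b.1 y, proj_mem _ _ _⟩⟩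
    have hy' : A.d y'.val = 0 := by
      change A.d (proj A.internal b.1 y) = 0
      rw [map_proj A.internal A.internal 1 A.d A.d_mem, hy, map_zero]
    refine ⟨y', hy', ?_⟩
    rw [F.pullback_eq, pull₂_nil]
    intro h0
    apply hab
    obtain ⟨ℓ, hℓ⟩ := hφ.bimoduleMap.multilinear.linearOn_last [] (F.op [a]) [] b.1
    have hdiff : b.val - (F.op [y']).val ∈ LinearMap.range B.d := by
      refine ⟨proj B.internal (b.1 - 1) z, ?_⟩
      rw [map_proj B.internal B.internal 1 B.d B.d_mem, hz, sub_add_cancel, map_sub,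
        proj_of_mem _ b.val_mem, if_pos rfl, F.op_singleton]
      change _ = _ - F.linear (proj A.internal b.1 y)
      rw [map_proj A.internal B.internal 0 F.linear F.linear_mem, add_zero]
    have hmem : b.val - (F.op [y']).val ∈ B.gr b.1 :=
      sub_mem b.val_mem (by simpa [F.isOp.deg, y'] using (F.op [y']).val_mem)
    have h1 := hφ.bimoduleMap.exact (v := F.op [a]) (w := ⟨b.1, ⟨_, hmem⟩⟩) hFa hdiff
    have h2 : ℓ (b.val - (F.op [y']).val) = 0 := (hℓ ⟨b.1, ⟨_, hmem⟩⟩ rfl).symm.trans h1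
    rw [map_sub, ← hℓ b rfl, ← hℓ _ (by simp [F.isOp.deg, y']), h0, sub_zero] at h2
    exact h2

end Pullback

/-! ### From functions on homogeneous words to multilinear maps -/

section Extension

variable {k : Type u} [Field k]
variable {V : Type v} [AddCommGroup V] [Module k V] {gr : ℤ → Submodule k V}
variable {N : Type v} [AddCommGroup N] [Module k N]

theorem ofFn_update {α : Type*} {n : ℕ} [DecidableEq (Fin n)] (y : Fin n → α) (i : Fin n) (z : α) :
    List.ofFn (Function.update y i z) =
      (List.ofFn y).take i ++ z :: (List.ofFn y).drop (i + 1) := by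
  have h : List.ofFn (Function.update y i z) = (List.ofFn y).set i z := by
    refine List.ext_getElem (by simp) fun j h₁ h₂ => ?_
    rw [List.getElem_set, List.getElem_ofFn, Function.update_apply]
    simp only [Fin.ext_iff, List.getElem_ofFn]
    exact if_congr eq_comm rfl rfl
  rw [h, List.set_eq_take_append_cons_drop, if_pos (by simp)]

/-- A multilinear function of homogeneous words extends to a family of multilinear maps. -/
theorem ML.exists_evalList (hI : DirectSum.IsInternal gr) {G : Word gr → N} (hG : ML G) :
    ∃ F : ∀ n : ℕ, MultilinearMap k (fun _ : Fin n => V) N,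
      ∀ w : Word gr, evalList F w.vals = G w := by
  let e := LinearEquiv.ofBijective (DirectSum.coeLinearMap gr) hI
  have key : ∀ (n : ℕ) (p : Fin n → ℤ) [DecidableEq (Fin n)] (x : ∀ i, gr (p i)) (i : Fin n),
      ∃ ℓ : V →ₗ[k] N, ∀ z : gr (p i),
        G (List.ofFn fun j => (⟨p j, Function.update x i z j⟩ : Homog gr)) = ℓ z := by
    intro n p _ x i
    obtain ⟨ℓ, hℓ⟩ := hG ((List.ofFn fun j => (⟨p j, x j⟩ : Homog gr)).take i)
      ((List.ofFn fun j => (⟨p j, x j⟩ : Homog gr)).drop (i + 1)) (p i)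
    refine ⟨ℓ, fun z => ?_⟩
    have h := Function.apply_update (fun j (t : gr (p j)) => (⟨p j, t⟩ : Homog gr)) x i z
    rw [show (fun j => (⟨p j, Function.update x i z j⟩ : Homog gr)) =
      Function.update (fun j => (⟨p j, x j⟩ : Homog gr)) i ⟨p i, z⟩ by
        funext j; rw [h j]]
    rw [ofFn_update]
    exact hℓ ⟨p i, z⟩ rfl
  let f : ∀ (n : ℕ) (p : Fin n → ℤ), MultilinearMap k (fun i => gr (p i)) N := fun n p =>
    { toFun := fun x => G (List.ofFn fun j => (⟨p j, x j⟩ : Homog gr))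
      map_update_add' := fun x i y z => by
        obtain ⟨ℓ, hℓ⟩ := key n p x i
        rw [hℓ, hℓ, hℓ, Submodule.coe_add, map_add]
      map_update_smul' := fun x i c z => by
        obtain ⟨ℓ, hℓ⟩ := key n p x i
        rw [hℓ, hℓ, Submodule.coe_smul, map_smul] }
  refine ⟨fun n => (MultilinearMap.fromDFinsuppEquiv (fun _ : Fin n => ℤ) k (f n)).compLinearMap
    fun _ => e.symm.toLinearMap, fun w => ?_⟩
  rw [evalList_eq _ (n := w.length) _ (by simp [Word.vals]), MultilinearMap.compLinearMap_apply]
  have h : ∀ i : Fin w.length, e.symm (w.get i).val =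
      DFinsupp.single (w.get i).1 (w.get i).2 := by
    intro i
    rw [LinearEquiv.symm_apply_eq]
    exact (DirectSum.coeLinearMap_lof gr _ _).symm
  have h' : ∀ i : Fin w.length,
      e.symm.toLinearMap (w.vals.get (i.cast (by simp [Word.vals]))) =
      DFinsupp.single (w.get i).1 (w.get i).2 := by
    intro i
    rw [← h i]
    simp [Word.vals]
    rfl
  simp only [h']
  refine (MultilinearMap.fromDFinsuppEquiv_single (κ := fun _ : Fin w.length => ℤ) (R := k)
    (M := fun _ j => gr j)
    (f w.length) (fun i => (w.get i).1) fun i => (w.get i).2).trans ?_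
  change G (List.ofFn fun j => w.get j) = G w
  rw [List.ofFn_get]

theorem eq_zero_of_evalList_nil {F : ∀ n : ℕ, MultilinearMap k (fun _ : Fin n => V) N}
    (h : evalList F [] = 0) : F 0 = 0 := by
  ext x
  rw [Subsingleton.elim x ([] : List V).get]
  exact h

end Extension

/-! ### Construction and composition of algebras and homomorphisms -/

section Construction

variable {k : Type u} [Field k]
variable {V : Type v} [AddCommGroup V] [Module k V] {gr : ℤ → Submodule k V}
variable {W : Type v} [AddCommGroup W] [Module k W] {gr' : ℤ → Submodule k W}
variable {U : Type v} [AddCommGroup U] [Module k U]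

/-- Modulo `S`, membership becomes vanishing, and `hat_deg_congr` applies. -/
theorem hat_mem {f : Word gr → Homog gr'} (hf : IsOp 0 f) {N : Type*} [AddCommGroup N] [Module k N]
    (S : Submodule k N) {G : Word gr' → N} (w : Word gr)
    (h : ∀ L : Word gr', L.deg = w.deg → G L ∈ S) : hat f G w ∈ S := by
  rw [← Submodule.Quotient.mk_eq_zero, ← Submodule.mkQ_apply, map_hat, ← hat_zero f w]
  exact hat_deg_congr hf w fun L hL => (Submodule.Quotient.mk_eq_zero S).2 (h L hL)

theorem der_mem {m : Word gr → Homog gr} (hm : IsOp 1 m) {N : Type*} [AddCommGroup N] [Module k N]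
    (S : Submodule k N) {G : Word gr → N} (w : Word gr)
    (h : ∀ l : Word gr, l.deg = w.deg + 1 → G l ∈ S) : der m G w ∈ S := by
  rw [← Submodule.Quotient.mk_eq_zero, ← Submodule.mkQ_apply, map_der, der, ← sum₃_zero w]
  refine sum₃_congr fun a b c habc => ?_
  rw [Submodule.mkQ_apply, (Submodule.Quotient.mk_eq_zero S).2, smul_zero]
  refine h _ ?_
  subst habc
  rw [Word.deg_append, Word.deg_cons, hm.deg, Word.deg_append, Word.deg_append]
  ring

theorem der_hat_of_forall {m : Word gr → Homog gr} (hm : IsOp 1 m) {m' : Word gr' → Homog gr'}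
    (hm' : IsOp 1 m') {f : Word gr → Homog gr'} (hf : IsOp 0 f) {N : Type*} [AddCommGroup N]
    [Module k N] {G : Word gr' → N} (hG : ML G) (w : Word gr)
    (h : ∀ u : Word gr, u.length ≤ w.length →
      der m (fun l => (f l).val) u = hat f (fun L => (m' L).val) u) :
    der m (hat f G) w = hat f (der m' G) w := by
  rw [der_hat hm hm' hf hG w (fun u hu => h u hu.le) ⟨Word.deg w + 1, 0⟩ rfl
    (by rw [h w le_rfl]; exact (add_zero _).symm), hG.linearOn_cons [] _ |>.apply_zero rfl rfl,
    add_zero]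

/-- The multilinear maps underlying a family of operations. -/
noncomputable def toMultilinear (hI : DirectSum.IsInternal gr) {r : ℤ} {op : Word gr → Homog gr'}
    (h : IsOp r op) : ∀ n : ℕ, MultilinearMap k (fun _ : Fin n => V) W :=
  (h.ml.exists_evalList hI).choose

theorem evalList_toMultilinear (hI : DirectSum.IsInternal gr) {r : ℤ} {op : Word gr → Homog gr'}
    (h : IsOp r op) (w : Word gr) : evalList (toMultilinear hI h) w.vals = (op w).val :=
  (h.ml.exists_evalList hI).choose_spec w

/-- The `A_∞`-algebra with given operations on homogeneous words. -/
noncomputable abbrev Algebra.ofOp (hI : DirectSum.IsInternal gr) {m : Word gr → Homog gr}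
    (hm : IsOp 1 m) (h : ∀ w, der m (fun l => (m l).val) w = 0) : Algebra k V where
  gr := gr
  internal := hI
  m := toMultilinear hI hm
  m_zero := eq_zero_of_evalList_nil ((evalList_toMultilinear hI hm []).trans hm.nil)
  m_deg w := by
    rw [evalList_toMultilinear, ← hm.deg]
    exact (m w).val_mem
  m_rel w := by
    rw [← h w]
    refine sum₃_congr fun a b c _ => ?_
    dsimp only
    rw [evalList_toMultilinear, ← evalList_toMultilinear hI hm (a ++ m b :: c), Word.vals_append]
    rfl

theorem Algebra.ofOp_op (hI : DirectSum.IsInternal gr) {m : Word gr → Homog gr}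
    (hm : IsOp 1 m) (h : ∀ w, der m (fun l => (m l).val) w = 0) :
    (Algebra.ofOp hI hm h).op = m := by
  funext w
  exact Homog.ext (hm.deg w).symm (evalList_toMultilinear hI hm w)

theorem Hom.exists_of_op {A : Algebra k V} {B : Algebra k W} {f : Word A.gr → Homog B.gr}
    (hf : IsOp 0 f)
    (h : ∀ w, der A.op (fun l => (f l).val) w = hat f (fun L => (B.op L).val) w) :
    ∃ F : Hom A B, F.op = f := by
  refine ⟨⟨toMultilinear A.internal hf,
    eq_zero_of_evalList_nil ((evalList_toMultilinear A.internal hf []).trans hf.nil),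
    fun w => ?_, fun w => ?_⟩, ?_⟩
  · rw [evalList_toMultilinear, ← add_zero w.deg, ← hf.deg]
    exact (f w).val_mem
  · refine Eq.trans ?_ ((h w).trans ?_)
    · refine sum₃_congr fun a b c _ => ?_
      dsimp only
      rw [← evalList_toMultilinear A.internal hf (a ++ A.op b :: c), Word.vals_append]
      rfl
    · refine Finset.sum_congr rfl fun c _ => ?_
      change evalList B.m (Word.vals _) = _
      rw [Word.vals, List.map_map]
      congr 1
      exact List.map_congr_left fun u _ => (evalList_toMultilinear A.internal hf u).symm
  · funext w
    exact Homog.ext (by rw [hf.deg, add_zero]; rfl) (evalList_toMultilinear A.internal hf w)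

variable {A : Algebra k V} {B : Algebra k W} {C : Algebra k U}

/-- Composition of `A_∞`-homomorphisms. -/
theorem Hom.exists_comp (F : Hom B C) (G : Hom A B) : ∃ H : Hom A C,
    ∀ w, (H.op w).val = hat G.op (fun L => (F.op L).val) w := by
  let f : Word A.gr → Homog C.gr := fun w => ⟨w.deg, ⟨hat G.op (fun L => (F.op L).val) w,
    hat_mem G.isOp _ w fun L hL => by
      rw [← hL]
      exact (F.op L).val_mem⟩⟩
  have hf : IsOp 0 f := ⟨fun w => (add_zero _).symm, F.isOp.ml.hat G.isOp, by
    change hat G.op (fun L => (F.op L).val) [] = 0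
    rw [hat_nil, F.isOp.nil]⟩
  obtain ⟨H, hH⟩ := Hom.exists_of_op hf fun w => by
    rw [← hat_hat F.isOp G.isOp hf (fun u _ => rfl) C.isOp.ml]
    refine (der_hat_of_forall A.isOp B.isOp G.isOp F.isOp.ml w fun u _ => G.der_op u).trans ?_
    exact hat_congr_fun _ _ fun L => F.der_op L
  exact ⟨H, fun w => by rw [hH]; rfl⟩

theorem Hom.linear_of_comp {F : Hom B C} {G : Hom A B} {H : Hom A C}
    (h : ∀ w, (H.op w).val = hat G.op (fun L => (F.op L).val) w) (x : V) :
    H.linear x = F.linear (G.linear x) := by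
  induction x using homogeneous_induction A.internal with
  | hom n x hx =>
    have := h [⟨n, ⟨x, hx⟩⟩]
    rw [H.op_singleton, hat_cons, sum₂_nil, hat_nil, F.op_singleton, G.op_singleton] at this
    exact this
  | add x y hx hy => simp only [map_add, hx, hy]

theorem Hom.isQuasiIso_of_comp {F : Hom B C} {G : Hom A B} {H : Hom A C}
    (h : ∀ w, (H.op w).val = hat G.op (fun L => (F.op L).val) w)
    (hF : F.IsQuasiIso) (hG : G.IsQuasiIso) : H.IsQuasiIso := by
  rw [Hom.isQuasiIso_iff] at *
  have hl := Hom.linear_of_comp h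
  refine ⟨fun x hx hr => ?_, fun y hy => ?_⟩
  · rw [hl] at hr
    exact hG.1 x hx (hF.1 _ (by rw [← G.linear_comm, hx, map_zero]) hr)
  · obtain ⟨z, hz, c, hc⟩ := hF.2 y hy
    obtain ⟨x, hx, e, he⟩ := hG.2 z hz
    refine ⟨x, hx, c + F.linear e, ?_⟩
    rw [map_add, hc, ← F.linear_comm, he, hl, map_sub]
    abel

/-- Functoriality is checked on a primitive, where it is `pull₁_pull₁`; hence the assumption on `φ`.
-/
theorem Hom.pullback_of_comp [CharZero k] {F : Hom B C} {G : Hom A B} {H : Hom A C}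
    (h : ∀ w, (H.op w).val = hat G.op (fun L => (F.op L).val) w) {d : ℤ} {φ : DualMap C}
    (hφ : IsStrongHomotopyInnerProduct d φ) : H.pullback φ = G.pullback (F.pullback φ) := by
  obtain ⟨α, hα, rfl⟩ := hφ.exists_primitive
  rw [H.pullback_eq, G.pullback_eq, F.pullback_eq, pull₂_dForm H.isOp, pull₂_dForm F.isOp,
    pull₂_dForm G.isOp, pull₁_pull₁ F.isOp G.isOp H.isOp (fun u _ => h u) hα]

end Construction

/-! ### Retraction of a complex onto its cohomology -/

section Retracts

variable {k : Type u} [Field k]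
variable {V : Type v} [AddCommGroup V] [Module k V]
variable {U : Type v} [AddCommGroup U] [Module k U]

/-- A deformation retract of the complex `A` onto a graded vector space with zero differential. -/
structure Retract (A : Algebra k V) (gr : ℤ → Submodule k U) where
  internal : DirectSum.IsInternal gr
  i : U →ₗ[k] V
  p : V →ₗ[k] U
  h : V →ₗ[k] V
  i_mem : ∀ n, ∀ x ∈ gr n, i x ∈ A.gr n
  p_mem : ∀ n, ∀ x ∈ A.gr n, p x ∈ gr n
  h_mem : ∀ n, ∀ x ∈ A.gr n, h x ∈ A.gr (n - 1)
  d_i : ∀ x, A.d (i x) = 0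
  p_d : ∀ x, p (A.d x) = 0
  p_i : ∀ x, p (i x) = x
  -- The homotopy identity is needed on cycles only, since the obstructions to which it is applied
  -- are closed.
  d_h : ∀ x, A.d x = 0 → A.d (h (x - i (p x))) = x - i (p x)

theorem isInternal_range_lof (H : ℤ → Type v) [∀ n, AddCommGroup (H n)] [∀ n, Module k (H n)] :
    DirectSum.IsInternal fun n => LinearMap.range (DirectSum.lof k ℤ H n) := by
  let D : DirectSum ℤ H →ₗ[k] DirectSum ℤ fun n => LinearMap.range (DirectSum.lof k ℤ H n) :=
    DirectSum.toModule k ℤ _ fun n => DirectSum.lof k ℤ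
      (fun n => LinearMap.range (DirectSum.lof k ℤ H n)) n ∘ₗ (DirectSum.lof k ℤ H n).rangeRestrict
  have := DirectSum.Decomposition.ofLinearMap
    (fun n => LinearMap.range (DirectSum.lof k ℤ H n)) D
    (by
      refine DirectSum.linearMap_ext _ fun n => ?_
      ext x : 1
      simp [D, DirectSum.coeLinearMap_lof])
    (by
      refine DirectSum.linearMap_ext _ fun n => ?_
      ext ⟨_, x, rfl⟩ : 1
      simp only [LinearMap.comp_apply, DirectSum.coeLinearMap_lof, D, DirectSum.toModule_lof]
      rfl)
  exact DirectSum.Decomposition.isInternal _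

/-- `H` is the cohomology in degree `n`, `s` a choice of representing cycles, and `q` an extension
of the projection from the cycles to all of `gr n`. -/
theorem Algebra.exists_representatives (A : Algebra k V) (n : ℤ) :
    ∃ (H : Type v) (_ : AddCommGroup H) (_ : Module k H) (s : H →ₗ[k] V) (q : A.gr n →ₗ[k] H),
      (∀ y, s y ∈ A.gr n ∧ A.d (s y) = 0) ∧
      (∀ x : A.gr n, A.d x = 0 → x - s (q x) ∈ LinearMap.range A.d) ∧
      (∀ x : A.gr n, (x : V) ∈ LinearMap.range A.d → q x = 0) ∧
      ∀ (x : A.gr n) (y : H), s y = x → q x = y := by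
  let Z : Submodule k (A.gr n) := LinearMap.ker (A.d ∘ₗ (A.gr n).subtype)
  let ι : Z →ₗ[k] V := (A.gr n).subtype ∘ₗ Z.subtype
  let Q : Submodule k Z := (LinearMap.range A.d).comap ι
  obtain ⟨s, hs⟩ := LinearMap.exists_rightInverse_of_surjective Q.mkQ (Submodule.range_mkQ _)
  obtain ⟨q, hq⟩ := LinearMap.exists_extend Q.mkQ
  have hqZ : ∀ z : Z, q z.1 = Q.mkQ z := LinearMap.congr_fun hq
  have hs' : ∀ y, Q.mkQ (s y) = y := LinearMap.congr_fun hs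
  refine ⟨Z ⧸ Q, inferInstance, inferInstance, ι ∘ₗ s, q, fun y => ⟨(s y).1.2, (s y).2⟩,
    fun x hx => ?_, fun x hx => ?_, fun x y h => ?_⟩
  · let z : Z := ⟨x, hx⟩
    have h : z - s (Q.mkQ z) ∈ Q := by
      rw [← Submodule.Quotient.mk_eq_zero, ← Submodule.mkQ_apply, map_sub, hs', sub_self]
    rw [hqZ z]
    exact h
  · obtain ⟨t, ht⟩ := hx
    let z : Z := ⟨x, by
      change A.d x = 0
      rw [← ht, A.d_d]⟩
    rw [hqZ z]
    exact (Submodule.Quotient.mk_eq_zero _).2 ⟨t, ht⟩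
  · rw [show x = (s y).1 from Subtype.ext h.symm, hqZ, hs']

/-- The cohomology of `A` is a deformation retract of `A`. -/
theorem Algebra.exists_retract (A : Algebra k V) :
    ∃ (U : Type v) (_ : AddCommGroup U) (_ : Module k U) (gr : ℤ → Submodule k U),
      Nonempty (Retract A gr) := by
  choose H _ _ s q hs hq hq0 hqs using A.exists_representatives
  -- A section of the differential onto its image, extended to `τ` on all of `V`. As `τ` need not
  -- respect degrees, `h` keeps only its component of degree `n - 1`.
  obtain ⟨σ, hσ⟩ := LinearMap.exists_rightInverse_of_surjective A.d.rangeRestrict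
    (LinearMap.range_rangeRestrict _)
  obtain ⟨τ, hτ⟩ := LinearMap.exists_extend σ
  have hτ' : ∀ x, A.d (τ (A.d x)) = A.d x := by
    intro x
    have h1 : τ (A.d x) = σ (A.d.rangeRestrict x) := LinearMap.congr_fun hτ (A.d.rangeRestrict x)
    rw [h1]
    exact congrArg Subtype.val (LinearMap.congr_fun hσ (A.d.rangeRestrict x))
  obtain ⟨p, hp⟩ := exists_linear_of_homogeneous (W := DirectSum ℤ H) A.internal fun n =>
    DirectSum.lof k ℤ H n ∘ₗ q n
  obtain ⟨h, hh⟩ := exists_linear_of_homogeneous A.internal fun n =>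
    proj A.internal (n - 1) ∘ₗ τ ∘ₗ (A.gr n).subtype
  let i : (DirectSum ℤ H) →ₗ[k] V := DirectSum.toModule k ℤ V s
  have hi : ∀ n y, i (DirectSum.lof k ℤ H n y) = s n y := fun n y => by simp [i]
  have i_mem : ∀ n, ∀ x ∈ LinearMap.range (DirectSum.lof k ℤ H n), i x ∈ A.gr n := by
    rintro n _ ⟨y, rfl⟩
    rw [hi]
    exact (hs n y).1
  have p_mem : ∀ n, ∀ x ∈ A.gr n, p x ∈ LinearMap.range (DirectSum.lof k ℤ H n) :=
    fun n x hx => ⟨q n ⟨x, hx⟩, (hp n ⟨x, hx⟩).symm⟩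
  have h_mem : ∀ n, ∀ x ∈ A.gr n, h x ∈ A.gr (n - 1) := fun n x hx => by
    rw [hh n ⟨x, hx⟩]
    exact proj_mem _ _ _
  have d_h : ∀ n, ∀ x ∈ A.gr n, A.d x = 0 → A.d (h (x - i (p x))) = x - i (p x) := by
    intro n x hx hdx
    obtain ⟨y, hy⟩ : x - i (p x) ∈ LinearMap.range A.d := by
      rw [hp n ⟨x, hx⟩, LinearMap.comp_apply, hi]
      exact hq n ⟨x, hx⟩ hdx
    have hm : x - i (p x) ∈ A.gr n := sub_mem hx (i_mem n _ (p_mem n x hx))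
    rw [hh n ⟨_, hm⟩]
    simp only [LinearMap.comp_apply, Submodule.subtype_apply]
    rw [map_proj A.internal A.internal 1 A.d A.d_mem, ← hy, hτ', sub_add_cancel, hy,
      proj_of_mem _ hm, if_pos rfl]
  refine ⟨DirectSum ℤ H, inferInstance, inferInstance,
    fun n => LinearMap.range (DirectSum.lof k ℤ H n),
    ⟨⟨isInternal_range_lof H, i, p, h, i_mem, p_mem, h_mem, ?_, ?_, ?_, ?_⟩⟩⟩
  · intro x
    have : A.d ∘ₗ i = 0 := by
      refine DirectSum.linearMap_ext _ fun n => ?_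
      ext y : 1
      simp only [LinearMap.comp_apply, hi]
      exact (hs n y).2
    exact LinearMap.congr_fun this x
  · intro x
    induction x using homogeneous_induction A.internal with
    | hom n x hx =>
      rw [hp (n + 1) ⟨A.d x, A.d_mem n x hx⟩, LinearMap.comp_apply, hq0 _ _ ⟨x, rfl⟩, map_zero]
    | add x y hx hy => simp only [map_add, hx, hy, add_zero]
  · intro x
    have : p ∘ₗ i = LinearMap.id := by
      refine DirectSum.linearMap_ext _ fun n => ?_
      ext y : 1
      simp only [LinearMap.comp_apply, hi, LinearMap.id_apply]
      rw [hp n ⟨s n y, (hs n y).1⟩, LinearMap.comp_apply, hqs n _ y rfl]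
    exact LinearMap.congr_fun this x
  · intro x hx
    rw [← sub_eq_zero]
    -- `T` has degree `0`, so it vanishes on a cycle as soon as it vanishes on its homogeneous
    -- components, which are cycles too.
    let T : V →ₗ[k] V := A.d ∘ₗ h ∘ₗ (LinearMap.id - i ∘ₗ p) - (LinearMap.id - i ∘ₗ p)
    have hT : ∀ n, ∀ x ∈ A.gr n, T x ∈ A.gr (n + 0) := by
      intro n x hx
      have hm : x - i (p x) ∈ A.gr n := sub_mem hx (i_mem n _ (p_mem n x hx))
      rw [add_zero]
      refine sub_mem ?_ hm
      have := A.d_mem _ _ (h_mem n _ hm)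
      rwa [sub_add_cancel] at this
    change T x = 0
    refine eq_zero_of_proj A.internal fun n => ?_
    have e := map_proj A.internal A.internal 0 T hT n x
    rw [add_zero] at e
    rw [← e]
    refine sub_eq_zero.2 (d_h n (proj A.internal n x) (proj_mem _ _ _) ?_)
    rw [map_proj A.internal A.internal 1 A.d A.d_mem, hx, map_zero]

end Retracts

/-! ### Differences of sums over splittings -/

section Splittings

variable {α β : Type*} {M : Type*} [AddCommGroup M]

theorem sum₂_sub (w : List α) (F G : List α → List α → M) :
    sum₂ w F - sum₂ w G = sum₂ w fun a b => F a b - G a b :=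
  (Finset.sum_sub_distrib ..).symm

theorem sum₂_sub_eq_left {w : List α} {F G : List α → List α → M}
    (h : ∀ a b, a ++ b = w → a ≠ [] → F a b = G a b) :
    sum₂ w F - sum₂ w G = F [] w - G [] w := by
  rw [sum₂_sub]
  exact sum₂_eq_left fun a b hab ha => sub_eq_zero.2 (h a b hab ha)

theorem sum₂_sub_eq_right {w : List α} {F G : List α → List α → M}
    (h : ∀ a b, a ++ b = w → b ≠ [] → F a b = G a b) :
    sum₂ w F - sum₂ w G = F w [] - G w [] := by
  rw [sum₂_sub]
  exact sum₂_eq_right fun a b hab ha => sub_eq_zero.2 (h a b hab ha)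

/-- The component of top length enters only through the decomposition into a single block. -/
theorem hat_sub_of_agree {op op' : List α → β} {G : List β → M} {w : List α} (hw : w ≠ [])
    (h : ∀ u, u.length < w.length → op' u = op u) :
    hat op' G w - hat op G w = G [op' w] - G [op w] := by
  cases w with
  | nil => exact absurd rfl hw
  | cons x w =>
    rw [hat_cons, hat_cons, sum₂_sub_eq_right]
    · simp
    · intro a b hab hb
      subst hab
      have : 0 < b.length := List.length_pos_iff.2 hb
      rw [h (x :: a) (by simp; omega)]
      exact hat_congr_op _ _ fun u hu => h u (by simp; omega)

end Splittings

/-! ### Effect of changing operations in one length -/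

section Updates

variable {k : Type u} [Field k]
variable {V : Type v} [AddCommGroup V] [Module k V]
variable {U : Type v} [AddCommGroup U] [Module k U] {gr : ℤ → Submodule k U}
variable {W : Type v} [AddCommGroup W] [Module k W] {gr' : ℤ → Submodule k W}
variable {M : Type*} [AddCommGroup M] [Module k M]

theorem der_congr_op {m m' : Word gr → Homog gr} (hm : IsOp 1 m) (hm' : IsOp 1 m')
    {G G' : Word gr → M} (hG : ML G) (hG' : ML G') {w : Word gr}
    (h : ∀ u : Word gr, u.length ≤ w.length → m' u = m u)
    (h' : ∀ u : Word gr, u.length ≤ w.length → G' u = G u) : der m' G' w = der m G w := by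
  refine sum₃_congr fun a b c habc => ?_
  congr 1
  by_cases hb : b = []
  · subst hb
    rw [hG.apply_zero _ _ hm.nil, hG'.apply_zero _ _ hm'.nil]
  · have : 0 < b.length := List.length_pos_iff.2 hb
    subst habc
    rw [h b (by simp; omega), h' _ (by simp; omega)]

/-- If `m` has no component of length one, then a change of the operations in the top length
contributes a single term to `der`. -/
theorem der_sub_of_agree {m m' : Word gr → Homog gr}
    (hs : ∀ u, u.length ≤ 1 → (m u).val = 0) (hs' : ∀ u, u.length ≤ 1 → (m' u).val = 0)
    {G G' : Word gr → M} (hG : ML G) (hG' : ML G') {w : Word gr}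
    (h : ∀ u : Word gr, u.length < w.length → m' u = m u)
    (h' : ∀ u : Word gr, u.length < w.length → G' u = G u) :
    der m' G' w - der m G w = G' [m' w] - G [m w] := by
  have e : der m' G' w - der m G w = sum₃ w fun a b c =>
      (Word.deg a).negOnePow • G' (a ++ m' b :: c) - (Word.deg a).negOnePow • G (a ++ m b :: c) := by
    simp only [der, sum₃, sum₂_sub]
  rw [e, sum₃_eq_mid]
  · simp
  · intro a b c habc hb
    refine sub_eq_zero.2 (congrArg _ ?_)
    by_cases hb1 : b.length ≤ 1
    · rw [hG.apply_zero _ _ (hs b hb1), hG'.apply_zero _ _ (hs' b hb1)]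
    · have hac : 0 < a.length + c.length := by
        by_contra h0
        have ha : a = [] := List.length_eq_zero_iff.1 (by omega)
        have hc : c = [] := List.length_eq_zero_iff.1 (by omega)
        exact hb (by simpa [ha, hc] using habc)
      subst habc
      rw [h b (by simp; omega), h' _ (by simp; omega)]

/-- Without unary component, every non-zero insertion of `m` shortens the word. -/
theorem der_eq_zero_of_agree {m : Word gr → Homog gr}
    (hs : ∀ u, u.length ≤ 1 → (m u).val = 0)
    {G : Word gr → M} (hG : ML G) {w : Word gr}
    (h : ∀ u : Word gr, u.length < w.length → G u = 0) : der m G w = 0 := by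
  rw [der, ← sum₃_zero w]
  refine sum₃_congr fun a b c habc => ?_
  by_cases hb : b.length ≤ 1
  · rw [hG.apply_zero _ _ (hs b hb), smul_zero]
  · subst habc
    rw [h _ (by simp; omega), smul_zero]

/-- Operations may be modified in one length. -/
theorem IsOp.exists_add {r : ℤ} {op : Word gr → Homog gr'} (h : IsOp r op) {δ : Word gr → W}
    (hδ : ML δ) (hm : ∀ w, δ w ∈ gr' (w.deg + r)) {n : ℕ} (hn : n ≠ 0) :
    ∃ op' : Word gr → Homog gr', IsOp r op' ∧ (∀ w, w.length ≠ n → op' w = op w) ∧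
      ∀ w, w.length = n → (op' w).val = (op w).val + δ w := by
  have hmem : ∀ w, (op w).val + δ w ∈ gr' (w.deg + r) := fun w =>
    add_mem (h.deg w ▸ (op w).val_mem) (hm w)
  let op' : Word gr → Homog gr' := fun w => if w.length = n then ⟨w.deg + r, ⟨_, hmem w⟩⟩ else op w
  have h1 : ∀ w, w.length ≠ n → op' w = op w := fun w hw => if_neg hw
  have h2 : ∀ w : Word gr, w.length = n → op' w = ⟨w.deg + r, ⟨_, hmem w⟩⟩ := fun w hw => if_pos hw
  have h3 : ∀ w, w.length = n → (op' w).val = (op w).val + δ w := fun w hw => by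
    rw [h2 w hw]
    rfl
  refine ⟨op', ⟨fun w => ?_, fun p q j => ?_, ?_⟩, h1, h3⟩
  · by_cases hw : w.length = n
    · rw [h2 w hw]
    · rw [h1 w hw, h.deg]
  · by_cases hpq : p.length + (q.length + 1) = n
    · exact ((h.ml p q j).add (hδ p q j)).congr fun x _ => h3 _ (by simpa using hpq)
    · exact (h.ml p q j).congr fun x _ => congrArg Homog.val (h1 _ (by simpa using hpq))
  · rw [h1 [] (by simpa using hn.symm), h.nil]

/-- The blocks of `v` and `w` are disjoint, so no block has more than `|a| + |b| + 1` letters. -/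
theorem pull₂_congr_op {f f' : Word gr → Homog gr'} (φ : PreMap gr' gr' gr') {a b : Word gr}
    {v w : Homog gr} (h : ∀ u : Word gr, u.length ≤ a.length + b.length + 1 → f' u = f u) :
    pull₂ f' φ a v b w = pull₂ f φ a v b w := by
  rw [pull₂, pull₂]
  refine sum₂_congr fun a₁ a' ha => ?_
  refine sum₂_congr fun b' b₃ hb => ?_
  refine congrArg _ ?_
  refine sum₂_congr fun a₂ a₃ ha' => ?_
  refine sum₂_congr fun b₁ b₂ hb' => ?_
  subst ha hb ha' hb'
  simp only [List.length_append] at h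
  rw [h (a₃ ++ v :: b₁) (by simp; omega), h (b₃ ++ w :: a₁) (by simp; omega)]
  rw [hat_congr_op _ a₂ fun u hu => h u (by omega)]
  exact hat_congr_fun _ _ fun L => hat_congr_op _ b₂ fun u hu => h u (by omega)

/-- A change of `f` in the top length contributes two terms to the pullback. -/
theorem pull₂_sub_of_agree {f f' : Word gr → Homog gr'} (φ : PreMap gr' gr' gr') {a b : Word gr}
    {v w : Homog gr} (h0 : 0 < a.length + b.length)
    (h : ∀ u : Word gr, u.length ≤ a.length + b.length → f' u = f u) :
    pull₂ f' φ a v b w - pull₂ f φ a v b w =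
      (φ [] (f' (a ++ v :: b)) [] (f [w]) - φ [] (f (a ++ v :: b)) [] (f [w])) +
      (Word.deg a * (v.1 + Word.deg b + w.1)).negOnePow •
        (φ [] (f [v]) [] (f' (b ++ w :: a)) - φ [] (f [v]) [] (f (b ++ w :: a))) := by
  -- `F` acts on the block of `v` and `H` on that of `w`; the unmarked blocks are too short to see
  -- the change. Replacing `H` and then `F` gives one term each, where the block is everything but
  -- the other marked letter.
  let P : (Word gr → Homog gr') → (Word gr → Homog gr') → k := fun F H =>
    sum₂ a fun a₁ a' => sum₂ b fun b' b₃ =>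
      (Word.deg a₁ * (Word.deg a' + v.1 + Word.deg b' + Word.deg b₃ + w.1)).negOnePow •
        sum₂ a' fun a₂ a₃ => sum₂ b' fun b₁ b₂ =>
          hat f (fun L₁ => hat f (fun L₂ =>
            φ L₁ (F (a₃ ++ v :: b₁)) L₂ (H (b₃ ++ w :: a₁))) b₂) a₂
  have e : pull₂ f' φ a v b w = P f' f' := by
    rw [pull₂]
    refine sum₂_congr fun a₁ a' ha => ?_
    refine sum₂_congr fun b' b₃ hb => ?_
    refine congrArg _ ?_
    refine sum₂_congr fun a₂ a₃ ha' => ?_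
    refine sum₂_congr fun b₁ b₂ hb' => ?_
    subst ha hb ha' hb'
    simp only [List.length_append] at h
    rw [hat_congr_op _ a₂ fun u hu => h u (by omega)]
    exact hat_congr_fun _ _ fun L => hat_congr_op _ b₂ fun u hu => h u (by omega)
  have e1 : P f' f' - P f' f = (Word.deg a * (v.1 + Word.deg b + w.1)).negOnePow •
        (φ [] (f [v]) [] (f' (b ++ w :: a)) - φ [] (f [v]) [] (f (b ++ w :: a))) := by
    simp only [P]
    rw [sum₂_sub_eq_right, sum₂_sub_eq_left]
    · have hv : f' [v] = f [v] := h _ (by simp; omega)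
      simp [← smul_sub, hv]
    · intro b' b₃ hb hne
      have : 0 < b'.length := List.length_pos_iff.2 hne
      subst hb
      simp only [List.length_append] at h
      rw [h (b₃ ++ w :: a) (by simp; omega)]
    · intro a₁ a' ha hne
      have : 0 < a'.length := List.length_pos_iff.2 hne
      refine sum₂_congr fun b' b₃ hb => ?_
      subst ha hb
      simp only [List.length_append] at h
      rw [h (b₃ ++ w :: a₁) (by simp; omega)]
  have e2 : P f' f - P f f =
      φ [] (f' (a ++ v :: b)) [] (f [w]) - φ [] (f (a ++ v :: b)) [] (f [w]) := by
    simp only [P]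
    rw [sum₂_sub_eq_left, sum₂_sub_eq_right, ← smul_sub, sum₂_sub_eq_left, sum₂_sub_eq_right]
    · simp
    · intro b₁ b₂ hb hne
      have : 0 < b₂.length := List.length_pos_iff.2 hne
      subst hb
      simp only [List.length_append] at h
      rw [h (a ++ v :: b₁) (by simp; omega)]
    · intro a₂ a₃ ha hne
      have : 0 < a₂.length := List.length_pos_iff.2 hne
      refine sum₂_congr fun b₁ b₂ hb => ?_
      subst ha hb
      simp only [List.length_append] at h
      rw [h (a₃ ++ v :: b₁) (by simp; omega)]
    · intro b' b₃ hb hne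
      have : 0 < b₃.length := List.length_pos_iff.2 hne
      refine congrArg _ ?_
      refine sum₂_congr fun a₂ a₃ ha => ?_
      refine sum₂_congr fun b₁ b₂ hb' => ?_
      subst ha hb hb'
      simp only [List.length_append] at h
      rw [h (a₃ ++ v :: b₁) (by simp; omega)]
    · intro a₁ a' ha hne
      have : 0 < a₁.length := List.length_pos_iff.2 hne
      refine sum₂_congr fun b' b₃ hb => ?_
      refine congrArg _ ?_
      refine sum₂_congr fun a₂ a₃ ha' => ?_
      refine sum₂_congr fun b₁ b₂ hb' => ?_
      subst ha ha' hb hb'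
      simp only [List.length_append] at h
      rw [h (a₃ ++ v :: b₁) (by simp; omega)]
  rw [e, ← e1, ← e2]
  change P f' f' - P f f = _
  abel

end Updates

/-! ### Linear maps determined on homogeneous vectors -/

section LinearExtension

variable {k : Type u} [Field k]
variable {V : Type v} [AddCommGroup V] [Module k V] {gr : ℤ → Submodule k V}
variable {W : Type*} [AddCommGroup W] [Module k W]
variable {N : Type*} [AddCommGroup N] [Module k N]

theorem exists_linear_of_linearOn (hI : DirectSum.IsInternal gr) {f : Homog gr → N}
    (hf : ∀ n, LinearOn n f) : ∃ L : V →ₗ[k] N, ∀ x : Homog gr, L x.val = f x := by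
  choose ℓ hℓ using hf
  obtain ⟨L, hL⟩ := exists_linear_of_homogeneous hI fun n => ℓ n ∘ₗ (gr n).subtype
  exact ⟨L, fun x => (hL x.1 x.2).trans (hℓ x.1 x rfl).symm⟩

theorem linearMap_ext_homog (hI : DirectSum.IsInternal gr) {L L' : V →ₗ[k] N}
    (h : ∀ x : Homog gr, L x.val = L' x.val) : L = L' := by
  ext x
  induction x using homogeneous_induction hI with
  | hom n x hx => exact h ⟨n, ⟨x, hx⟩⟩
  | add x y hx hy => rw [map_add, map_add, hx, hy]

variable {gr' : ℤ → Submodule k W}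

/-- A family of linear maps is linear in a parameter, if its values on homogeneous vectors are. -/
theorem LinearOn.of_apply (hI : DirectSum.IsInternal gr) {n : ℤ} {f : Homog gr' → V →ₗ[k] N}
    (h : ∀ y : Homog gr, LinearOn n fun x => f x y.val) : LinearOn n f := by
  refine .of_forall fun c x y => linearMap_ext_homog hI fun z => ?_
  obtain ⟨ℓ, hℓ⟩ := h z
  rw [LinearMap.add_apply, LinearMap.smul_apply]
  have h1 := hℓ ⟨n, c • x + y⟩ rfl
  have h2 := hℓ ⟨n, x⟩ rfl
  have h3 := hℓ ⟨n, y⟩ rfl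
  simp only at h1 h2 h3
  rw [h1, h2, h3, ← map_smul, ← map_add]
  rfl

theorem ML.of_apply (hI : DirectSum.IsInternal gr) {f : Word gr' → V →ₗ[k] N}
    (h : ∀ y : Homog gr, ML fun w => f w y.val) : ML f := fun p q n =>
  .of_apply hI fun y => h y p q n

end LinearExtension

/-! ### The inner product on cohomology -/

section InnerProducts

variable {k : Type u} [Field k]
variable {V : Type v} [AddCommGroup V] [Module k V] {A : Algebra k V}
variable {U : Type v} [AddCommGroup U] [Module k U] {gr : ℤ → Submodule k U}

/-- The inclusion of a retract on homogeneous elements. -/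
def Retract.incl (R : Retract A gr) (x : Homog gr) : Homog A.gr :=
  ⟨x.1, ⟨R.i x.val, R.i_mem _ _ x.val_mem⟩⟩

theorem Retract.val_incl (R : Retract A gr) (x : Homog gr) : (R.incl x).val = R.i x.val := rfl

theorem Retract.d_incl (R : Retract A gr) (x : Homog gr) : A.d (R.incl x).val = 0 := R.d_i _

theorem Retract.eq_zero_of_mem_range (R : Retract A gr) {x : U}
    (h : R.i x ∈ LinearMap.range A.d) : x = 0 := by
  obtain ⟨y, hy⟩ := h
  rw [← R.p_i x, ← hy, R.p_d]

theorem Retract.finiteDimensional (R : Retract A gr) [FiniteDimensional k A.Cohomology] :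
    FiniteDimensional k U := by
  let j : U →ₗ[k] A.Cohomology :=
    Submodule.mkQ _ ∘ₗ R.i.codRestrict (LinearMap.ker A.d) fun x => R.d_i x
  refine FiniteDimensional.of_injective j ?_
  rw [← LinearMap.ker_eq_bot, LinearMap.ker_eq_bot']
  intro x hx
  have h : (Submodule.Quotient.mk ⟨R.i x, R.d_i x⟩ : A.Cohomology) = 0 := hx
  rw [Submodule.Quotient.mk_eq_zero] at h
  exact R.eq_zero_of_mem_range h

theorem Retract.exists_form (R : Retract A gr) {φ : DualMap A} (hφ : IsMultilinear φ) :
    ∃ ω : U →ₗ[k] U →ₗ[k] k, ∀ x y : Homog gr,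
      ω x.val y.val = φ [] (R.incl x) [] (R.incl y) := by
  have h1 : ∀ x : Homog gr, ∃ L : U →ₗ[k] k, ∀ y : Homog gr,
      L y.val = φ [] (R.incl x) [] (R.incl y) := fun x =>
    exists_linear_of_linearOn R.internal fun n => by
      obtain ⟨ℓ, hℓ⟩ := hφ.linearOn_last [] (R.incl x) [] n
      exact ⟨ℓ ∘ₗ R.i, fun y hy => hℓ (R.incl y) hy⟩
  choose L hL using h1
  obtain ⟨ω, hω⟩ := exists_linear_of_linearOn R.internal (f := L) fun n =>
    .of_apply R.internal fun y => by
      obtain ⟨ℓ, hℓ⟩ := hφ.linearOn_mid [] [] (R.incl y) n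
      exact ⟨ℓ ∘ₗ R.i, fun x hx => (hL x y).trans (hℓ (R.incl x) hx)⟩
  exact ⟨ω, fun x y => by rw [hω, hL]⟩

variable {R : Retract A gr} {d : ℤ} {φ : DualMap A} {ω : U →ₗ[k] U →ₗ[k] k}

theorem Retract.form_degree (hφ : IsStrongHomotopyInnerProduct d φ)
    (hω : ∀ x y : Homog gr, ω x.val y.val = φ [] (R.incl x) [] (R.incl y)) (x y : Homog gr)
    (h : x.1 + y.1 ≠ d) : ω x.val y.val = 0 := by
  rw [hω]
  exact hφ.bimoduleMap.degree _ _ _ _ (by simpa [Retract.incl] using h)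

theorem Retract.form_skew (hφ : IsStrongHomotopyInnerProduct d φ)
    (hω : ∀ x y : Homog gr, ω x.val y.val = φ [] (R.incl x) [] (R.incl y)) (x y : Homog gr) :
    ω x.val y.val = -((x.1 * y.1).negOnePow • ω y.val x.val) := by
  rw [hω, hω, hφ.skew]
  simp [Retract.incl]

theorem Retract.form_proj (hφ : IsStrongHomotopyInnerProduct d φ)
    (hω : ∀ x y : Homog gr, ω x.val y.val = φ [] (R.incl x) [] (R.incl y)) (n : ℤ) (x : U)
    (y : Homog gr) : ω (proj R.internal n x) y.val = if n + y.1 = d then ω x y.val else 0 := by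
  have hdeg := Retract.form_degree hφ hω
  induction x using homogeneous_induction R.internal with
  | hom m x hx =>
    rw [proj_of_mem _ hx]
    have h := hdeg ⟨m, ⟨x, hx⟩⟩ y
    change _ → ω x y.val = 0 at h
    simp only at h
    split_ifs with h1 h2 h2
    · rfl
    · exact h (by rwa [h1])
    · rw [h (by omega), map_zero, LinearMap.zero_apply]
    · rw [map_zero, LinearMap.zero_apply]
  | add x y hx hy =>
    simp only [map_add, LinearMap.add_apply, hx, hy]
    split_ifs <;> simp

/-- Homological non-degeneracy supplies a cycle `b`; it differs from `i (p b)` by a boundary, to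
which `φ_{0,0}` is blind, so `p b` detects the class within the retract. -/
theorem Retract.form_nondegenerate (hφ : IsStrongHomotopyInnerProduct d φ)
    (hω : ∀ x y : Homog gr, ω x.val y.val = φ [] (R.incl x) [] (R.incl y)) (x : U)
    (h : ∀ y, ω x y = 0) : x = 0 := by
  refine eq_zero_of_proj R.internal fun n => ?_
  by_contra hx
  let x' : Homog gr := ⟨n, ⟨proj R.internal n x, proj_mem _ _ _⟩⟩
  obtain ⟨b, hb, hab⟩ := hφ.nondegenerate (R.incl x') (R.d_incl x') fun h' =>
    hx (R.eq_zero_of_mem_range h')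
  let y : Homog gr := ⟨b.1, ⟨R.p b.val, R.p_mem _ _ b.val_mem⟩⟩
  obtain ⟨ℓ, hℓ⟩ := hφ.bimoduleMap.multilinear.linearOn_last [] (R.incl x') [] b.1
  have hmem : b.val - R.i y.val ∈ A.gr b.1 := sub_mem b.val_mem (R.i_mem _ _ y.val_mem)
  have h1 := hφ.bimoduleMap.exact (v := R.incl x') (w := ⟨b.1, ⟨_, hmem⟩⟩) (R.d_incl x')
    ⟨_, R.d_h b.val hb⟩
  replace h1 : ℓ (b.val - R.i y.val) = 0 := (hℓ ⟨b.1, ⟨_, hmem⟩⟩ rfl).symm.trans h1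
  have h2 := hℓ (R.incl y) rfl
  rw [← hω, R.val_incl] at h2
  change ω (proj R.internal n x) y.val = _ at h2
  rw [Retract.form_proj hφ hω, h, ite_self] at h2
  rw [map_sub, ← h2, sub_zero] at h1
  exact hab ((hℓ b rfl).trans h1)

theorem Retract.exists_dual [FiniteDimensional k U] (hφ : IsStrongHomotopyInnerProduct d φ)
    (hω : ∀ x y : Homog gr, ω x.val y.val = φ [] (R.incl x) [] (R.incl y)) :
    ∃ σ : (U →ₗ[k] k) →ₗ[k] U, ∀ ℓ, ω (σ ℓ) = ℓ := by
  have hinj : Function.Injective ω := by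
    rw [← LinearMap.ker_eq_bot, LinearMap.ker_eq_bot']
    exact fun x hx => Retract.form_nondegenerate hφ hω x fun y => by rw [hx]; rfl
  -- Here finite dimension enters: an injective map to the dual is onto.
  have hsurj : Function.Surjective ω :=
    (LinearMap.injective_iff_surjective_of_finrank_eq_finrank
      (Subspace.dual_finrank_eq (K := k) (V := U)).symm).1 hinj
  obtain ⟨σ, hσ⟩ := LinearMap.exists_rightInverse_of_surjective ω (LinearMap.range_eq_top.2 hsurj)
  exact ⟨σ, LinearMap.congr_fun hσ⟩

/-- A word `u` and a one-form `β` determine a vector of degree `|u|'` that represents `-β(u, ·)`. -/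
theorem Retract.exists_hamiltonian [FiniteDimensional k U] (hφ : IsStrongHomotopyInnerProduct d φ)
    (hω : ∀ x y : Homog gr, ω x.val y.val = φ [] (R.incl x) [] (R.incl y))
    {β : Word gr → Homog gr → k} (hβ : IsOneForm β) :
    ∃ ξ : Word gr → U, ML ξ ∧ (∀ u, ξ u ∈ gr u.deg) ∧
      ∀ (u : Word gr) (y : Homog gr), u.deg + y.1 = d → ω (ξ u) y.val = -β u y := by
  obtain ⟨σ, hσ⟩ := Retract.exists_dual hφ hω
  choose B hB using fun u => exists_linear_of_linearOn R.internal (hβ.last u)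
  have hBml : ML B := .of_apply R.internal fun y => by
    simp only [hB]
    exact hβ.ml y
  -- The dual vector of `-β(u, ·)` may be inhomogeneous. Its component of degree `|u|'` pairs
  -- correctly with all `y` of complementary degree.
  refine ⟨fun u => proj R.internal u.deg (σ (-B u)),
    .of_deg (F := fun e u => proj R.internal e (σ (-B u))) fun e =>
      (hBml.neg.map σ).map (proj R.internal e),
    fun u => proj_mem _ _ _, fun u y h => ?_⟩
  rw [Retract.form_proj hφ hω, if_pos h, hσ, LinearMap.neg_apply, hB]

end InnerProducts

/-! ### Homotopy transfer with a Darboux correction -/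

section Transfer

variable {k : Type u} [Field k]
variable {V : Type v} [AddCommGroup V] [Module k V] {A : Algebra k V}
variable {U : Type v} [AddCommGroup U] [Module k U] {gr : ℤ → Submodule k U}

/-- The failure of `g` to be an `A_∞`-homomorphism from `m` to `A`. -/
def defect (A : Algebra k V) (m : Word gr → Homog gr) (g : Word gr → Homog A.gr) (w : Word gr) :
    V :=
  der m (fun l => (g l).val) w - hat g (fun L => (A.op L).val) w

theorem defect_mem {m : Word gr → Homog gr} {g : Word gr → Homog A.gr} (hm : IsOp 1 m)
    (hg : IsOp 0 g) (w : Word gr) : defect A m g w ∈ A.gr (w.deg + 1) := by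
  refine sub_mem (der_mem hm _ w fun l hl => ?_) (hat_mem hg _ w fun L hL => ?_)
  · rw [← hl, ← add_zero l.deg, ← hg.deg]
    exact (g l).val_mem
  · rw [← hL, ← A.isOp.deg]
    exact (A.op L).val_mem

theorem ML.defect {m : Word gr → Homog gr} {g : Word gr → Homog A.gr} (hm : IsOp 1 m)
    (hg : IsOp 0 g) : ML (defect A m g) := by
  have h := (hg.ml.der hm).add (A.isOp.ml.hat hg).neg
  simp only [← sub_eq_add_neg] at h
  exact h

/-- `m` and `g` are operations on a retract, without linear term and with linear term the inclusion
respectively, such that `g` is an `A_∞`-homomorphism on words shorter than `n`, and the components of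
the pullback of `φ` with at least three and at most `l` arguments vanish. -/
structure IsTransfer (R : Retract A gr) (φ : DualMap A) (n l : ℕ) (m : Word gr → Homog gr)
    (g : Word gr → Homog A.gr) : Prop where
  m_op : IsOp 1 m
  g_op : IsOp 0 g
  m_small : ∀ w : Word gr, w.length ≤ 1 → (m w).val = 0
  g_one : ∀ x, g [x] = R.incl x
  rel : ∀ w : Word gr, w.length < n → defect A m g w = 0
  form : ∀ (a : Word gr) (v : Homog gr) (b : Word gr) (w : Homog gr),
    0 < a.length + b.length → a.length + b.length + 2 ≤ l → pull₂ g φ a v b w = 0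

variable {R : Retract A gr} {φ : DualMap A}

/-- Start with `m = 0` and `g = i` in length one: the equation in length one is `d ∘ i = 0`, and the
condition on the form is vacuous. -/
theorem IsTransfer.exists_base (R : Retract A gr) (φ : DualMap A) :
    ∃ m g, IsTransfer R φ 2 2 m g := by
  let m : Word gr → Homog gr := fun w => ⟨w.deg + 1, 0⟩
  have hm : IsOp 1 m := ⟨fun _ => rfl, .zero, rfl⟩
  let g₀ : Word gr → Homog A.gr := fun w => ⟨w.deg, 0⟩
  have hg₀ : IsOp 0 g₀ := ⟨fun w => (add_zero _).symm, .zero, rfl⟩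
  let δ : Word gr → V := fun w => match w with
    | [x] => R.i x.val
    | _ => 0
  have hδ : ML δ := by
    rintro (_ | ⟨x, p⟩) (_ | ⟨y, q⟩) n
    · exact ⟨R.i, fun _ _ => rfl⟩
    · exact .zero
    · refine LinearOn.zero.congr fun z _ => ?_
      cases p <;> rfl
    · refine LinearOn.zero.congr fun z _ => ?_
      cases p <;> rfl
  have hδm : ∀ w, δ w ∈ A.gr (w.deg + 0) := by
    rintro (_ | ⟨x, _ | ⟨y, w⟩⟩)
    · exact zero_mem _
    · simpa using R.i_mem _ _ x.val_mem
    · exact zero_mem _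
  obtain ⟨g, hg, -, hg1⟩ := hg₀.exists_add hδ hδm one_ne_zero
  have g1 : ∀ x, g [x] = R.incl x := fun x =>
    Homog.ext (by simp [hg.deg, Retract.incl]) ((hg1 [x] rfl).trans (zero_add _))
  refine ⟨m, g, hm, hg, fun _ _ => rfl, g1, fun w hw => ?_, fun a v b w _ _ => by omega⟩
  match w, hw with
  | [], _ => rw [defect, der_nil hm hg.ml, hat_nil, A.isOp.nil, sub_zero]
  | [x], _ =>
    rw [defect, der_eq_zero_of_agree (fun _ _ => rfl) hg.ml, hat_cons, sum₂_nil, hat_nil, g1,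
      A.op_singleton, R.d_incl, sub_zero]
    intro u hu
    rw [List.length_eq_zero_iff.1 (Nat.lt_one_iff.1 hu), hg.nil]

theorem defect_congr_op {m m' : Word gr → Homog gr} {g g' : Word gr → Homog A.gr}
    (hm : IsOp 1 m) (hm' : IsOp 1 m') (hg : IsOp 0 g) (hg' : IsOp 0 g') {w : Word gr}
    (h : ∀ u : Word gr, u.length ≤ w.length → m' u = m u)
    (h' : ∀ u : Word gr, u.length ≤ w.length → g' u = g u) :
    defect A m' g' w = defect A m g w := by
  rw [defect, der_congr_op hm hm' hg.ml hg'.ml h fun u hu => congrArg _ (h' u hu),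
    hat_congr_op _ w h']
  rfl

/-- In top length, `m` enters only through `g₁ ∘ m_n` and `g` only through `m₁ ∘ g_n`, because the
retract carries zero differential. -/
theorem defect_sub_of_agree {m m' : Word gr → Homog gr} {g g' : Word gr → Homog A.gr}
    (hs : ∀ u, u.length ≤ 1 → (m u).val = 0) (hs' : ∀ u, u.length ≤ 1 → (m' u).val = 0)
    (hg : IsOp 0 g) (hg' : IsOp 0 g') (g1 : ∀ x, g [x] = R.incl x)
    (g1' : ∀ x, g' [x] = R.incl x) {w : Word gr} (hw : w ≠ [])
    (h : ∀ u : Word gr, u.length < w.length → m' u = m u)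
    (h' : ∀ u : Word gr, u.length < w.length → g' u = g u) :
    defect A m' g' w = defect A m g w + R.i ((m' w).val - (m w).val) -
      A.d ((g' w).val - (g w).val) := by
  have e1 := der_sub_of_agree hs hs' hg.ml hg'.ml h fun u hu => congrArg Homog.val (h' u hu)
  have e2 := hat_sub_of_agree (G := fun L => (A.op L).val) hw h'
  simp only [A.op_singleton, g1, g1', R.val_incl] at e1 e2
  rw [map_sub, map_sub, ← e1, ← e2, defect, defect]
  abel

/-- Apply `m̂` to `g ∘ m̂ = m^A ∘ ĝ + defect`. On the left the shorter relations for `m` leave `i (m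
∘ m̂)`; on the right those for `A` leave `d (defect)`, and the defect of shorter words is zero. As
`p ∘ i = 1` and `p ∘ d = 0`, both sides vanish: the obstruction is closed, and the relations for `m`
hold as well. -/
theorem IsTransfer.d_defect {n l : ℕ} {m : Word gr → Homog gr} {g : Word gr → Homog A.gr}
    (h : IsTransfer R φ n l m g) (w : Word gr) (hw : w.length ≤ n) :
    A.d (defect A m g w) = 0 ∧ der m (fun u => (m u).val) w = 0 := by
  induction hN : w.length using Nat.strong_induction_on generalizing w with
  | _ N ih =>
    subst hN
    have hD : ∀ u : Word gr, u.length < w.length → der m (fun u => (m u).val) u = 0 :=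
      fun u hu => (ih u.length hu u (by omega) rfl).2
    have e1 := der_hat h.m_op A.isOp h.g_op A.isOp.ml w
      (fun u hu => sub_eq_zero.1 (h.rel u (by omega)))
      ⟨w.deg + 1, ⟨defect A m g w, defect_mem h.m_op h.g_op w⟩⟩ rfl
      (add_sub_cancel _ _).symm
    rw [hat_congr_fun _ _ A.der_op, hat_zero, zero_add, A.op_singleton] at e1
    have hDm : der m (fun u => (m u).val) w ∈ gr (w.deg + 2) := der_mem h.m_op _ w fun u hu => by
      rw [show w.deg + 2 = u.deg + 1 by omega, ← h.m_op.deg]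
      exact (m u).val_mem
    have e2 := der_der h.m_op h.g_op.ml w hD ⟨_, ⟨_, hDm⟩⟩ rfl rfl
    rw [h.g_one, R.val_incl] at e2
    have e3 : der m (defect A m g) w = 0 := der_eq_zero_of_agree h.m_small
      (.defect h.m_op h.g_op) fun u hu => h.rel u (by omega)
    have e4 := der_add m (fun u => hat g (fun L => (A.op L).val) u) (defect A m g) w
    have e5 : ∀ u, hat g (fun L => (A.op L).val) u + defect A m g u =
        der m (fun l => (g l).val) u := fun u => add_sub_cancel _ _
    simp only [e5] at e4
    have e6 : R.i (der m (fun u => (m u).val) w) = A.d (defect A m g w) := by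
      refine e2.symm.trans (e4.trans ?_)
      rw [e3, add_zero]
      exact e1
    have e7 : der m (fun u => (m u).val) w = 0 := by
      rw [← R.p_i (der m (fun u => (m u).val) w), e6, R.p_d]
    exact ⟨by rw [← e6, e7, map_zero], e7⟩

/-- Extension of the homotopy transfer by one step. -/
theorem IsTransfer.exists_rel_succ {n l : ℕ} {m : Word gr → Homog gr} {g : Word gr → Homog A.gr}
    (h : IsTransfer R φ n l m g) (hn : 2 ≤ n) (hl : l ≤ n) :
    ∃ m' g', IsTransfer R φ (n + 1) l m' g' ∧
      ∀ w : Word gr, w.length < n → m' w = m w ∧ g' w = g w := by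
  have hE := ML.defect h.m_op h.g_op
  have hEm := defect_mem h.m_op h.g_op
  -- The defect `E` is a cycle. Its cohomology class `p E` is absorbed by `m_n`, and the exact
  -- remainder `E - i (p E)` by `g_n` through the homotopy.
  obtain ⟨m', hm', hm1, hm2⟩ := h.m_op.exists_add (hE.map R.p).neg
    (fun w => neg_mem (R.p_mem _ _ (hEm w))) (n := n) (by omega)
  obtain ⟨g', hg', hg1, hg2⟩ := h.g_op.exists_add
    (hE.map (R.h ∘ₗ (LinearMap.id - R.i ∘ₗ R.p)))
    (fun w => by
      have := R.h_mem _ _ (sub_mem (hEm w) (R.i_mem _ _ (R.p_mem _ _ (hEm w))))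
      rwa [add_sub_cancel_right, ← add_zero w.deg] at this) (n := n) (by omega)
  have hs : ∀ w : Word gr, w.length ≤ 1 → (m' w).val = 0 := fun w hw => by
    rw [hm1 w (by omega), h.m_small w hw]
  have g1 : ∀ x, g' [x] = R.incl x := fun x => by
    rw [hg1 [x] (by simp; omega), h.g_one]
  refine ⟨m', g', ⟨hm', hg', hs, g1, fun w hw => ?_, fun a v b w hab hab' => ?_⟩,
    fun w hw => ⟨hm1 w (by omega), hg1 w (by omega)⟩⟩
  · by_cases hwn : w.length < n
    · rw [defect_congr_op h.m_op hm' h.g_op hg' (fun u hu => hm1 u (by omega))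
        fun u hu => hg1 u (by omega), h.rel w hwn]
    · have hwn' : w.length = n := by omega
      rw [defect_sub_of_agree h.m_small hs h.g_op hg' h.g_one g1
        (by rintro rfl; simp at hwn'; omega) (fun u hu => hm1 u (by omega))
        fun u hu => hg1 u (by omega), hm2 w hwn', hg2 w hwn', add_sub_cancel_left,
        add_sub_cancel_left]
      simp only [LinearMap.comp_apply, LinearMap.sub_apply, LinearMap.id_apply]
      rw [R.d_h _ (h.d_defect w hwn'.le).1, map_neg]
      abel
  · rw [pull₂_congr_op φ fun u hu => hg1 u (by omega)]
    exact h.form a v b w hab hab'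

/-- By a change of `g` in length `n` one arranges that the pullback of `φ` has no component with
`n + 1` arguments. -/
theorem IsTransfer.exists_form_succ [CharZero k] [FiniteDimensional k U] {d : ℤ} {n : ℕ}
    {m : Word gr → Homog gr} {g : Word gr → Homog A.gr}
    (hφ : IsStrongHomotopyInnerProduct d φ) {ω : U →ₗ[k] U →ₗ[k] k}
    (hω : ∀ x y : Homog gr, ω x.val y.val = φ [] (R.incl x) [] (R.incl y))
    (h : IsTransfer R φ (n + 1) n m g) (hn : 2 ≤ n) :
    ∃ g', IsTransfer R φ (n + 1) (n + 1) m g' ∧ ∀ w : Word gr, w.length < n → g' w = g w := by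
  obtain ⟨α, hα, rfl⟩ := hφ.exists_primitive
  set φ := dForm α with hφα
  -- With `β = g^*α`, the correction `i ξ` is chosen so that `ω(ξ(u), y) = -β(u, y)`. The two terms
  -- by which the pullback changes then add up to `-dβ`, minus the component to be killed.
  obtain ⟨ξ, hξ, hξm, hξω⟩ := Retract.exists_hamiltonian hφ hω (hα.pull₁ h.g_op)
  obtain ⟨g', hg', hg1, hg2⟩ := h.g_op.exists_add (hξ.map R.i)
    (fun w => R.i_mem _ _ (by rw [add_zero]; exact hξm w)) (n := n) (by omega)
  have g1 : ∀ x, g' [x] = R.incl x := fun x => by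
    rw [hg1 [x] (by simp; omega), h.g_one]
  refine ⟨g', ⟨h.m_op, hg', h.m_small, g1, fun w hw => ?_, fun a v b w hab hab' => ?_⟩,
    fun w hw => hg1 w (by omega)⟩
  · by_cases hwn : w.length < n
    · rw [defect_congr_op h.m_op h.m_op h.g_op hg' (fun _ _ => rfl)
        fun u hu => hg1 u (by omega), h.rel w hw]
    -- The correction takes values in cycles, so the equation in length `n` is not disturbed.
    · have hwn' : w.length = n := by omega
      rw [defect_sub_of_agree h.m_small h.m_small h.g_op hg' h.g_one g1
        (by rintro rfl; simp at hwn'; omega) (fun _ _ => rfl)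
        fun u hu => hg1 u (by omega), hg2 w hwn', add_sub_cancel_left, h.rel w hw, R.d_i]
      simp
  · by_cases hab2 : a.length + b.length + 2 ≤ n
    · rw [pull₂_congr_op φ fun u hu => hg1 u (by omega)]
      exact h.form a v b w hab hab2
    by_cases hd : Word.deg a + v.1 + Word.deg b + w.1 = d
    · have hu : ∀ u : Word gr, u.length = n → ∀ y : Homog gr,
          φ [] (g' u) [] (R.incl y) - φ [] (g u) [] (R.incl y) = ω (ξ u) y.val := by
        intro u hu y
        obtain ⟨ℓ, hℓ⟩ := hφ.bimoduleMap.multilinear.linearOn_mid [] [] (R.incl y) (u.deg + 0)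
        have e := hℓ (R.incl ⟨u.deg, ⟨ξ u, hξm u⟩⟩) (add_zero _).symm
        simp only at e hℓ
        rw [← hω] at e
        refine Eq.trans ?_ e.symm
        rw [hℓ _ (hg'.deg u), hℓ _ (h.g_op.deg u), hg2 u hu, map_add, add_sub_cancel_left]
        rfl
      have hl1 : (a ++ v :: b).length = n := by simp; omega
      have hl2 : (b ++ w :: a).length = n := by simp; omega
      have key := pull₂_sub_of_agree (f := g) (f' := g') φ (v := v) (w := w) hab
        (fun u hu => hg1 u (by omega))
      -- Skew symmetry moves the changed block of `w` into the first slot, where `hu` evaluates it.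
      have hskew : ∀ u : Word gr, φ [] (R.incl v) [] (g' u) - φ [] (R.incl v) [] (g u) =
          -((v.1 * Word.deg u).negOnePow •
            (φ [] (g' u) [] (R.incl v) - φ [] (g u) [] (R.incl v))) := by
        intro u
        rw [hφ.skew [] (R.incl v) [] (g' u), hφ.skew [] (R.incl v) [] (g u), smul_sub]
        simp [hg'.deg, h.g_op.deg, Retract.incl]
        abel
      rw [h.g_one, h.g_one, hskew, hu _ hl1, hu _ hl2,
        hξω _ _ (by simp only [Word.deg_append, Word.deg_cons]; omega),
        hξω _ _ (by simp only [Word.deg_append, Word.deg_cons]; omega), hφα,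
        pull₂_dForm h.g_op, sub_eq_iff_eq_add] at key
      rw [hφα, key, dForm]
      simp only [smul_neg, neg_neg, negOnePow_smul_smul]
      have hsgn : (Word.deg a * (v.1 + Word.deg b + w.1) +
          v.1 * Word.deg (b ++ w :: a)).negOnePow =
          ((Word.deg a + v.1) * (Word.deg b + w.1)).negOnePow :=
        negOnePow_congr (by
          simp only [Word.deg_append, Word.deg_cons]
          push_cast
          grind)
      rw [hsgn]
      abel
    · exact pull₂_degree hg' hφ.bimoduleMap.degree a v b w hd

end Transfer

/-! ### The limit of the inductive construction -/

section Limit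

variable {k : Type u} [Field k]
variable {V : Type v} [AddCommGroup V] [Module k V] {A : Algebra k V}
variable {U : Type v} [AddCommGroup U] [Module k U] {gr : ℤ → Submodule k U}
variable {R : Retract A gr} {φ : DualMap A}

theorem IsTransfer.exists_succ [CharZero k] [FiniteDimensional k U] {d : ℤ} {n : ℕ}
    {m : Word gr → Homog gr} {g : Word gr → Homog A.gr}
    (hφ : IsStrongHomotopyInnerProduct d φ) {ω : U →ₗ[k] U →ₗ[k] k}
    (hω : ∀ x y : Homog gr, ω x.val y.val = φ [] (R.incl x) [] (R.incl y))
    (h : IsTransfer R φ n n m g) (hn : 2 ≤ n) :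
    ∃ m' g', IsTransfer R φ (n + 1) (n + 1) m' g' ∧
      ∀ w : Word gr, w.length < n → m' w = m w ∧ g' w = g w := by
  obtain ⟨m', g₁, h₁, hw₁⟩ := h.exists_rel_succ hn le_rfl
  obtain ⟨g', h', hw'⟩ := h₁.exists_form_succ hφ hω hn
  exact ⟨m', g', h', fun w hw => ⟨(hw₁ w hw).1, (hw' w hw).trans (hw₁ w hw).2⟩⟩

theorem IsTransfer.exists_limit [CharZero k] [FiniteDimensional k U] {d : ℤ}
    (hφ : IsStrongHomotopyInnerProduct d φ) {ω : U →ₗ[k] U →ₗ[k] k}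
    (hω : ∀ x y : Homog gr, ω x.val y.val = φ [] (R.incl x) [] (R.incl y)) :
    ∃ m g, ∀ n, IsTransfer R φ n n m g := by
  obtain ⟨m₀, g₀, h₀⟩ := IsTransfer.exists_base R φ
  choose! M G hMG hagree using fun n m g (h : IsTransfer R φ n n m g) (hn : 2 ≤ n) =>
    h.exists_succ hφ hω hn
  -- `s n` is valid up to level `n + 2`, and later stages leave words of length less than `n + 2`
  -- alone. Hence stage `|w|` already has the final value on `w`.
  let s : ℕ → (Word gr → Homog gr) × (Word gr → Homog A.gr) := fun n =>
    Nat.rec (m₀, g₀) (fun n x => (M (n + 2) x.1 x.2, G (n + 2) x.1 x.2)) n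
  have hs : ∀ n, IsTransfer R φ (n + 2) (n + 2) (s n).1 (s n).2 := by
    intro n
    induction n with
    | zero => exact h₀
    | succ n ih => exact hMG (n + 2) _ _ ih (by omega)
  have hst : ∀ (j n : ℕ) (w : Word gr), w.length < j + 2 →
      (s (j + n)).1 w = (s j).1 w ∧ (s (j + n)).2 w = (s j).2 w := by
    intro j n w hw
    induction n with
    | zero => exact ⟨rfl, rfl⟩
    | succ n ih =>
      have h := hagree (j + n + 2) _ _ (hs (j + n)) (by omega) w (by omega)
      exact ⟨h.1.trans ih.1, h.2.trans ih.2⟩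
  let m : Word gr → Homog gr := fun w => (s w.length).1 w
  let g : Word gr → Homog A.gr := fun w => (s w.length).2 w
  have hm : ∀ (n : ℕ) (w : Word gr), w.length ≤ n → m w = (s n).1 w ∧ g w = (s n).2 w := by
    intro n w hw
    obtain ⟨c, rfl⟩ := Nat.exists_eq_add_of_le hw
    have h := hst w.length c w (by omega)
    exact ⟨h.1.symm, h.2.symm⟩
  have hlen : ∀ (p q : Word gr) (x : Homog gr), (p ++ x :: q).length ≤ p.length + (q.length + 1) :=
    fun p q x => by simp
  have m_op : IsOp 1 m := ⟨fun w => (hs _).m_op.deg w, fun p q j =>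
    ((hs (p.length + (q.length + 1))).m_op.ml p q j).congr fun x _ =>
      congrArg Homog.val (hm _ _ (hlen p q x)).1, (hs 0).m_op.nil⟩
  have g_op : IsOp 0 g := ⟨fun w => (hs _).g_op.deg w, fun p q j =>
    ((hs (p.length + (q.length + 1))).g_op.ml p q j).congr fun x _ =>
      congrArg Homog.val (hm _ _ (hlen p q x)).2, (hs 0).g_op.nil⟩
  refine ⟨m, g, fun n => ⟨m_op, g_op, fun w hw => (hs _).m_small w hw, fun x => (hs 1).g_one x,
    fun w hw => ?_, fun a v b w hab hab' => ?_⟩⟩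
  · rw [defect_congr_op (hs n).m_op m_op (hs n).g_op g_op (fun u hu => (hm n u (by omega)).1)
      fun u hu => (hm n u (by omega)).2]
    exact (hs n).rel w (by omega)
  · rw [pull₂_congr_op φ fun u hu => (hm n u (by omega)).2]
    exact (hs n).form a v b w hab (by omega)

end Limit

/-! ### Cyclic minimal models and equivalence -/

section CyclicModels

variable {k : Type u} [Field k]
variable {V : Type v} [AddCommGroup V] [Module k V] {A : Algebra k V}
variable {U : Type v} [AddCommGroup U] [Module k U]
variable {W : Type v} [AddCommGroup W] [Module k W] {B : Algebra k W}

theorem ofInnerProduct_eq_zero (C : Algebra k U) (β : U →ₗ[k] U →ₗ[k] k) {a b : Word C.gr}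
    {v w : Homog C.gr} (h : 0 < a.length + b.length) : ofInnerProduct C β a v b w = 0 := by
  cases a with
  | nil =>
    cases b with
    | nil => simp at h
    | cons y b => rfl
  | cons x a => rfl

/-- An inner product is cyclic, if it is a map of bimodules. -/
theorem cyclic_of_compOp_eq {C : Algebra k U} {β : U →ₗ[k] U →ₗ[k] k}
    (h : (ofInnerProduct C β).compOp = (ofInnerProduct C β).dualOpComp)
    (hs : ∀ x y : Homog C.gr, β x.val y.val = -((x.1 * y.1).negOnePow • β y.val x.val))
    (x : Homog C.gr) (u : Word C.gr) (y : Homog C.gr) :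
    β (C.op (x :: u)).val y.val =
      (x.1 * (u.deg + y.1)).negOnePow • β (C.op (u ++ [y])).val x.val := by
  have e := congrFun (congrFun (congrFun (congrFun h []) x) u) y
  have e1 : (ofInnerProduct C β).compOp [] x u y = β (C.op (x :: u)).val y.val := by
    rw [DualMap.compOp, sum₃, sum₂_nil, sum₂_nil, sum₂_nil, sum₂_eq_right]
    · rw [ofInnerProduct_eq_zero C β (by simp), smul_zero, zero_add, Word.deg_nil,
        Int.negOnePow_zero, one_smul, sum₃, sum₂_congr (G := fun _ _ => (0 : k)), sum₂_zero, add_zero]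
      · rfl
      · intro b₁ r _
        rw [← sum₂_zero (M := k) r]
        refine sum₂_congr fun b₂ b₃ _ => ?_
        rw [ofInnerProduct_eq_zero C β (by simp), smul_zero]
    · intro b₁ b₂ _ hb
      rw [ofInnerProduct_eq_zero C β (by simpa [List.length_pos_iff] using hb), smul_zero]
  have e2 : (ofInnerProduct C β).dualOpComp [] x u y =
      -(x.1.negOnePow • β x.val (C.op (u ++ [y])).val) := by
    rw [DualMap.dualOpComp, sum₂_nil, sum₂_eq_left]
    · simp [Algebra.dualOp]
      rfl
    · intro b₁ b₂ _ hb
      rw [Algebra.dualOp, ofInnerProduct_eq_zero C β (by simpa [List.length_pos_iff] using hb),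
        smul_zero, neg_zero]
  -- For a constant form, the bimodule equation with empty left word has one surviving term on each
  -- side; skew symmetry turns it into cyclicity.
  rw [e1, e2, hs x, C.isOp.deg, smul_neg, neg_neg, negOnePow_smul_smul] at e
  rw [e]
  congr 1
  refine negOnePow_congr ?_
  simp only [Word.deg_append, Word.deg_cons, Word.deg_nil]
  push_cast
  grind

/-- A strong homotopy inner product pulls back to a cyclic inner product on a minimal model. -/
theorem IsStrongHomotopyInnerProduct.exists_cyclic_model [CharZero k]
    [FiniteDimensional k A.Cohomology] {d : ℤ} {φ : DualMap A}
    (hφ : IsStrongHomotopyInnerProduct d φ) :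
    ∃ (U : Type v) (_ : AddCommGroup U) (_ : Module k U) (C : Algebra k U)
      (β : U →ₗ[k] U →ₗ[k] k) (G : Hom C A),
      IsCyclicInnerProduct C d β ∧ G.IsQuasiIso ∧ G.pullback φ = ofInnerProduct C β := by
  obtain ⟨U, _, _, gr, ⟨R⟩⟩ := A.exists_retract
  have := R.finiteDimensional
  obtain ⟨ω, hω⟩ := R.exists_form hφ.bimoduleMap.multilinear
  obtain ⟨m, g, hmg⟩ := IsTransfer.exists_limit (R := R) hφ hω
  have hm := (hmg 0).m_op
  have hrel : ∀ w, der m (fun u => (m u).val) w = 0 := fun w =>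
    ((hmg w.length).d_defect w le_rfl).2
  let C : Algebra k U := Algebra.ofOp R.internal hm hrel
  have hC : C.op = m := Algebra.ofOp_op R.internal hm hrel
  obtain ⟨G, hG⟩ := Hom.exists_of_op (A := C) (B := A) (f := g) (hmg 0).g_op fun w => by
    rw [hC]
    exact sub_eq_zero.1 ((hmg (w.length + 1)).rel w (by omega))
  have hd : ∀ x, C.d x = 0 := by
    intro x
    induction x using homogeneous_induction C.internal with
    | hom n x hx =>
      have h := C.op_singleton ⟨n, ⟨x, hx⟩⟩
      rw [hC, (hmg 0).m_small _ le_rfl] at h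
      exact h.symm
    | add x y hx hy => rw [map_add, hx, hy, add_zero]
  have hl : ∀ x, G.linear x = R.i x := by
    intro x
    induction x using homogeneous_induction C.internal with
    | hom n x hx =>
      have h := G.op_singleton ⟨n, ⟨x, hx⟩⟩
      rw [hG, (hmg 0).g_one] at h
      exact h.symm
    | add x y hx hy => rw [map_add, map_add, hx, hy]
  have hq : G.IsQuasiIso := by
    rw [Hom.isQuasiIso_iff]
    refine ⟨fun x _ hx => ?_, fun y hy => ⟨R.p y, hd _, ?_⟩⟩
    · rw [hl] at hx
      rw [R.eq_zero_of_mem_range hx]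
      exact zero_mem _
    · rw [hl]
      exact ⟨_, R.d_h y hy⟩
  have hp : G.pullback φ = ofInnerProduct C ω := by
    funext a v b w
    rw [G.pullback_eq, hG]
    by_cases hab : 0 < a.length + b.length
    · rw [ofInnerProduct_eq_zero C ω hab]
      exact (hmg _).form a v b w hab le_rfl
    · obtain rfl : a = [] := List.length_eq_zero_iff.1 (by omega)
      obtain rfl : b = [] := List.length_eq_zero_iff.1 (by omega)
      rw [pull₂_nil, (hmg 0).g_one, (hmg 0).g_one]
      exact (hω v w).symm
  -- Cyclicity need not be arranged in the construction: the pullback theorem applied to `G`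
  -- supplies the bimodule equation of the constant form.
  have heq := (hφ.pullback G hq).bimoduleMap.equation
  rw [hp] at heq
  exact ⟨U, _, _, C, ω, G, ⟨Retract.form_degree hφ hω, Retract.form_skew hφ hω,
    Retract.form_nondegenerate hφ hω, cyclic_of_compOp_eq heq (Retract.form_skew hφ hω)⟩, hq, hp⟩

/-- A cyclic model `G` of `f^*φ`, composed with `f`, is a cyclic model of `φ` with the same inner
product. Finite dimension passes to the cohomology of `A` along the injection induced by `f`. -/
theorem IsStrongHomotopyInnerProduct.equivalent_pullback [CharZero k]
    [FiniteDimensional k B.Cohomology] {d : ℤ} {φ : DualMap B}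
    (hφ : IsStrongHomotopyInnerProduct d φ) (f : Hom A B) (hf : f.IsQuasiIso) :
    Equivalent d (f.pullback φ) φ := by
  have : FiniteDimensional k A.Cohomology := .of_injective f.cohomologyMap hf.1
  obtain ⟨U, _, _, C, β, G, hβ, hG, hp⟩ := (hφ.pullback f hf).exists_cyclic_model
  obtain ⟨H, hH⟩ := f.exists_comp G
  exact ⟨U, _, _, C, β, G, H, hβ, hG, Hom.isQuasiIso_of_comp hH hf hG, hp,
    (Hom.pullback_of_comp hH hφ).trans hp⟩

end CyclicModels

end AInf

theorem mainTheorem5 {k : Type u} [Field k] [CharZero k]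
    {V W : Type v} [AddCommGroup V] [Module k V] [AddCommGroup W] [Module k W]
    (A : AInf.Algebra k V) (B : AInf.Algebra k W)
    [FiniteDimensional k B.Cohomology]
    (d : ℤ) (φ : AInf.DualMap B) (hφ : AInf.IsStrongHomotopyInnerProduct d φ)
    (f : AInf.Hom A B) (hf : f.IsQuasiIso) :
    AInf.IsStrongHomotopyInnerProduct d (f.pullback φ) ∧
      AInf.Equivalent d (f.pullback φ) φ := by
  exact ⟨hφ.pullback f hf, hφ.equivalent_pullback f hf⟩
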